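/- Let $A$ be a real number and $d$ a natural number, and consider all primes $p$ and $q$ with $q \mid p-1$ and $(p-1)/q \le A(\log p)^d$ (that is, $q = (p-1)/\mathrm{polylog}(p)$), together with an element $a \in \mathbb{Z}_p^*$ of order $q$. Let $G = \mathbb{Z}_q \ltimes \mathbb{Z}_p$ be the group of pairs $(a^t, b)$, $b \in \mathbb{Z}_p$, with the product $(\alpha, b)(\alpha', b') = (\alpha\alpha', b + \alpha b')$, where $(\alpha, b)$ is encoded by the binary digits of the residues $\alpha$ and $b$ modulo $p$. Then the subgroups of these groups are fully reconstructible, that is, the hidden subgroup problem for them is solved with high probability by quantum circuits of size polynomial in $\log |G|$. Precisely: there are constants $C$ and $k$, depending only on $A$ and $d$, such that for all such $p, q, a$, every $m \in \mathbb{N}$ and every $0 < \varepsilon < 1$ there is a quantum circuit of size at most $$C\,\bigl(1 + \log |G| + \log(1/\varepsilon)\bigr)^k$$ with the following property. For every subgroup $H \le G$ and every function $f : G \to \{0,1\}^m$ that is constant on each left coset of $H$ and takes distinct values on distinct left cosets, the circuit, run with the oracle for $f$, puts out the code words of a family of elements that generate $H$, with probability at least $1 - \varepsilon$. Here a quantum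 circuit starts in the state $|0\dots0\rangle$ of finitely many qubits, applies a sequence of gates, and ends with a measurement in the computational basis; a gate is any unitary operation on at most three qubits or one oracle query $|u\rangle|w\rangle \mapsto |u\rangle|w \oplus F(u)\rangle$, where $F$ sends the code word of $g$ to $f(g)$ and all other bit strings to $0$; and the size is the number of gates plus the number of group elements put out. -/

import Mathlib

noncomputable section

namespace HSP

/-! ### Quantum circuits with an oracle -/

/-- A pure state of the qubits `W`: the amplitudes of the computational basis states. -/
abbrev QState (W : Type) : Type := (W → Bool) → ℂ

/-- A gate on the wires `W`, for an oracle with input bits indexed by `β` and `m` output bits: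
either an arbitrary unitary on at most three wires, or a query to the oracle whose input and
output registers are placed on pairwise distinct wires. -/
inductive Gate (β : Type) (m : ℕ) (W : Type) : Type
  | unitary (k : ℕ) (hk : k ≤ 3) (s : Fin k ↪ W)
      (U : Matrix.unitaryGroup (Fin k → Bool) ℂ) : Gate β m W
  | query (x : β ↪ W) (y : Fin m ↪ W) (hxy : ∀ b j, x b ≠ y j) : Gate β m W

/-- The action of a `k`-qubit operator on the wires `s 0, …, s (k - 1)`, the identity being
applied to all the other wires.  (`Function.extend s z v` is the basis state `v` in which the
bits on the wires `s` are replaced by `z`.) -/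
def applyUnitary {W : Type} {k : ℕ} (s : Fin k ↪ W)
    (U : Matrix (Fin k → Bool) (Fin k → Bool) ℂ) (ψ : QState W) : QState W :=
  fun v => ∑ z : Fin k → Bool, U (fun j => v (s j)) z * ψ (Function.extend s z v)

/-- The basis permutation `|u⟩|w⟩ ↦ |u⟩|w ⊕ F u⟩`, where `u` is read on the wires `x` and `w`
on the wires `y`. -/
def queryMap {β W : Type} {m : ℕ} (F : (β → Bool) → Fin m → Bool) (x : β ↪ W) (y : Fin m ↪ W)
    (v : W → Bool) : W → Bool :=
  Function.extend y (fun j => xor (v (y j)) (F (fun b => v (x b)) j)) v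

/-- The action of a gate on states, for the oracle `F`.  (`queryMap` is an involution, so that
precomposing the amplitudes with it realizes the query.) -/
def Gate.apply {β : Type} {m : ℕ} {W : Type} (F : (β → Bool) → Fin m → Bool) :
    Gate β m W → QState W → QState W
  | .unitary _ _ s U, ψ => applyUnitary s U.1 ψ
  | .query x y _, ψ => fun v => ψ (queryMap F x y v)

/-- A quantum circuit on the wires `W`, with oracle gates.  After the gates, all the wires are
measured in the computational basis, and the bits on the wires `out i b`, `b : β`, are read as
the `i`-th of `numOut` bit strings put out by the circuit. -/
structure Circuit (β : Type) (m : ℕ) (W : Type) : Type where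
  gates : List (Gate β m W)
  numOut : ℕ
  out : Fin numOut → β → W

namespace Circuit

variable {β : Type} {m : ℕ} {W : Type}

/-- The size: the number of gates (a query counts as one gate), plus the number of bit strings
put out. -/
def size (c : Circuit β m W) : ℕ := c.gates.length + c.numOut

/-- The state in which the circuit leaves the wires when started on `|0…0⟩`; the gates act in
the order of the list. -/
def finalState [DecidableEq (W → Bool)] (c : Circuit β m W) (F : (β → Bool) → Fin m → Bool) :
    QState W :=
  c.gates.foldl (fun ψ g => g.apply F ψ) (Pi.single (fun _ => false) 1)

/-- The probability that the final measurement has an outcome in the set `E`. -/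
def prob [Fintype W] [DecidableEq W] (c : Circuit β m W) (F : (β → Bool) → Fin m → Bool)
    (E : Set (W → Bool)) : ℝ :=
  ∑ v : W → Bool, E.indicator (fun v => ‖c.finalState F v‖ ^ 2) v

end Circuit

/-! ### The hidden subgroup problem -/

/-- `f` is constant on each left coset of `H` and takes distinct values on distinct ones. -/
def Hides {G S : Type} [Group G] (f : G → S) (H : Subgroup G) : Prop :=
  ∀ g g' : G, f g = f g' ↔ g⁻¹ * g' ∈ H

/-- The function that the oracle for `f : G → {0,1}^m` evaluates: it sends the code word of
`g` to `f g`, and it sends bit strings that are not code words to zero. -/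
def oracle {G β : Type} {m : ℕ} (enc : G ↪ (β → Bool)) (f : G → Fin m → Bool) :
    (β → Bool) → Fin m → Bool :=
  Function.extend enc f (fun _ _ => false)

/-- The measurement outcomes for which the bit strings put out are the code words of a family
of generators of `H`. -/
def correctOutcomes {G β W : Type} {m : ℕ} [Group G] (enc : G ↪ (β → Bool))
    (c : Circuit β m W) (H : Subgroup G) : Set (W → Bool) :=
  {v | ∃ g : Fin c.numOut → G,
    (∀ i, enc (g i) = fun b => v (c.out i b)) ∧ Subgroup.closure (Set.range g) = H}

/-- Subgroups of the family of groups `G i`, whose elements are encoded as bit strings by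
`enc i`, are fully reconstructible: there is a polynomial such that for each group `G i`, each
length `m` of the oracle's values and each error `ε`, a quantum circuit of size polynomial in
`log |G i|` and `log (1 / ε)` finds, for every subgroup `H` and every function `f` that hides
`H`, generators of `H` with probability at least `1 - ε`. -/
def FullyReconstructible {ι : Type} (G : ι → Type) [∀ i, Group (G i)] (β : ι → Type)
    (enc : ∀ i, G i ↪ (β i → Bool)) : Prop :=
  ∃ (C : ℝ) (k : ℕ), ∀ (i : ι) (m : ℕ) (ε : ℝ), 0 < ε → ε < 1 →
    ∃ (W : Type) (_ : Fintype W) (_ : DecidableEq W) (c : Circuit (β i) m W),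
      (c.size : ℝ) ≤ C * (1 + Real.log (Nat.card (G i)) + Real.log (1 / ε)) ^ k ∧
      ∀ (H : Subgroup (G i)) (f : G i → Fin m → Bool), Hides f H →
        1 - ε ≤ c.prob (oracle (enc i) f) (correctOutcomes (enc i) c H)

/-! ### The groups `ℤ_q ⋉ ℤ_p` -/

/-- The action of the cyclic group generated by `a` on the additive group of integers
modulo `p` by multiplication. -/
def mulAction (p : ℕ) (a : (ZMod p)ˣ) :
    Subgroup.zpowers a →* MulAut (Multiplicative (ZMod p)) where
  toFun α := AddEquiv.toMultiplicative (DistribMulAction.toAddEquiv (ZMod p) (α : (ZMod p)ˣ))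
  map_one' := by
    ext b
    exact congrArg Multiplicative.ofAdd (one_smul (ZMod p)ˣ b.toAdd)
  map_mul' α α' := by
    ext b
    exact congrArg Multiplicative.ofAdd (mul_smul (α : (ZMod p)ˣ) (α' : (ZMod p)ˣ) b.toAdd)

/-- For `a` of order `q` modulo `p`, the group `ℤ_q ⋉ ℤ_p` of the pairs `(a ^ t, b)`, that is,
of the maps `x ↦ a ^ t * x + b` on the integers modulo `p`.  In Mathlib's semidirect product
`b` is the left component and `a ^ t` the right one. -/
abbrev QHedral (p : ℕ) (a : (ZMod p)ˣ) : Type :=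
  Multiplicative (ZMod p) ⋊[mulAction p a] Subgroup.zpowers a

/-- The product is `(α, b) * (α', b') = (α * α', b + α * b')`. -/
theorem QHedral.mul_def (p : ℕ) (a : (ZMod p)ˣ) (g h : QHedral p a) :
    (g * h).right = g.right * h.right ∧
      (g * h).left.toAdd =
        g.left.toAdd + ((g.right : (ZMod p)ˣ) : ZMod p) * h.left.toAdd :=
  ⟨rfl, rfl⟩

/-- The binary digits of the representative in `{0, …, p - 1}` of a residue modulo `p`. -/
def bits (p : ℕ) (x : ZMod p) : Fin (Nat.size p) → Bool := fun j => x.val.testBit j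

theorem bits_injective (p : ℕ) [NeZero p] : Function.Injective (bits p) := by
  intro x y h
  apply ZMod.val_injective p
  apply Nat.eq_of_testBit_eq
  intro j
  by_cases hj : j < Nat.size p
  · exact congrFun h ⟨j, hj⟩
  · have hlt : ∀ z : ZMod p, z.val < 2 ^ j := fun z =>
      ((ZMod.val_lt z).trans (Nat.lt_size_self p)).trans_le
        (Nat.pow_le_pow_right (by norm_num) (not_lt.mp hj))
    rw [Nat.testBit_eq_false_of_lt (hlt x), Nat.testBit_eq_false_of_lt (hlt y)]

/-- The element `(a ^ t, b)` is encoded by the binary digits of the two residues `a ^ t` and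
`b` modulo `p`. -/
def QHedral.enc (p : ℕ) [NeZero p] (a : (ZMod p)ˣ) :
    QHedral p a ↪ (Fin (Nat.size p) ⊕ Fin (Nat.size p) → Bool) where
  toFun g := Sum.elim (bits p ((g.right : (ZMod p)ˣ) : ZMod p)) (bits p g.left.toAdd)
  inj' := by
    intro g h hgh
    have h1 : bits p ((g.right : (ZMod p)ˣ) : ZMod p) = bits p ((h.right : (ZMod p)ˣ) : ZMod p) :=
      funext fun j => congrFun hgh (Sum.inl j)
    have h2 : bits p g.left.toAdd = bits p h.left.toAdd :=
      funext fun j => congrFun hgh (Sum.inr j)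
    apply SemidirectProduct.ext
    · exact Multiplicative.toAdd.injective (bits_injective p h2)
    · exact Subtype.ext (Units.ext (bits_injective p h1))

/-- Primes `p` and `q` with `(p - 1) / q ≤ A * (log p) ^ d`, and an element `a` of order `q`
modulo `p` (so that `q ∣ p - 1`). -/
structure Params (A : ℝ) (d : ℕ) : Type where
  p : ℕ
  q : ℕ
  prime_p : p.Prime
  prime_q : q.Prime
  a : (ZMod p)ˣ
  orderOf_a : orderOf a = q
  index_le : ((p : ℝ) - 1) / q ≤ A * Real.log p ^ d

instance Params.neZero {A : ℝ} {d : ℕ} (i : Params A d) : NeZero i.p :=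
  ⟨i.prime_p.ne_zero⟩

end HSP

end

/-! The group consists of the affine maps `x ↦ α * x + c` of the integers modulo `p`, with `α` a
power of `a`. Since `p` and `q` are prime, a subgroup `H` is trivial, the group of all translations,
the stabilizer of a point `b`, or the whole group. Hence `H` is generated by the translation by one,
if it lies in `H`, together with any one element of `H` that is not a translation, if there is one
(`QHedral.exists_fixed_point`, `QHedral.eq_of_le_of_mem`). The translation is a fixed candidate that
only has to be tested; the other generator has to be found.

Let `H` be the stabilizer of `b`. Its left cosets are the sets of all `g` with `g(b) = z`, that is,
of all pairs `(α, z - α * b)` (`QHedral.hides_eq_iff`). The algorithm ignores the noncommutative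
structure: it queries the oracle in superposition and applies an abelian Fourier transform to both
components. At the frequencies `(s, t)` with `s = t * b` the exponent `α * s + (z - α * b) * t`
equals `z * t` for every `α`, so all `q` terms of the amplitude have the same phase. There are about
`p ^ 2` pairs `(t, z)`, each with probability of order `q ^ 2 / p ^ 4`. So with probability of order
`(q / p) ^ 2`, which is inverse polylogarithmic in `p`, the outcome gives `b = s / t` and with it a
nontrivial stabilizing element. Replacing the modulus `p` by a power of two perturbs the phases only
slightly and costs a constant factor (`QHedral.norm_sum_ex_ge`, `QHedral.exists_fourier_sampling`).

Wrong candidates must not be put out. As `g ∈ H` exactly if `f g = f 1`, an interference test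
compares two oracle values: it always passes if they agree and passes with probability `1 / 2`
otherwise (`mass_checkState`). A candidate that fails one of `k` tests is replaced by the identity
(`exists_verified`). With `N` independent samples and the one fixed candidate, the error is at most
`(N + 1) / 2 ^ k + (1 - ρ) ^ N`, where `ρ` is the success probability of a sample
(`exists_circuit_of_samplers`).

For the size, classical computations are straight-line programs (`Derives`), compiled at one gate
and one ancilla per operation (`Derives.compile`). Scratch values need not be erased: later gates
use the computed register only as a control, and it is measured at the end in the computational
basis. -/

noncomputable section

namespace HSP

open Function

/-! ### Elementary gates and general properties of circuits -/

section Gates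

variable {β : Type} {m : ℕ} {W W' : Type} {F : (β → Bool) → Fin m → Bool}

/-- The state reached from `ψ` by a list of gates. -/
def run (F : (β → Bool) → Fin m → Bool) (gs : List (Gate β m W)) (ψ : QState W) : QState W :=
  gs.foldl (fun ψ g => g.apply F ψ) ψ

theorem run_nil (ψ : QState W) : run F [] ψ = ψ := rfl

theorem run_cons (g : Gate β m W) (gs : List (Gate β m W)) (ψ : QState W) :
    run F (g :: gs) ψ = run F gs (g.apply F ψ) := rfl

theorem run_append (gs hs : List (Gate β m W)) (ψ : QState W) :
    run F (gs ++ hs) ψ = run F hs (run F gs ψ) := by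
  simp [run, List.foldl_append]

open Classical in
/-- The indicator of a proposition, as an amplitude. -/
def ind (P : Prop) : ℂ := if P then 1 else 0

theorem ind_pos {P : Prop} (h : P) : ind P = 1 := by simp [ind, h]

theorem ind_neg {P : Prop} (h : ¬ P) : ind P = 0 := by simp [ind, h]

theorem ind_and (P Q : Prop) : ind (P ∧ Q) = ind P * ind Q := by
  by_cases hP : P <;> by_cases hQ : Q <;> simp [ind, hP, hQ]

/-- The basis state `|0…0⟩`. -/
def zeroState : QState W := fun v => ind (v = fun _ => false)

/-- The weight that a state gives to a set of outcomes. -/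
def mass [Fintype W] [DecidableEq W] (ψ : QState W) (E : Set (W → Bool)) : ℝ :=
  ∑ v : W → Bool, E.indicator (fun v => ‖ψ v‖ ^ 2) v

theorem finalState_eq [DecidableEq (W → Bool)] (c : Circuit β m W) :
    c.finalState F = run F c.gates zeroState := by
  have : (Pi.single (fun _ => false) 1 : QState W) = zeroState := by
    funext v
    simp only [Pi.single_apply, zeroState, ind]
    congr
  rw [Circuit.finalState, this]
  rfl

theorem prob_eq_mass [Fintype W] [DecidableEq W] (c : Circuit β m W) (E : Set (W → Bool)) :
    c.prob F E = mass (run F c.gates zeroState) E := by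
  rw [Circuit.prob, mass, finalState_eq]

/-! ### Weights of sets of outcomes -/

section Mass

variable [Fintype W] [DecidableEq W]

theorem mass_nonneg (ψ : QState W) (E : Set (W → Bool)) : 0 ≤ mass ψ E :=
  Finset.sum_nonneg fun v _ => Set.indicator_nonneg (fun _ _ => by positivity) v

theorem mass_mono (ψ : QState W) {E E' : Set (W → Bool)} (h : E ⊆ E') :
    mass ψ E ≤ mass ψ E' :=
  Finset.sum_le_sum fun v _ =>
    Set.indicator_le_indicator_of_subset h (fun _ => by positivity) v

theorem mass_compl (ψ : QState W) (E : Set (W → Bool)) :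
    mass ψ Eᶜ = mass ψ Set.univ - mass ψ E := by
  rw [eq_sub_iff_add_eq, mass, mass, mass, ← Finset.sum_add_distrib]
  refine Finset.sum_congr rfl fun v _ => ?_
  by_cases h : v ∈ E <;> simp [h]

theorem mass_diff (ψ : QState W) {E E' : Set (W → Bool)} (h : E' ⊆ E) :
    mass ψ (E \ E') = mass ψ E - mass ψ E' := by
  rw [eq_sub_iff_add_eq, mass, mass, mass, ← Finset.sum_add_distrib]
  refine Finset.sum_congr rfl fun v _ => ?_
  by_cases hE' : v ∈ E'
  · simp [hE', h hE']
  · by_cases hE : v ∈ E <;> simp [hE, hE']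

theorem mass_zeroState_univ : mass (zeroState : QState W) Set.univ = 1 := by
  simp only [mass, Set.indicator_univ, zeroState]
  rw [Finset.sum_eq_single (fun _ => false)]
  · simp [ind]
  · intro v _ hv
    simp [ind, hv]
  · simp

theorem sum_le_mass {κ : Type} (ψ : QState W) (E : Set (W → Bool)) (S : Finset κ)
    (g : κ → W → Bool) (hg : Set.InjOn g S) (hE : ∀ k ∈ S, g k ∈ E) :
    ∑ k ∈ S, ‖ψ (g k)‖ ^ 2 ≤ mass ψ E := by
  classical
  calc ∑ k ∈ S, ‖ψ (g k)‖ ^ 2 = ∑ k ∈ S, E.indicator (fun v => ‖ψ v‖ ^ 2) (g k) :=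
        Finset.sum_congr rfl fun k hk => by rw [Set.indicator_of_mem (hE k hk)]
    _ = ∑ v ∈ S.image g, E.indicator (fun v => ‖ψ v‖ ^ 2) v := (Finset.sum_image hg).symm
    _ ≤ _ := Finset.sum_le_sum_of_subset_of_nonneg (Finset.subset_univ _)
        fun v _ _ => Set.indicator_nonneg (fun _ _ => by positivity) v

end Mass

/-! #### Gates preserve the norm -/

theorem extend_comp_self {k : ℕ} (s : Fin k ↪ W) (z : Fin k → Bool) (v : W → Bool) :
    (extend s z v) ∘ s = z := funext fun j => s.injective.extend_apply z v j

theorem extend_extend {α : Type} (s : α ↪ W) (z z' : α → Bool) (v : W → Bool) :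
    extend s z (extend s z' v) = extend s z v := by
  funext w
  by_cases h : ∃ j, s j = w
  · obtain ⟨j, rfl⟩ := h
    simp [s.injective.extend_apply]
  · simp [extend_apply' _ _ _ h]

theorem extend_self {α : Type} (s : α ↪ W) (v : W → Bool) : extend s (v ∘ s) v = v := by
  funext w
  by_cases h : ∃ j, s j = w
  · obtain ⟨j, rfl⟩ := h
    simp [s.injective.extend_apply]
  · simp [extend_apply' _ _ _ h]

theorem sum_norm_mulVec {n : Type} [Fintype n] [DecidableEq n]
    (U : Matrix.unitaryGroup n ℂ) (x : n → ℂ) :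
    ∑ i, ‖(U.1.mulVec x) i‖ ^ 2 = ∑ i, ‖x i‖ ^ 2 := by
  have key : ∀ y : n → ℂ, ((∑ i, ‖y i‖ ^ 2 : ℝ) : ℂ) = star y ⬝ᵥ y := by
    intro y
    simp [dotProduct, Complex.conj_mul']
  have h : star (U.1.mulVec x) ⬝ᵥ U.1.mulVec x = star x ⬝ᵥ x := by
    rw [Matrix.star_mulVec, Matrix.dotProduct_mulVec, Matrix.vecMul_vecMul]
    have : U.1.conjTranspose * U.1 = 1 := U.2.1
    rw [this, Matrix.vecMul_one]
  rw [← key, ← key] at h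
  exact_mod_cast h

/-- Exchanging `z` with the bits of `v` on the wires `s` is an involution of the pairs `(v, z)`, so
each basis state is counted `2 ^ k` times. This splits the norm of a state into blocks on which a
gate acts by its matrix. -/
theorem sum_extend [Fintype W] [DecidableEq W] {k : ℕ} (s : Fin k ↪ W) (f : (W → Bool) → ℝ) :
    ∑ v, ∑ z, f (extend s z v) = 2 ^ k * ∑ v, f v := by
  let e : (W → Bool) × (Fin k → Bool) ≃ (W → Bool) × (Fin k → Bool) :=
    { toFun := fun x => (extend s x.2 x.1, x.1 ∘ s)
      invFun := fun x => (extend s x.2 x.1, x.1 ∘ s)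
      left_inv := fun x => by
        simp [extend_extend, extend_self, extend_comp_self]
      right_inv := fun x => by
        simp [extend_extend, extend_self, extend_comp_self] }
  calc ∑ v, ∑ z, f (extend s z v) = ∑ x : (W → Bool) × (Fin k → Bool), f (e x).1 := by
        rw [Fintype.sum_prod_type]
        rfl
    _ = ∑ x : (W → Bool) × (Fin k → Bool), f x.1 := Equiv.sum_comp e fun x => f x.1
    _ = _ := by
        rw [Fintype.sum_prod_type]
        simp [Finset.mul_sum]

theorem queryMap_involutive (x : β ↪ W) (y : Fin m ↪ W) (hxy : ∀ b j, x b ≠ y j) :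
    Involutive (queryMap F x y) := by
  intro v
  have hx : (fun b => queryMap F x y v (x b)) = fun b => v (x b) := by
    funext b
    exact extend_apply' _ _ _ fun ⟨j, hj⟩ => hxy b j hj.symm
  have hy : ∀ j, queryMap F x y v (y j) = xor (v (y j)) (F (fun b => v (x b)) j) :=
    fun j => y.injective.extend_apply _ _ _
  conv_lhs => rw [queryMap]
  simp only [hx, hy]
  rw [queryMap, extend_extend]
  simp only [Bool.xor_assoc, Bool.xor_self, Bool.xor_false]
  exact extend_self y v

theorem mass_apply [Fintype W] [DecidableEq W] (g : Gate β m W) (ψ : QState W) :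
    mass (g.apply F ψ) Set.univ = mass ψ Set.univ := by
  simp only [mass, Set.indicator_univ]
  cases g with
  | unitary k hk s U =>
    have h1 := sum_extend s fun v => ‖applyUnitary s U.1 ψ v‖ ^ 2
    have h2 := sum_extend s fun v => ‖ψ v‖ ^ 2
    -- On the basis states that agree with `v` off `s`, the gate is multiplication by the unitary
    -- matrix `U`.
    have h3 : ∀ v, ∑ z, ‖applyUnitary s U.1 ψ (extend s z v)‖ ^ 2
        = ∑ z, ‖ψ (extend s z v)‖ ^ 2 := by
      intro v
      rw [← sum_norm_mulVec U fun z => ψ (extend s z v)]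
      refine Finset.sum_congr rfl fun z _ => ?_
      simp only [applyUnitary, extend_extend, Matrix.mulVec, dotProduct]
      have : (fun j => extend s z v (s j)) = z := extend_comp_self s z v
      rw [this]
    simp only [h3] at h1
    rw [h1] at h2
    exact mul_left_cancel₀ (by positivity) h2
  | query x y hxy =>
    exact Equiv.sum_comp (queryMap_involutive (F := F) x y hxy).toPerm fun v => ‖ψ v‖ ^ 2

theorem mass_run [Fintype W] [DecidableEq W] (gs : List (Gate β m W)) (ψ : QState W) :
    mass (run F gs ψ) Set.univ = mass ψ Set.univ := by
  induction gs generalizing ψ with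
  | nil => rfl
  | cons g gs ih => rw [run_cons, ih, mass_apply]

theorem mass_run_zeroState_le [Fintype W] [DecidableEq W] (gs : List (Gate β m W))
    (E : Set (W → Bool)) : mass (run F gs zeroState) E ≤ 1 := by
  rw [← mass_zeroState_univ (W := W), ← mass_run (F := F) gs]
  exact mass_mono _ (Set.subset_univ E)

/-! #### Placing a circuit on a subset of the wires -/

/-- The gate with its wires relabelled. -/
def Gate.map (e : W ↪ W') : Gate β m W → Gate β m W'
  | .unitary k hk s U => .unitary k hk (s.trans e) U
  | .query x y hxy => .query (x.trans e) (y.trans e) fun b j h => hxy b j (e.injective h)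

theorem extend_trans {α : Type} (s : α ↪ W) (e : W ↪ W') (z : α → Bool) (v : W' → Bool) :
    extend (s.trans e) z v = extend e (extend s z (v ∘ e)) v := by
  funext w
  by_cases h : ∃ i, e i = w
  · obtain ⟨i, rfl⟩ := h
    rw [e.injective.extend_apply]
    by_cases h' : ∃ j, s j = i
    · obtain ⟨j, rfl⟩ := h'
      rw [s.injective.extend_apply]
      exact (s.trans e).injective.extend_apply z v j
    · rw [extend_apply' _ _ _ h', extend_apply']
      · rfl
      · rintro ⟨j, hj⟩
        exact h' ⟨j, e.injective hj⟩
  · rw [extend_apply' _ _ _ h, extend_apply']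
    rintro ⟨j, hj⟩
    exact h ⟨s j, hj⟩

theorem Gate.map_apply (e : W ↪ W') (g : Gate β m W) (ψ : QState W') (v : W' → Bool) :
    (g.map e).apply F ψ v = g.apply F (fun u => ψ (extend e u v)) (v ∘ e) := by
  cases g with
  | unitary k hk s U =>
    simp only [Gate.map, Gate.apply, applyUnitary, extend_trans]
    rfl
  | query x y hxy =>
    simp only [Gate.map, Gate.apply, queryMap, extend_trans]
    rfl

/-- Gates on the wires `e` never mix basis states that differ elsewhere, so the circuit acts
separately on each slice of `ψ` with the other wires frozen. -/
theorem run_map (e : W ↪ W') (gs : List (Gate β m W)) (ψ : QState W') (v : W' → Bool) :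
    run F (gs.map (Gate.map e)) ψ v = run F gs (fun u => ψ (extend e u v)) (v ∘ e) := by
  induction gs generalizing ψ with
  | nil =>
    simp only [List.map_nil, run_nil]
    rw [extend_self]
  | cons g gs ih =>
    rw [List.map_cons, run_cons, ih, run_cons]
    congr 1
    funext u
    rw [Gate.map_apply]
    congr 1
    · funext u'
      rw [extend_extend]
    · exact funext fun w => e.injective.extend_apply u v w

/-! #### Some particular gates -/

theorem extend_update [DecidableEq W] {k : ℕ} (s : Fin k ↪ W) (v : W → Bool) (a : Fin k)
    (b : Bool) : extend s (update (v ∘ s) a b) v = update v (s a) b := by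
  funext w
  by_cases h : ∃ j, s j = w
  · obtain ⟨j, rfl⟩ := h
    rw [s.injective.extend_apply]
    by_cases hj : j = a
    · subst hj
      simp
    · rw [update_of_ne hj, update_of_ne (s.injective.ne hj)]
      rfl
  · rw [extend_apply' _ _ _ h, update_of_ne]
    rintro rfl
    exact h ⟨a, rfl⟩

theorem exists_perm_gate {k : ℕ} (hk : k ≤ 3) (s : Fin k ↪ W) (σ : Equiv.Perm (Fin k → Bool)) :
    ∃ g : Gate β m W, ∀ F ψ v, g.apply F ψ v = ψ (extend s (σ (v ∘ s)) v) := by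
  classical
  refine ⟨.unitary k hk s ⟨σ.permMatrix ℂ, ?_⟩, fun F ψ v => ?_⟩
  · rw [Matrix.mem_unitaryGroup_iff, Matrix.star_eq_conjTranspose, Matrix.conjTranspose_permMatrix,
      ← Matrix.permMatrix_mul, inv_mul_cancel, Matrix.permMatrix_one]
  · simp only [Gate.apply, applyUnitary]
    rw [Finset.sum_eq_single (σ (v ∘ s))]
    · simp [PEquiv.toMatrix_apply, comp_def]
    · intro z _ hz
      have : σ (fun j => v (s j)) ≠ z := fun h => hz h.symm
      simp [PEquiv.toMatrix_apply, this]
    · simp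

theorem exists_diagonal_gate {k : ℕ} (hk : k ≤ 3) (s : Fin k ↪ W) (θ : (Fin k → Bool) → ℂ)
    (hθ : ∀ z, ‖θ z‖ = 1) :
    ∃ g : Gate β m W, ∀ F ψ v, g.apply F ψ v = θ (v ∘ s) * ψ v := by
  refine ⟨.unitary k hk s ⟨Matrix.diagonal θ, ?_⟩, fun F ψ v => ?_⟩
  · rw [Matrix.mem_unitaryGroup_iff, Matrix.star_eq_conjTranspose, Matrix.diagonal_conjTranspose,
      Matrix.diagonal_mul_diagonal, ← Matrix.diagonal_one]
    congr 1
    funext z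
    simp [Complex.mul_conj', hθ z]
  · simp only [Gate.apply, applyUnitary]
    rw [Finset.sum_eq_single (v ∘ s)]
    · rw [extend_self]
      simp [comp_def]
    · intro z _ hz
      rw [Matrix.diagonal_apply_ne _ (by exact fun h => hz h.symm), zero_mul]
    · simp

/-- `t ↦ t ⊕ op(i, j)`, as a map of basis states. -/
def condXor [DecidableEq W] (i j t : W) (op : Bool → Bool → Bool) (v : W → Bool) : W → Bool :=
  update v t (xor (v t) (op (v i) (v j)))

theorem condXor_involutive [DecidableEq W] {i j t : W} (hi : i ≠ t) (hj : j ≠ t)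
    (op : Bool → Bool → Bool) : Involutive (condXor i j t op) := by
  intro v
  simp [condXor, update_of_ne hi, update_of_ne hj]

theorem exists_condXor_gate [DecidableEq W] {i j t : W} (hi : i ≠ t) (hj : j ≠ t)
    (op : Bool → Bool → Bool) :
    ∃ g : Gate β m W, ∀ F ψ v, g.apply F ψ v = ψ (condXor i j t op v) := by
  -- The wires of a gate have to be distinct, so for `i = j` a gate on two wires is used.
  by_cases hij : i = j
  · subst hij
    have hs : Injective ![i, t] := by
      intro a b
      fin_cases a <;> fin_cases b <;> simp [hi, hi.symm]
    obtain ⟨g, hg⟩ := exists_perm_gate (β := β) (m := m) (by norm_num) ⟨_, hs⟩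
      (condXor_involutive (i := (0 : Fin 2)) (j := 0) (t := 1) (by simp) (by simp) op).toPerm
    refine ⟨g, fun F ψ v => ?_⟩
    rw [hg]
    congr 1
    exact extend_update ⟨![i, t], hs⟩ v 1 _
  · have hs : Injective ![i, j, t] := by
      intro a b
      fin_cases a <;> fin_cases b <;> simp [hi, hi.symm, hj, hj.symm, hij, Ne.symm hij]
    obtain ⟨g, hg⟩ := exists_perm_gate (β := β) (m := m) (by norm_num) ⟨_, hs⟩
      (condXor_involutive (i := (0 : Fin 3)) (j := 1) (t := 2) (by simp) (by simp) op).toPerm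
    refine ⟨g, fun F ψ v => ?_⟩
    rw [hg]
    congr 1
    exact extend_update ⟨![i, j, t], hs⟩ v 2 _

/-- `1 / √2`. -/
def rsqrt : ℂ := ((√2)⁻¹ : ℝ)

theorem rsqrt_mul_self : rsqrt * rsqrt = 1 / 2 := by
  rw [rsqrt, ← Complex.ofReal_mul, ← mul_inv, Real.mul_self_sqrt (by norm_num)]
  norm_num

theorem norm_rsqrt_sq : ‖rsqrt‖ ^ 2 = 1 / 2 := by
  rw [pow_two, ← norm_mul, rsqrt_mul_self]
  norm_num

/-- `(-1) ^ (a * b)`. -/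
def sgn (a b : Bool) : ℂ := if a && b then -1 else 1

theorem exists_hadamard_gate [DecidableEq W] (w : W) :
    ∃ g : Gate β m W, ∀ F ψ v, g.apply F ψ v =
      rsqrt * ∑ c : Bool, sgn (v w) c * ψ (update v w c) := by
  let s : Fin 1 ↪ W := ⟨fun _ => w, fun _ _ _ => Subsingleton.elim _ _⟩
  let U : Matrix (Fin 1 → Bool) (Fin 1 → Bool) ℂ :=
    Matrix.of fun z z' => rsqrt * sgn (z 0) (z' 0)
  have hU : ∀ z z', U z z' = rsqrt * sgn (z 0) (z' 0) := fun _ _ => rfl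
  have hsum : ∀ f : (Fin 1 → Bool) → ℂ, ∑ z, f z = ∑ c : Bool, f fun _ => c := fun f =>
    (Equiv.sum_comp (Equiv.funUnique (Fin 1) Bool).symm f).symm
  have hrs : star rsqrt = rsqrt := by simp [rsqrt]
  refine ⟨.unitary 1 (by norm_num) s ⟨U, ?_⟩, fun F ψ v => ?_⟩
  · rw [Matrix.mem_unitaryGroup_iff]
    ext z z'
    have hz : z = fun _ => z 0 := funext fun i => by rw [Subsingleton.elim i 0]
    have hz' : z' = fun _ => z' 0 := funext fun i => by rw [Subsingleton.elim i 0]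
    rw [hz, hz', Matrix.mul_apply, hsum]
    simp only [Matrix.star_apply, hU, star_mul, hrs]
    have h2 : ∀ a b : ℂ, rsqrt * a * (b * rsqrt) = a * b * (1 / 2) := fun a b => by
      rw [← rsqrt_mul_self]
      ring
    simp only [h2]
    have hne : (fun _ : Fin 1 => true) ≠ fun _ => false := fun h => by
      simpa using congrFun h 0
    cases z 0 <;> cases z' 0 <;> (simp [sgn, hne, hne.symm]; try norm_num)
  · simp only [Gate.apply, applyUnitary]
    rw [hsum, Finset.mul_sum]
    refine Finset.sum_congr rfl fun c _ => ?_
    have : extend s (fun _ => c) v = update v w c := by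
      refine Eq.trans ?_ (extend_update s v 0 c)
      congr 1
      funext i
      rw [Subsingleton.elim i 0, update_self]
    rw [this, hU, mul_assoc]
    rfl

theorem exists_phase_gate {i j : W} (hij : i ≠ j) (θ : ℝ) :
    ∃ g : Gate β m W, ∀ F ψ v, g.apply F ψ v =
      (if v i && v j then Complex.exp (Complex.I * θ) else 1) * ψ v := by
  have hs : Injective ![i, j] := by
    intro a b
    fin_cases a <;> fin_cases b <;> simp [hij, hij.symm]
  obtain ⟨g, hg⟩ := exists_diagonal_gate (β := β) (m := m) (by norm_num) ⟨_, hs⟩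
    (fun z : Fin 2 → Bool => if z 0 && z 1 then Complex.exp (Complex.I * θ) else 1) (by
      intro z
      split_ifs
      · rw [mul_comm]
        exact Complex.norm_exp_ofReal_mul_I θ
      · simp)
  exact ⟨g, hg⟩

theorem exists_query_gate (x : β ↪ W) (y : Fin m ↪ W) (hxy : ∀ b j, x b ≠ y j) :
    ∃ g : Gate β m W, ∀ F ψ v, g.apply F ψ v = ψ (queryMap F x y v) :=
  ⟨.query x y hxy, fun _ _ _ => rfl⟩

end Gates

end HSP

end

noncomputable section

namespace HSP

open Function

/-! ### Classical computations as quantum circuits -/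

/-- `Derives A c B`: starting from the Boolean functions in `A`, all the Boolean functions in `B`
can be computed by `c` binary logical operations. -/
inductive Derives {X : Type} : Set (X → Bool) → ℕ → Set (X → Bool) → Prop
  | base {A B : Set (X → Bool)} {c : ℕ} : B ⊆ A → Derives A c B
  | step {A B : Set (X → Bool)} {c : ℕ} (f g : X → Bool) (op : Bool → Bool → Bool) :
      f ∈ A → g ∈ A → Derives (insert (fun x => op (f x) (g x)) A) c B → Derives A (c + 1) B

namespace Derives

variable {X : Type} {A A' B B' C : Set (X → Bool)} {c c' d : ℕ}

theorem mono_right (h : Derives A c B) (hB : B' ⊆ B) : Derives A c B' := by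
  induction h with
  | base h => exact base (hB.trans h)
  | step f g op hf hg _ ih => exact step f g op hf hg (ih hB)

theorem mono_left (h : Derives A c B) (hA : A ⊆ A') : Derives A' c B := by
  induction h generalizing A' with
  | base h => exact base (h.trans hA)
  | step f g op hf hg _ ih =>
    exact step f g op (hA hf) (hA hg) (ih (Set.insert_subset_insert hA))

theorem mono_cost (h : Derives A c B) (hc : c ≤ c') : Derives A c' B := by
  induction h generalizing c' with
  | base h => exact base h
  | step f g op hf hg _ ih =>
    obtain ⟨e, rfl⟩ : ∃ e, c' = e + 1 := ⟨c' - 1, by omega⟩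
    exact step f g op hf hg (ih (by omega))

theorem union_self (h : Derives A c B) : Derives A c (A ∪ B) := by
  induction h with
  | base h => exact base (Set.union_subset le_rfl h)
  | step f g op hf hg _ ih =>
    exact step f g op hf hg (ih.mono_right (Set.union_subset_union_left _ (Set.subset_insert _ _)))

theorem trans (h : Derives A c B) (h' : Derives (A ∪ B) d C) : Derives A (c + d) C := by
  induction h with
  | base h => exact (h'.mono_left (Set.union_subset le_rfl h)).mono_cost (by omega)
  | @step A B c f g op hf hg _ ih =>
    have := step f g op hf hg
      (ih (h'.mono_left (Set.union_subset_union_left _ (Set.subset_insert _ _))))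
    exact this.mono_cost (by omega)

theorem union (h : Derives A c B) (h' : Derives A d C) : Derives A (c + d) (B ∪ C) := by
  refine h.trans ((h'.mono_left Set.subset_union_left).union_self.mono_right ?_)
  exact Set.union_subset_union_left _ Set.subset_union_right

theorem op {f g : X → Bool} (o : Bool → Bool → Bool) (hf : f ∈ A) (hg : g ∈ A) :
    Derives A 1 {fun x => o (f x) (g x)} :=
  step f g o hf hg (base (by simp))

/-- Several sets of functions, each derivable at cost `d`. -/
theorem iUnion_range {B : ℕ → Set (X → Bool)} (n : ℕ) (h : ∀ i < n, Derives A d (B i)) :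
    Derives A (n * d) {f | ∃ i < n, f ∈ B i} := by
  induction n with
  | zero => exact base (by rintro f ⟨i, hi, -⟩; omega)
  | succ n ih =>
    refine (((ih fun i hi => h i (by omega)).union (h n (by omega))).mono_right ?_).mono_cost
      (by rw [add_mul]; omega)
    rintro f ⟨i, hi, hf⟩
    by_cases hin : i = n
    · subst hin
      exact Or.inr hf
    · exact Or.inl ⟨i, by omega, hf⟩

theorem range_fin {n : ℕ} {F : Fin n → X → Bool} (h : ∀ i, Derives A d {F i}) :
    Derives A (n * d) (Set.range F) := by
  refine (iUnion_range (B := fun i => {f | ∃ hi : i < n, f = F ⟨i, hi⟩}) n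
    fun i hi => (h ⟨i, hi⟩).mono_right ?_).mono_right ?_
  · rintro f ⟨_, rfl⟩
    rfl
  · rintro f ⟨i, rfl⟩
    exact ⟨i, i.2, i.2, rfl⟩

end Derives

/-! ### Compiling straight-line programs into gates -/

section Compile

variable {β : Type} {m : ℕ} {W W₁ : Type}

theorem run_mul_const {F : (β → Bool) → Fin m → Bool} (gs : List (Gate β m W)) (ψ : QState W)
    (z : ℂ) : run F gs (fun v => ψ v * z) = fun v => run F gs ψ v * z := by
  induction gs generalizing ψ with
  | nil => rfl
  | cons g gs ih =>
    have : g.apply F (fun v => ψ v * z) = fun v => g.apply F ψ v * z := by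
      funext v
      cases g with
      | unitary k hk s U => simp only [Gate.apply, applyUnitary, Finset.sum_mul, mul_assoc]
      | query x y hxy => rfl
    rw [run_cons, run_cons, this, ih]

/-- The state `ψ` on the left wires and zeros on the right wires. -/
def padded (ψ : QState W) : QState (W ⊕ W₁) :=
  fun v => ψ (v ∘ Sum.inl) * ind (v ∘ Sum.inr = fun _ => false)

theorem padded_zeroState : padded zeroState = (zeroState : QState (W ⊕ W₁)) := by
  funext v
  rw [padded, zeroState, zeroState, ← ind_and]
  congr 1
  apply propext
  constructor
  · rintro ⟨h, h'⟩
    funext w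
    cases w with
    | inl w => exact congrFun h w
    | inr w => exact congrFun h' w
  · rintro rfl
    exact ⟨rfl, rfl⟩

theorem extend_inl (u : W → Bool) (v : W ⊕ W₁ → Bool) :
    extend Sum.inl u v = Sum.elim u (v ∘ Sum.inr) := by
  funext w
  cases w with
  | inl w => exact Sum.inl_injective.extend_apply _ _ _
  | inr w => exact extend_apply' _ _ _ (by simp)

theorem run_map_inl {F : (β → Bool) → Fin m → Bool} (gs : List (Gate β m W)) (ψ : QState W) :
    run F (gs.map (Gate.map ⟨Sum.inl, Sum.inl_injective⟩)) (padded ψ : QState (W ⊕ W₁)) =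
      padded (run F gs ψ) := by
  funext v
  rw [run_map]
  have : (fun u => (padded ψ : QState (W ⊕ W₁)) (extend Sum.inl u v)) =
      fun u => ψ u * ind (v ∘ Sum.inr = fun _ => false) := by
    funext u
    rw [extend_inl]
    rfl
  exact (congrFun (congrArg _ this) _).trans (congrFun (run_mul_const gs ψ _) (v ∘ Sum.inl))

/-- Here `σ x` is the basis state that holds the input `x`. The invariant is that each function
known so far sits on some wire outside the ancillas still in use, which are zero. An operation is
XORed onto the first ancilla, so the circuit only permutes basis states. -/
theorem Derives.compile_aux {X : Type} [DecidableEq W] {A B : Set (X → Bool)} {c : ℕ}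
    (h : Derives A c B) : ∀ (σ : X → W → Bool) (anc : Fin c ↪ W),
      (∀ f ∈ A, ∃ w, w ∉ Set.range anc ∧ ∀ x, σ x w = f x) → (∀ x i, σ x (anc i) = false) →
      ∃ (gs : List (Gate β m W)) (π : Equiv.Perm (W → Bool)), gs.length ≤ c ∧
        (∀ F ψ v, run F gs ψ v = ψ (π.symm v)) ∧
        (∀ u, ∀ w ∉ Set.range anc, π u w = u w) ∧ ∀ f ∈ B, ∃ w, ∀ x, π (σ x) w = f x := by
  induction h with
  | base h =>
    intro σ anc hA _
    refine ⟨[], Equiv.refl _, by simp, fun _ _ _ => rfl, fun _ _ _ => rfl, fun f hf => ?_⟩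
    obtain ⟨w, -, hw⟩ := hA f (h hf)
    exact ⟨w, hw⟩
  | @step A B c f g op hf hg _ ih =>
    intro σ anc hA h0
    obtain ⟨i, hi, hif⟩ := hA f hf
    obtain ⟨j, hj, hjg⟩ := hA g hg
    have hi0 : i ≠ anc 0 := fun h => hi ⟨0, h.symm⟩
    have hj0 : j ≠ anc 0 := fun h => hj ⟨0, h.symm⟩
    obtain ⟨gate, hgate⟩ := exists_condXor_gate (β := β) (m := m) hi0 hj0 op
    let τ : Equiv.Perm (W → Bool) := (condXor_involutive hi0 hj0 op).toPerm
    have hτ : ∀ u, ∀ w ≠ anc 0, τ u w = u w := fun u w hw => update_of_ne hw _ _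
    obtain ⟨gs, π, hlen, hrun, hfix, hout⟩ := ih (fun x => τ (σ x))
      -- The ancilla `anc 0` now holds the new function, and the remaining ones serve the rest of
      -- the program.
      ((Fin.succEmb c).trans anc)
      (by
        intro e he
        rcases he with rfl | he
        · refine ⟨anc 0, ?_, fun x => ?_⟩
          · rintro ⟨k, hk⟩
            exact Fin.succ_ne_zero k (anc.injective hk)
          · change update _ _ _ _ = _
            rw [update_self, h0, hif, hjg, Bool.false_xor]
        · obtain ⟨w, hw, hwe⟩ := hA e he
          refine ⟨w, ?_, fun x => ?_⟩
          · rintro ⟨k, rfl⟩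
            exact hw ⟨_, rfl⟩
          · rw [hτ _ _ fun h => hw ⟨0, h.symm⟩, hwe])
      (by
        intro x k
        rw [hτ]
        · exact h0 x _
        · exact fun h => Fin.succ_ne_zero k (anc.injective h))
    refine ⟨gate :: gs, τ.trans π, by simpa using hlen, fun F ψ v => ?_, fun u w hw => ?_,
      fun e he => ?_⟩
    · rw [run_cons, hrun, hgate]
      rfl
    · rw [Equiv.trans_apply, hfix, hτ]
      · exact fun h => hw ⟨0, h.symm⟩
      · rintro ⟨k, rfl⟩
        exact hw ⟨_, rfl⟩
    · exact hout e he

variable [Fintype W] [DecidableEq W] [Fintype W₁] [DecidableEq W₁]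

theorem mass_padded (ψ : QState W) (E : Set (W ⊕ W₁ → Bool)) :
    mass (padded ψ) E = mass ψ {a | Sum.elim a (fun _ => false) ∈ E} := by
  classical
  rw [mass, mass, ← Equiv.sum_comp (Equiv.sumArrowEquivProdArrow W W₁ Bool).symm,
    Fintype.sum_prod_type]
  refine Finset.sum_congr rfl fun a _ => ?_
  rw [Finset.sum_eq_single fun _ => false]
  · simp only [Set.indicator_apply, Set.mem_ofPred_eq]
    congr 1
    simp [padded, ind, Equiv.sumArrowEquivProdArrow, comp_def]
  · intro b _ hb
    have : (fun x => b x) ≠ fun _ => false := hb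
    simp [Set.indicator_apply, padded, ind, Equiv.sumArrowEquivProdArrow, comp_def, this]
  · simp

/-- A derivation from the bits of a register can be carried out by a circuit. -/
theorem Derives.compile {κ : Type} {c : ℕ} {out : κ → (W → Bool) → Bool}
    (h : Derives (Set.range fun w v => v w) c (Set.range out)) :
    ∃ (gs : List (Gate β m (W ⊕ Fin c))) (o : κ → W ⊕ Fin c), gs.length ≤ c ∧
      ∀ (F : (β → Bool) → Fin m → Bool) (ψ : QState W) (E : Set (κ → Bool)),
        mass (run F gs (padded ψ)) {v | v ∘ o ∈ E} = mass ψ {a | (fun b => out b a) ∈ E} := by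
  obtain ⟨gs, π, hlen, hrun, -, hout⟩ := h.compile_aux (β := β) (m := m) (W := W ⊕ Fin c)
    (fun a => Sum.elim a fun _ => false)
    ⟨Sum.inr, Sum.inr_injective⟩
    (by
      rintro f ⟨w, rfl⟩
      exact ⟨Sum.inl w, by simp, fun x => rfl⟩)
    (fun _ _ => rfl)
  choose o ho using fun b => hout (out b) ⟨b, rfl⟩
  refine ⟨gs, o, hlen, fun F ψ E => ?_⟩
  -- A permutation of basis states only transports the outcome distribution, whatever is left on the
  -- ancillas.
  calc mass (run F gs (padded ψ)) {v | v ∘ o ∈ E}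
      = mass (padded ψ) {v | π v ∘ o ∈ E} := by
        rw [mass, mass, ← Equiv.sum_comp π]
        refine Finset.sum_congr rfl fun v _ => ?_
        by_cases hv : π v ∘ o ∈ E
        · rw [Set.indicator_of_mem (by exact hv), Set.indicator_of_mem (by exact hv), hrun,
            Equiv.symm_apply_apply]
        · rw [Set.indicator_of_notMem (by exact hv), Set.indicator_of_notMem (by exact hv)]
    _ = _ := by
        rw [mass_padded]
        congr 1
        ext a
        have : π (Sum.elim a fun _ => false) ∘ o = fun b => out b a := funext fun b => ho b a
        simp [this]

end Compile

end HSP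

end

noncomputable section

namespace HSP

open Function

/-! ### Independent subcircuits that share a read-only register -/

section Replicate

variable {β : Type} {m : ℕ} {A V ι : Type} {F : (β → Bool) → Fin m → Bool}

/-- The wires of the `i`-th copy of a circuit. -/
def copyEmb (i : ι) : A ⊕ V ↪ A ⊕ ι × V where
  toFun := Sum.map id fun w => (i, w)
  inj' := Sum.map_injective.2 ⟨injective_id, Prod.mk_right_injective i⟩

theorem extend_copyEmb [DecidableEq ι] (i : ι) (u : A ⊕ V → Bool) (v : A ⊕ ι × V → Bool) :
    extend (copyEmb i) u v = Sum.elim (u ∘ Sum.inl)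
      fun jw => if jw.1 = i then u (Sum.inr jw.2) else v (Sum.inr jw) := by
  funext w
  rcases w with w | ⟨j, w⟩
  · exact (copyEmb i).injective.extend_apply u v (Sum.inl w)
  · by_cases hj : j = i
    · subst hj
      refine Eq.trans ((copyEmb j).injective.extend_apply u v (Sum.inr w)) ?_
      simp
    · rw [extend_apply']
      · simp [hj]
      · rintro ⟨x | x, hx⟩
        · simp [copyEmb] at hx
        · simp only [copyEmb, Embedding.coeFn_mk, Sum.map_inr, Sum.inr.injEq,
            Prod.mk.injEq] at hx
          exact hj hx.1.symm

/-- The circuits `gs i` on the wires `A ⊕ V`, with one copy of the wires `V` for each `i`. -/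
def replicateGates [Fintype ι] (gs : ι → List (Gate β m (A ⊕ V))) :
    List (Gate β m (A ⊕ ι × V)) :=
  (Finset.univ : Finset ι).toList.flatMap fun i => (gs i).map (Gate.map (copyEmb i))

theorem length_replicateGates [Fintype ι] {gs : ι → List (Gate β m (A ⊕ V))} {N : ℕ}
    (h : ∀ i, (gs i).length ≤ N) : (replicateGates gs).length ≤ Fintype.card ι * N := by
  rw [replicateGates, List.length_flatMap]
  calc _ ≤ ((Finset.univ : Finset ι).toList.map fun _ => N).sum :=
        List.sum_le_sum fun i _ => by simpa using h i
    _ = _ := by simp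

/-- The hypothesis says that each circuit only reads the register `A`: for every amplitude function
`Φ` there, it prepares on its own wires a state that depends on the value read. The factors prepared
by different copies therefore multiply. -/
theorem run_replicateGates [Fintype ι] [DecidableEq ι] {gs : ι → List (Gate β m (A ⊕ V))}
    {χ : ι → (A → Bool) → QState V}
    (h : ∀ i Φ, run F (gs i) (padded Φ) = fun v => Φ (v ∘ Sum.inl) * χ i (v ∘ Sum.inl) (v ∘ Sum.inr))
    (Φ : QState A) :
    run F (replicateGates gs) (padded Φ) = fun v => Φ (v ∘ Sum.inl) *
      ∏ i, χ i (v ∘ Sum.inl) fun w => v (Sum.inr (i, w)) := by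
  classical
  -- The state after the copies in `S` have run.
  let φ : Finset ι → QState (A ⊕ ι × V) := fun S v => Φ (v ∘ Sum.inl) *
    ∏ i, if i ∈ S then χ i (v ∘ Sum.inl) fun w => v (Sum.inr (i, w))
      else zeroState fun w => v (Sum.inr (i, w))
  have hstep : ∀ S : Finset ι, ∀ i ∉ S,
      run F ((gs i).map (Gate.map (copyEmb i))) (φ S) = φ (insert i S) := by
    intro S i hi
    funext v
    rw [run_map]
    -- With the wires of the other copies frozen, their factors depend on the shared register alone
    -- and can be absorbed into `Φ`. This is why the hypothesis is needed for every `Φ`.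
    let Φ' : QState A := fun a => Φ a *
      ∏ j ∈ Finset.univ.erase i, if j ∈ S then χ j a fun w => v (Sum.inr (j, w))
        else zeroState fun w => v (Sum.inr (j, w))
    have h1 : (fun u => φ S (extend (copyEmb i) u v)) = padded Φ' := by
      funext u
      simp only [φ, padded, Φ']
      rw [← Finset.mul_prod_erase _ _ (Finset.mem_univ i), if_neg hi, extend_copyEmb]
      simp only [Sum.elim_comp_inl, Sum.elim_inr, if_true]
      have : ∀ j ∈ Finset.univ.erase i, (if j ∈ S then
          χ j (u ∘ Sum.inl) fun w => if j = i then u (Sum.inr w) else v (Sum.inr (j, w))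
          else zeroState fun w => if j = i then u (Sum.inr w) else v (Sum.inr (j, w))) =
          if j ∈ S then χ j (u ∘ Sum.inl) fun w => v (Sum.inr (j, w))
          else zeroState fun w => v (Sum.inr (j, w)) := by
        intro j hj
        simp [Finset.ne_of_mem_erase hj]
      rw [Finset.prod_congr rfl this, mul_comm (zeroState _), ← mul_assoc]
      rfl
    rw [h1, h]
    simp only [φ, Φ']
    rw [← Finset.mul_prod_erase Finset.univ _ (Finset.mem_univ i), if_pos (Finset.mem_insert_self i S)]
    have : ∀ j ∈ Finset.univ.erase i, (if j ∈ insert i S then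
        χ j (v ∘ Sum.inl) fun w => v (Sum.inr (j, w))
        else zeroState fun w => v (Sum.inr (j, w))) =
        if j ∈ S then χ j (v ∘ Sum.inl) fun w => v (Sum.inr (j, w))
        else zeroState fun w => v (Sum.inr (j, w)) := by
      intro j hj
      simp [Finset.mem_insert, Finset.ne_of_mem_erase hj]
    rw [Finset.prod_congr rfl this, mul_assoc, mul_comm (Finset.prod _ _)]
    rfl
  have hlist : ∀ (l : List ι) (S : Finset ι), l.Nodup → (∀ i ∈ l, i ∉ S) →
      run F (l.flatMap fun i => (gs i).map (Gate.map (copyEmb i))) (φ S) = φ (l.toFinset ∪ S) := by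
    intro l
    induction l with
    | nil => intro S _ _; simp [run_nil]
    | cons i l ih =>
      intro S hl hS
      rw [List.flatMap_cons, run_append, hstep S i (hS i (by simp)), ih]
      · congr 1
        ext j
        simp only [Finset.mem_union, Finset.mem_insert, List.toFinset_cons]
        tauto
      · exact (List.nodup_cons.1 hl).2
      · intro j hj
        rw [Finset.mem_insert, not_or]
        exact ⟨fun hji => (List.nodup_cons.1 hl).1 (hji ▸ hj), hS j (by simp [hj])⟩
  have h0 : padded Φ = φ ∅ := by
    funext v
    simp only [padded, φ, Finset.notMem_empty, if_false]
    congr 1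
    by_cases hv : v ∘ Sum.inr = fun _ => false
    · rw [ind_pos hv, Finset.prod_eq_one]
      intro i _
      exact ind_pos (funext fun w => congrFun hv (i, w))
    · rw [ind_neg hv]
      obtain ⟨⟨i, w⟩, hw⟩ := Function.ne_iff.1 hv
      refine (Finset.prod_eq_zero (Finset.mem_univ i) (ind_neg fun h => hw (congrFun h w))).symm
  rw [replicateGates, h0, hlist _ ∅ (Finset.nodup_toList _) (by simp)]
  funext v
  simp [φ]

/-- Given the value `a` of the shared register, the state is a product, so the measurements of the
copies are conditionally independent. -/
theorem mass_prod [Fintype A] [DecidableEq A] [Fintype V] [DecidableEq V] [Fintype ι]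
    [DecidableEq ι] (Φ : QState A) (χ : ι → (A → Bool) → QState V) (S : Set (A → Bool))
    (E : ι → Set (V → Bool)) :
    mass (fun v : A ⊕ ι × V → Bool => Φ (v ∘ Sum.inl) *
        ∏ i, χ i (v ∘ Sum.inl) fun w => v (Sum.inr (i, w)))
      {v | v ∘ Sum.inl ∈ S ∧ ∀ i, (fun w => v (Sum.inr (i, w))) ∈ E i} =
      ∑ a, S.indicator (fun a => ‖Φ a‖ ^ 2 * ∏ i, mass (χ i a) (E i)) a := by
  classical
  let e : (A → Bool) × (ι → V → Bool) ≃ (A ⊕ ι × V → Bool) :=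
    ((Equiv.refl _).prodCongr (Equiv.curry ι V Bool).symm).trans
      (Equiv.sumArrowEquivProdArrow A (ι × V) Bool).symm
  rw [mass, ← Equiv.sum_comp e, Fintype.sum_prod_type]
  refine Finset.sum_congr rfl fun a _ => ?_
  have he1 : ∀ x, e (a, x) ∘ Sum.inl = a := fun x => rfl
  have he2 : ∀ x i, (fun w => e (a, x) (Sum.inr (i, w))) = x i := fun x i => rfl
  by_cases ha : a ∈ S
  · rw [Set.indicator_of_mem ha]
    simp only [mass]
    rw [Finset.prod_univ_sum, Fintype.piFinset_univ, Finset.mul_sum]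
    refine Finset.sum_congr rfl fun x _ => ?_
    by_cases hx : ∀ i, x i ∈ E i
    · rw [Set.indicator_of_mem (by exact ⟨ha, hx⟩), norm_mul, mul_pow, he1, norm_prod,
        ← Finset.prod_pow]
      refine congrArg _ (Finset.prod_congr rfl fun i _ => ?_)
      rw [Set.indicator_of_mem (hx i), he2]
    · rw [Set.indicator_of_notMem (by exact fun h => hx h.2)]
      obtain ⟨i, hi⟩ := not_forall.1 hx
      rw [Finset.prod_eq_zero (Finset.mem_univ i) (Set.indicator_of_notMem hi _), mul_zero]
  · rw [Set.indicator_of_notMem ha]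
    exact Finset.sum_eq_zero fun x _ => Set.indicator_of_notMem (by exact fun h => ha h.1) _

end Replicate

/-! ### Comparing two values of the oracle -/

section Check

variable {β : Type} {m : ℕ} {A : Type} {F : (β → Bool) → Fin m → Bool}

/-- The wires for one comparison: a control wire, and the registers of the query. -/
abbrev CheckWires (β : Type) (m : ℕ) : Type := Unit ⊕ (β ⊕ Fin m)

/-- The basis state with the given registers. -/
def assemble (a : A → Bool) (c : Bool) (u : β → Bool) (y : Fin m → Bool) :
    A ⊕ CheckWires β m → Bool :=
  Sum.elim a (Sum.elim (fun _ => c) (Sum.elim u y))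

theorem eq_assemble (v : A ⊕ CheckWires β m → Bool) :
    v = assemble (v ∘ Sum.inl) (v (Sum.inr (Sum.inl ()))) (fun b => v (Sum.inr (Sum.inr (Sum.inl b))))
      fun j => v (Sum.inr (Sum.inr (Sum.inr j))) := by
  funext w
  rcases w with w | w | w | w <;> rfl

theorem padded_assemble (Φ : QState A) (a : A → Bool) (c : Bool) (u : β → Bool)
    (y : Fin m → Bool) : padded Φ (assemble a c u y) =
      Φ a * (ind (c = false) * ind ((u = fun _ => false) ∧ y = fun _ => false)) := by
  rw [padded, ← ind_and]
  congr 2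
  apply propext
  constructor
  · intro h
    exact ⟨congrFun h (Sum.inl ()), funext fun b => congrFun h (Sum.inr (Sum.inl b)),
      funext fun j => congrFun h (Sum.inr (Sum.inr j))⟩
  · rintro ⟨rfl, rfl, rfl⟩
    funext w
    rcases w with w | w | w <;> rfl

/-- The result of the selection between the bit strings `x` and `e`. -/
def select (c : Bool) (x e : β → Bool) : β → Bool := fun b => if c then x b else e b

theorem select_true (x e : β → Bool) : select true x e = x := rfl

theorem select_false (x e : β → Bool) : select false x e = e := rfl

theorem exists_select_gates [Fintype β] [DecidableEq β] [DecidableEq A] (o : β → A)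
    (e : β → Bool) :
    ∃ gs : List (Gate β m (A ⊕ CheckWires β m)), gs.length = Fintype.card β ∧
      ∀ (F : (β → Bool) → Fin m → Bool) ψ a c u y, run F gs ψ (assemble a c u y) =
        ψ (assemble a c (fun b => xor (u b) (select c (a ∘ o) e b)) y) := by
  choose g hg using fun b : β => exists_condXor_gate (β := β) (m := m)
    (i := (Sum.inl (o b) : A ⊕ CheckWires β m)) (j := Sum.inr (Sum.inl ()))
    (t := Sum.inr (Sum.inr (Sum.inl b))) (by simp) (by simp) fun x c => if c then x else e b
  have hlist : ∀ l : List β, l.Nodup → ∀ (F : (β → Bool) → Fin m → Bool) ψ a c u y,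
      run F (l.map g) ψ (assemble a c u y) =
        ψ (assemble a c (fun b => if b ∈ l then xor (u b) (select c (a ∘ o) e b) else u b) y) := by
    intro l
    induction l with
    | nil => intros; simp [run_nil]
    | cons b l ih =>
      intro hl F ψ a c u y
      rw [List.map_cons, run_cons, ih (List.nodup_cons.1 hl).2, hg]
      congr 1
      funext w
      rcases w with w | w | w | w
      · simp [condXor, assemble]
      · simp [condXor, assemble]
      · by_cases hw : w = b
        · subst hw
          simp [condXor, assemble, select, (List.nodup_cons.1 hl).1]
        · simp [condXor, assemble, hw]
      · simp [condXor, assemble]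
  refine ⟨(Finset.univ : Finset β).toList.map g, by simp, fun F ψ a c u y => ?_⟩
  rw [hlist _ (Finset.nodup_toList _)]
  simp

/-- The state of the wires of a comparison of the oracle's values at `x` and at `e`. -/
def checkState (F : (β → Bool) → Fin m → Bool) (x e : β → Bool) : QState (CheckWires β m) :=
  fun w => 1 / 2 * ∑ c', sgn (w (Sum.inl ())) c' *
    ind (((fun b => w (Sum.inr (Sum.inl b))) = fun _ => false) ∧
      (fun j => w (Sum.inr (Sum.inr j))) = F (select c' x e))

/-- The gates are a Hadamard gate on the control, the selection of `x` or `e` as query input, the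
query, the selection again, and a Hadamard gate. The second selection erases the query input, so
that the two branches differ only in the oracle's value and interfere if the values agree. -/
theorem exists_check_gates [Fintype β] [DecidableEq β] [DecidableEq A] (o : β → A)
    (e : β → Bool) :
    ∃ gs : List (Gate β m (A ⊕ CheckWires β m)), gs.length = 2 * Fintype.card β + 3 ∧
      ∀ (F : (β → Bool) → Fin m → Bool) Φ, run F gs (padded Φ) =
        fun v => Φ (v ∘ Sum.inl) * checkState F ((v ∘ Sum.inl) ∘ o) e (v ∘ Sum.inr) := by
  obtain ⟨hd, hhd⟩ := exists_hadamard_gate (β := β) (m := m)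
    (Sum.inr (Sum.inl ()) : A ⊕ CheckWires β m)
  obtain ⟨sel, hlen, hsel⟩ := exists_select_gates (m := m) o e
  obtain ⟨q, hq⟩ := exists_query_gate (W := A ⊕ CheckWires β m)
    ⟨fun b : β => Sum.inr (Sum.inr (Sum.inl b)), fun _ _ h => by simpa using h⟩
    ⟨fun j : Fin m => Sum.inr (Sum.inr (Sum.inr j)), fun _ _ h => by simpa using h⟩
    (fun b j h => by
      have : (Sum.inr (Sum.inr (Sum.inl b)) : A ⊕ CheckWires β m) = Sum.inr (Sum.inr (Sum.inr j)) := h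
      simp at this)
  have hhd' : ∀ (F : (β → Bool) → Fin m → Bool) ψ a c u y, hd.apply F ψ (assemble a c u y) =
      rsqrt * ∑ c', sgn c c' * ψ (assemble a c' u y) := by
    intro F ψ a c u y
    rw [hhd]
    congr 1
    refine Finset.sum_congr rfl fun c' _ => ?_
    congr 2
    funext w
    rcases w with w | w | w | w <;> simp [assemble]
  have hq' : ∀ (F : (β → Bool) → Fin m → Bool) ψ a c u y, q.apply F ψ (assemble a c u y) =
      ψ (assemble a c u fun j => xor (y j) (F u j)) := by
    intro F ψ a c u y
    rw [hq]
    congr 1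
    funext w
    have hne : ∀ (w : A ⊕ CheckWires β m) (j : Fin m), Sum.inr (Sum.inr (Sum.inr j)) = w →
        ∃ j, w = Sum.inr (Sum.inr (Sum.inr j)) := fun w j h => ⟨j, h.symm⟩
    rcases w with w | w | w | w
    · exact extend_apply' _ _ _ fun ⟨j, hj⟩ => by simpa using hne _ j hj
    · exact extend_apply' _ _ _ fun ⟨j, hj⟩ => by simpa using hne _ j hj
    · exact extend_apply' _ _ _ fun ⟨j, hj⟩ => by simpa using hne _ j hj
    · exact (Embedding.injective _).extend_apply _ _ w
  refine ⟨hd :: (sel ++ q :: (sel ++ [hd])), by simp [hlen]; omega, fun F Φ => ?_⟩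
  funext v
  rw [eq_assemble v]
  generalize v ∘ Sum.inl = a, v (Sum.inr (Sum.inl ())) = c,
    (fun b => v (Sum.inr (Sum.inr (Sum.inl b)))) = u,
    (fun j => v (Sum.inr (Sum.inr (Sum.inr j)))) = y
  rw [run_cons, run_append, run_cons, run_append, run_cons, run_nil, hhd']
  simp only [hsel, hq', hhd', padded_assemble]
  change _ = Φ a * (1 / 2 * ∑ c', sgn c c' * ind ((u = fun _ => false) ∧ y = F (select c' (a ∘ o) e)))
  -- The first Hadamard gate meets a control wire in the state zero, so it contributes no sign.
  have hc : ∀ c' X, ∑ c'', sgn c' c'' * (Φ a * (ind (c'' = false) * X)) = Φ a * X := by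
    intro c' X
    simp [sgn, ind]
  rw [← rsqrt_mul_self]
  simp only [hc]
  simp only [Finset.mul_sum]
  refine Finset.sum_congr rfl fun c' _ => ?_
  have hP : ((fun b => xor (xor (u b) (select c' (a ∘ o) e b)) (select c' (a ∘ o) e b)) =
      fun _ => false) ∧ (fun j => xor (y j) (F (fun b => xor (u b) (select c' (a ∘ o) e b)) j)) =
      (fun _ => false) ↔ (u = fun _ => false) ∧ y = F (select c' (a ∘ o) e) := by
    simp only [Bool.xor_assoc, Bool.xor_self, Bool.xor_false]
    refine and_congr_right fun hu => ?_
    have hu' : u = fun _ => false := hu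
    subst hu'
    simp [funext_iff]
  rw [propext hP]
  ring

/-- Equal values add up to a single amplitude `1`. Distinct values leave two orthogonal terms of
amplitude `1 / 2`, of total weight `1 / 4 + 1 / 4`. -/
theorem mass_checkState [Fintype β] [DecidableEq β] (x e : β → Bool) :
    mass (checkState F x e) {w | w (Sum.inl ()) = false} = if F x = F e then 1 else 1 / 2 := by
  classical
  let g : (Fin m → Bool) → CheckWires β m → Bool := fun y =>
    Sum.elim (fun _ => false) (Sum.elim (fun _ => false) y)
  have hg : Injective g := fun y y' h => funext fun j => congrFun h (Sum.inr (Sum.inr j))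
  have hval : ∀ y, checkState F x e (g y) = 1 / 2 * (ind (y = F x) + ind (y = F e)) := by
    intro y
    simp only [checkState, g, Fintype.sum_bool, sgn, Sum.elim_inl, Sum.elim_inr, Bool.false_and]
    rw [select_true, select_false]
    simp
  have h1 : mass (checkState F x e) {w | w (Sum.inl ()) = false} =
      ∑ y, ‖(1 / 2 * (ind (y = F x) + ind (y = F e)) : ℂ)‖ ^ 2 := by
    rw [mass, ← Finset.sum_subset (Finset.subset_univ (Finset.univ.image g)),
      Finset.sum_image hg.injOn]
    · refine Finset.sum_congr rfl fun y _ => ?_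
      rw [Set.indicator_of_mem (by simp [g]), hval]
    · intro w _ hw
      by_cases hc : w (Sum.inl ()) = false
      · rw [Set.indicator_of_mem (by exact hc)]
        have hu : ¬ (fun b => w (Sum.inr (Sum.inl b))) = fun _ => false := by
          intro hu
          apply hw
          rw [Finset.mem_image]
          refine ⟨fun j => w (Sum.inr (Sum.inr j)), Finset.mem_univ _, ?_⟩
          funext i
          rcases i with i | i | i
          · exact hc.symm
          · exact (congrFun hu i).symm
          · rfl
        simp [checkState, hu, ind]
      · rw [Set.indicator_of_notMem (by exact hc)]
  rw [h1]
  split_ifs with h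
  · rw [Finset.sum_eq_single (F e)]
    · simp [ind, h]
      norm_num
    · intro y _ hy
      simp [ind, h, hy]
    · simp
  · rw [← Finset.sum_subset (Finset.subset_univ {F x, F e}), Finset.sum_pair h]
    · simp [ind, h, Ne.symm h]
      norm_num
    · intro y _ hy
      simp only [Finset.mem_insert, Finset.mem_singleton, not_or] at hy
      simp [ind, hy]

end Check

end HSP

end

noncomputable section

namespace HSP

open Function

/-! ### Verification of a candidate -/

section Verify

/-- The result of a verification: the candidate if all the comparisons are passed, else `e`. -/
def verifiedOutput {β A : Type} {m k : ℕ} (o : β → A) (e : β → Bool) (b : β)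
    (v : A ⊕ Fin k × CheckWires β m → Bool) : Bool :=
  if ∀ i, v (Sum.inr (i, Sum.inl ())) = false then v (Sum.inl (o b)) else e b

theorem Derives.range_fintype {X : Type} {β : Type} [Fintype β] {S : Set (X → Bool)} {d : ℕ} {f : β → X → Bool}
    (h : ∀ b, Derives S d {f b}) : Derives S (Fintype.card β * d) (Set.range f) := by
  refine (range_fin (F := f ∘ (Fintype.equivFin β).symm) fun i => h _).mono_right ?_
  rw [(Equiv.surjective _).range_comp]

theorem Derives.verifiedOutput {β A : Type} {m : ℕ} [Fintype β] [Nonempty A] {k : ℕ} (o : β → A) (e : β → Bool) :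
    Derives (Set.range fun w (v : A ⊕ Fin k × CheckWires β m → Bool) => v w)
      (k + 1 + Fintype.card β) (Set.range (verifiedOutput o e)) := by
  -- The conjunction of the first `j` test results; the extra operation makes the constant `true`
  -- for `j = 0`.
  have hand : ∀ j ≤ k, Derives (Set.range fun w (v : A ⊕ Fin k × CheckWires β m → Bool) => v w)
      (j + 1) {fun v => decide (∀ i : Fin k, (i : ℕ) < j → v (Sum.inr (i, Sum.inl ())) = false)} := by
    intro j
    induction j with
    | zero =>
      intro _
      have hw := Set.mem_range_self (f := fun w (v : A ⊕ Fin k × CheckWires β m → Bool) => v w)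
        (Sum.inl (Classical.arbitrary A))
      refine (Derives.op (fun _ _ => true) hw hw).mono_right ?_
      rintro f rfl
      simp
    | succ j ih =>
      intro hj
      refine (ih (by omega)).trans ((Derives.op (fun x y => x && !y) (Or.inr rfl)
        (Or.inl ⟨Sum.inr (⟨j, hj⟩, Sum.inl ()), rfl⟩)).mono_right ?_)
      rintro f rfl
      funext v
      rw [Bool.eq_iff_iff]
      simp only [Bool.and_eq_true, decide_eq_true_eq, Bool.not_eq_true', Nat.lt_succ_iff]
      constructor
      · exact fun h => ⟨fun i hi => h i hi.le, h _ le_rfl⟩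
      · rintro ⟨h, h'⟩ i hi
        rcases hi.lt_or_eq with hi | hi
        · exact h i hi
        · rwa [show i = ⟨j, hj⟩ from Fin.ext hi]
  refine (hand k le_rfl).trans (((Derives.range_fintype (d := 1) fun b => ?_)).mono_cost (by simp))
  refine (Derives.op (fun x y => if x then y else e b) (Or.inr rfl)
    (Or.inl ⟨Sum.inl (o b), rfl⟩)).mono_right ?_
  rintro f rfl
  funext v
  simp [HSP.verifiedOutput]

variable {β : Type} {m : ℕ} {A : Type} [Fintype A] [DecidableEq A]

theorem eq_zero_of_mass_eq_zero {ψ : QState A} {E : Set (A → Bool)} (h : mass ψ E = 0)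
    {a : A → Bool} (ha : a ∈ E) : ‖ψ a‖ ^ 2 = 0 := by
  have := (Finset.sum_eq_zero_iff_of_nonneg fun v _ =>
    Set.indicator_nonneg (fun _ _ => by positivity) v).1 h a (Finset.mem_univ a)
  rwa [Set.indicator_of_mem ha] at this

/-- The wires of a circuit with `k` comparisons of its output. -/
abbrev VerifiedWires (β : Type) [Fintype β] (m : ℕ) (A : Type) (k : ℕ) : Type :=
  (A ⊕ Fin k × CheckWires β m) ⊕ Fin (k + 1 + Fintype.card β)

/-- Soundness and completeness of the tests: a candidate outside `T` almost surely has an oracle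
value different from that at `e`, so it survives `k` tests with probability `1 / 2 ^ k`, while a
candidate with the same oracle value as `e` always survives. The set `T` is left free, as it will be
`H`, a single element, or the part of `H` outside `K`. -/
theorem exists_verified [Fintype β] [DecidableEq β] [Nonempty A] (gs : List (Gate β m A)) (o : β → A) (e : β → Bool) (k : ℕ) :
    ∃ (gs' : List (Gate β m (VerifiedWires β m A k))) (o' : β → VerifiedWires β m A k),
      gs'.length ≤ gs.length + k * (2 * Fintype.card β + 3) + (k + 1 + Fintype.card β) ∧
      ∀ F : (β → Bool) → Fin m → Bool,
        (∀ T : Set (β → Bool), e ∈ T → mass (run F gs zeroState) {a | a ∘ o ∉ T ∧ F (a ∘ o) = F e} = 0 →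
          mass (run F gs' zeroState) {v | v ∘ o' ∉ T} ≤ (1 / 2) ^ k) ∧
        ∀ T : Set (β → Bool), (∀ x ∈ T, F x = F e) →
          mass (run F gs zeroState) {a | a ∘ o ∈ T} ≤ mass (run F gs' zeroState) {v | v ∘ o' ∈ T} := by
  classical
  obtain ⟨chk, hlchk, hchk⟩ := exists_check_gates (m := m) o e
  obtain ⟨cl, o', hlcl, hcl⟩ :=
    (Derives.verifiedOutput (m := m) (k := k) o e).compile (β := β) (m := m)
  let inner : List (Gate β m (A ⊕ Fin k × CheckWires β m)) :=
    gs.map (Gate.map ⟨Sum.inl, Sum.inl_injective⟩) ++ replicateGates fun _ : Fin k => chk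
  refine ⟨inner.map (Gate.map ⟨Sum.inl, Sum.inl_injective⟩) ++ cl, o', ?_, fun F => ?_⟩
  · have := length_replicateGates (gs := fun _ : Fin k => chk) fun _ => hlchk.le
    simp only [List.length_append, List.length_map, inner]
    rw [Fintype.card_fin] at this
    omega
  set Ψ := run F gs zeroState with hΨ
  let φ : QState (A ⊕ Fin k × CheckWires β m) := fun v => Ψ (v ∘ Sum.inl) *
    ∏ i, checkState F ((v ∘ Sum.inl) ∘ o) e fun w => v (Sum.inr (i, w))
  have hinner : run F inner zeroState = φ := by
    rw [run_append, ← padded_zeroState, run_map_inl]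
    exact run_replicateGates (χ := fun _ a => checkState F (a ∘ o) e) (fun _ Φ => hchk F Φ) Ψ
  have hout : ∀ E : Set (β → Bool), mass (run F (inner.map (Gate.map ⟨Sum.inl, Sum.inl_injective⟩) ++ cl) zeroState)
      {v | v ∘ o' ∈ E} = mass φ {v | (fun b => verifiedOutput o e b v) ∈ E} := by
    intro E
    rw [run_append, ← padded_zeroState, run_map_inl, hinner]
    exact hcl F φ E
  have hpass : ∀ S : Set (A → Bool),
      mass φ {v | v ∘ Sum.inl ∈ S ∧ ∀ i : Fin k, (fun w => v (Sum.inr (i, w))) ∈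
        {w : CheckWires β m → Bool | w (Sum.inl ()) = false}} =
      ∑ a, S.indicator (fun a => ‖Ψ a‖ ^ 2 * (if F (a ∘ o) = F e then 1 else 1 / 2) ^ k) a := by
    intro S
    refine (mass_prod Ψ (fun (_ : Fin k) a => checkState F (a ∘ o) e) S _).trans ?_
    refine Finset.sum_congr rfl fun a _ => ?_
    congr 1
    funext a
    simp only [mass_checkState, Finset.prod_const, Finset.card_univ, Fintype.card_fin]
  constructor
  · intro T he hT
    refine (hout Tᶜ).trans_le ((mass_mono φ
      (E' := {v | v ∘ Sum.inl ∈ {a : A → Bool | a ∘ o ∉ T} ∧ ∀ i : Fin k,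
        (fun w => v (Sum.inr (i, w))) ∈ {w : CheckWires β m → Bool | w (Sum.inl ()) = false}})
      ?_).trans ((hpass {a | a ∘ o ∉ T}).trans_le ?_))
    · intro v hv
      have hv' : (fun b => verifiedOutput o e b v) ∉ T := hv
      by_cases hp : ∀ i, v (Sum.inr (i, Sum.inl ())) = false
      · refine ⟨?_, hp⟩
        simp only [verifiedOutput, if_pos hp] at hv'
        exact hv'
      · simp only [verifiedOutput, if_neg hp] at hv'
        exact absurd he hv'
    · calc _ ≤ ∑ a, ‖Ψ a‖ ^ 2 * (1 / 2) ^ k := by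
            refine Finset.sum_le_sum fun a _ => ?_
            by_cases ha : a ∘ o ∉ T
            · rw [Set.indicator_of_mem (by exact ha)]
              split_ifs with hF
              · rw [eq_zero_of_mass_eq_zero hT (by exact ⟨ha, hF⟩)]
                simp
              · exact le_rfl
            · rw [Set.indicator_of_notMem (by exact ha)]
              positivity
        _ = mass Ψ Set.univ * (1 / 2) ^ k := by
            rw [← Finset.sum_mul]
            simp [mass]
        _ = (1 / 2) ^ k := by rw [mass_run, mass_zeroState_univ, one_mul]
  · intro T hT
    refine le_trans (le_of_eq ?_) ((mass_mono φ (E := {v | v ∘ Sum.inl ∈ {a : A → Bool | a ∘ o ∈ T} ∧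
      ∀ i : Fin k, (fun w => v (Sum.inr (i, w))) ∈
        {w : CheckWires β m → Bool | w (Sum.inl ()) = false}}) ?_).trans_eq (hout T).symm)
    · rw [hpass, mass]
      refine Finset.sum_congr rfl fun a _ => ?_
      by_cases ha : a ∘ o ∈ T
      · rw [Set.indicator_of_mem (by exact ha), Set.indicator_of_mem (by exact ha), if_pos (hT _ ha)]
        simp
      · rw [Set.indicator_of_notMem (by exact ha), Set.indicator_of_notMem (by exact ha)]
    · rintro v ⟨hv, hp⟩
      have hp' : ∀ i, v (Sum.inr (i, Sum.inl ())) = false := hp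
      change (fun b => verifiedOutput o e b v) ∈ T
      simp only [verifiedOutput, if_pos hp']
      exact hv

end Verify

/-! ### Running many circuits in parallel -/

section Parallel

variable {β : Type} {m : ℕ} {B : Type} {F : (β → Bool) → Fin m → Bool}

theorem run_map_inr {A : Type} (gs : List (Gate β m B)) (Φ : QState A) :
    run F (gs.map (Gate.map ⟨Sum.inr, Sum.inr_injective⟩)) (padded Φ : QState (A ⊕ B)) =
      fun v => Φ (v ∘ Sum.inl) * run F gs zeroState (v ∘ Sum.inr) := by
  funext v
  rw [run_map]
  have : (fun u => (padded Φ : QState (A ⊕ B)) (extend Sum.inr u v)) =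
      fun u => zeroState u * Φ (v ∘ Sum.inl) := by
    funext u
    have hu : extend Sum.inr u v = Sum.elim (v ∘ Sum.inl) u := by
      funext w
      cases w with
      | inl w => exact extend_apply' _ _ _ (by simp)
      | inr w => exact Sum.inr_injective.extend_apply _ _ _
    rw [hu, mul_comm]
    rfl
  rw [mul_comm]
  exact (congrFun (congrArg _ this) _).trans (congrFun (run_mul_const gs zeroState _) (v ∘ Sum.inr))

/-- The circuit that runs the circuits `gs i` on separate copies of their wires. -/
def parallel {N : ℕ} (gs : Fin N → List (Gate β m B)) (o : Fin N → β → B) :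
    Circuit β m (Empty ⊕ Fin N × B) where
  gates := replicateGates fun i => (gs i).map (Gate.map ⟨Sum.inr, Sum.inr_injective⟩)
  numOut := N
  out i b := Sum.inr (i, o i b)

theorem parallel_size {N M : ℕ} {gs : Fin N → List (Gate β m B)} (o : Fin N → β → B)
    (h : ∀ i, (gs i).length ≤ M) : (parallel gs o).size ≤ N * M + N := by
  have := length_replicateGates (A := Empty) (N := M)
    (gs := fun i => (gs i).map (Gate.map ⟨Sum.inr, Sum.inr_injective⟩)) fun i => by simpa using h i
  rw [Fintype.card_fin] at this
  exact Nat.add_le_add_right this N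

/-- The shared register is empty here, so conditional independence becomes independence. -/
theorem mass_parallel [Fintype B] [DecidableEq B] {N : ℕ} (gs : Fin N → List (Gate β m B))
    (o : Fin N → β → B) (E : Fin N → Set (B → Bool)) :
    mass (run F (parallel gs o).gates zeroState) {v | ∀ i, (fun w => v (Sum.inr (i, w))) ∈ E i} =
      ∏ i, mass (run F (gs i) zeroState) (E i) := by
  have h := run_replicateGates (F := F) (A := Empty)
    (gs := fun i => (gs i).map (Gate.map ⟨Sum.inr, Sum.inr_injective⟩))
    (χ := fun i _ => run F (gs i) zeroState) (fun i Φ => run_map_inr (gs i) Φ) zeroState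
  rw [parallel, ← padded_zeroState, h]
  have h2 := mass_prod (A := Empty) zeroState (fun i _ => run F (gs i) zeroState) Set.univ E
  simp only [Set.mem_univ, true_and] at h2
  rw [h2, Fintype.sum_unique, Set.indicator_univ, zeroState, ind_pos (Subsingleton.elim _ _)]
  simp

end Parallel

/-! ### From samplers to a circuit for the hidden subgroup problem -/

section Amplify

theorem oracle_enc {G β : Type} {m : ℕ} (enc : G ↪ (β → Bool)) (f : G → Fin m → Bool) (g : G) :
    oracle enc f (enc g) = f g :=
  enc.injective.extend_apply _ _ _

variable {β : Type} {m : ℕ} {A G : Type} [Fintype β] [DecidableEq β] [Fintype A] [DecidableEq A]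
  [Nonempty A] [Group G]

set_option synthInstance.maxSize 1000 in
/-- From circuits that put out candidates to a circuit that solves a hidden subgroup problem: the
first of the `N + 1` candidates is `g₀`, and each of the others generates `H` modulo `K` with
probability `ρ`. -/
theorem exists_circuit_of_samplers (enc : G ↪ (β → Bool)) (K : Subgroup G) (g₀ : G)
    (hK : ∀ H H' : Subgroup G, H' ≤ H → (g₀ ∈ H → g₀ ∈ H') →
      (¬ H ≤ K → ∃ h ∈ H', h ∉ K) → H' = H)
    (N k M : ℕ) (ρ : ℝ) (hρ : ρ ≤ 1) (gs : Fin (N + 1) → List (Gate β m A))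
    (hlen : ∀ i, (gs i).length ≤ M) (o : Fin (N + 1) → β → A)
    (henc : ∀ i (f : G → Fin m → Bool),
      mass (run (oracle enc f) (gs i) zeroState) {a | a ∘ o i ∉ Set.range enc} = 0)
    (h0 : ∀ f : G → Fin m → Bool,
      mass (run (oracle enc f) (gs 0) zeroState) {a | a ∘ o 0 ∈ ({enc g₀} : Set _)} = 1)
    (hhit : ∀ i ≠ 0, ∀ (f : G → Fin m → Bool) (H : Subgroup G), Hides f H → ¬ H ≤ K →
      ρ ≤ mass (run (oracle enc f) (gs i) zeroState) {a | a ∘ o i ∈ enc '' {h | h ∈ H ∧ h ∉ K}}) :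
    ∃ c : Circuit β m (Empty ⊕ Fin (N + 1) × VerifiedWires β m A k),
      c.size ≤ (N + 1) * (M + k * (2 * Fintype.card β + 3) + (k + 1 + Fintype.card β) + 1) ∧
      ∀ (H : Subgroup G) (f : G → Fin m → Bool), Hides f H →
        1 - (N + 1) * (1 / 2) ^ k - (1 - ρ) ^ N ≤
          c.prob (oracle enc f) (correctOutcomes enc c H) := by
  classical
  choose gs' o' hlen' hv using fun i => exists_verified (gs i) (o i) (enc 1) k
  refine ⟨parallel gs' o', ?_, fun H f hf => ?_⟩
  · refine (parallel_size o' fun i => (hlen' i).trans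
      (Nat.add_le_add_right (Nat.add_le_add_right (hlen i) _) _)).trans ?_
    rw [mul_add _ _ 1, mul_one]
  set F := oracle enc f with hFdef
  -- Comparing with the value at the identity tests membership in `H`.
  have hF : ∀ g, F (enc g) = F (enc 1) ↔ g ∈ H := by
    intro g
    rw [hFdef, oracle_enc, oracle_enc, hf g 1, mul_one, H.inv_mem_iff]
  -- Output `0` must be `g₀` itself when `g₀ ∈ H`; merely lying in `H` would also allow the default
  -- output, the identity.
  let T : Fin (N + 1) → Set (β → Bool) := fun i =>
    if i = 0 ∧ g₀ ∈ H then {enc g₀} else enc '' H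
  let E : ∀ i, Set (VerifiedWires β m A k → Bool) := fun i => {v | v ∘ o' i ∈ T i}
  have hTH : ∀ i, T i ⊆ enc '' H := by
    intro i
    simp only [T]
    split_ifs with h
    · exact Set.singleton_subset_iff.2 ⟨g₀, h.2, rfl⟩
    · exact le_rfl
  have hE : ∀ i, 1 - (1 / 2) ^ k ≤ mass (run F (gs' i) zeroState) (E i) := by
    intro i
    by_cases h : i = 0 ∧ g₀ ∈ H
    · have hT : T i = {enc g₀} := if_pos h
      have h2 := (hv i F).2 (T i) (by
        rintro x hx
        rw [hT, Set.mem_singleton_iff] at hx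
        rw [hx, hF]
        exact h.2)
      refine le_trans ?_ h2
      obtain ⟨rfl, -⟩ := h
      rw [hT]
      have : (0 : ℝ) ≤ (1 / 2) ^ k := by positivity
      linarith [(h0 f).ge]
    · have hT : T i = enc '' H := if_neg h
      -- A string outside the code words of `H` that shares the value at the identity cannot be a
      -- code word, and such strings have weight zero by `henc`. This matters because the oracle's
      -- default value zero may equal `f 1`.
      have h1 := (hv i F).1 (T i) (by
          rw [hT]
          exact ⟨1, H.one_mem, rfl⟩) (le_antisymm ((mass_mono _ ?_).trans_eq (henc i f))
            (mass_nonneg _ _))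
      · have h2 := mass_compl (run F (gs' i) zeroState) (E i)
        rw [mass_run, mass_zeroState_univ] at h2
        have h3 : mass (run F (gs' i) zeroState) (E i)ᶜ ≤ (1 / 2) ^ k := h1
        linarith
      · rintro a ⟨ha, haF⟩ ⟨g, hg⟩
        rw [hT, ← hg] at ha
        rw [← hg, hF] at haF
        exact ha ⟨g, haF, rfl⟩
  have hprod : 1 - (N + 1) * (1 / 2) ^ k ≤ ∏ i, mass (run F (gs' i) zeroState) (E i) := by
    have hk1 : ((1 : ℝ) / 2) ^ k ≤ 1 := pow_le_one₀ (by norm_num) (by norm_num)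
    have hb := one_add_mul_le_pow (a := -((1 : ℝ) / 2) ^ k) (by linarith) (N + 1)
    calc (1 : ℝ) - (N + 1) * (1 / 2) ^ k ≤ (1 - (1 / 2) ^ k) ^ (N + 1) := by
          push_cast at hb
          rw [sub_eq_add_neg 1 (((1 : ℝ) / 2) ^ k)]
          linarith
      _ = ∏ _i : Fin (N + 1), (1 - (1 / 2) ^ k : ℝ) := by simp
      _ ≤ _ := Finset.prod_le_prod (fun _ _ => by linarith) fun i _ => hE i
  -- outcomes for which all the outputs lie in `H` and the group they generate is large enough
  have hcorrect : ∀ v : Empty ⊕ Fin (N + 1) × VerifiedWires β m A k → Bool,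
      (∀ i, (fun w => v (Sum.inr (i, w))) ∈ E i) →
      (¬ H ≤ K → ∃ i, (fun w => v (Sum.inr (i, w))) ∘ o' i ∈ enc '' {h | h ∈ H ∧ h ∉ K}) →
      v ∈ correctOutcomes enc (parallel gs' o') H := by
    intro v hvE hvK
    choose g hgH hg using fun i => hTH i (hvE i)
    refine ⟨g, hg, hK H _ ?_ ?_ ?_⟩
    · rw [Subgroup.closure_le]
      rintro _ ⟨i, rfl⟩
      exact hgH i
    · intro hg₀
      have h1 := hvE 0
      have hT : T 0 = {enc g₀} := if_pos ⟨rfl, hg₀⟩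
      simp only [E, hT] at h1
      have h2 : g 0 = g₀ := enc.injective ((hg 0).trans h1)
      exact h2 ▸ Subgroup.subset_closure ⟨(0 : Fin (N + 1)), rfl⟩
    · intro h
      obtain ⟨i, h', hh', hi⟩ := hvK h
      have h2 : g i = h' := enc.injective ((hg i).trans hi.symm)
      exact ⟨g i, Subgroup.subset_closure (Set.mem_range_self i), h2 ▸ hh'.2⟩
  rw [prob_eq_mass]
  by_cases hHK : H ≤ K
  · refine le_trans ?_ (mass_mono _ (E := {v | ∀ i, (fun w => v (Sum.inr (i, w))) ∈ E i})
      fun v hv => hcorrect v hv fun h => absurd hHK h)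
    have hpar := mass_parallel (F := F) gs' o' E
    have : 0 ≤ (1 - ρ) ^ N := pow_nonneg (by linarith) N
    linarith
  · let hit : ∀ i, Set (VerifiedWires β m A k → Bool) := fun i =>
      {v | v ∘ o' i ∈ enc '' {h | h ∈ H ∧ h ∉ K}}
    let E' : ∀ i, Set (VerifiedWires β m A k → Bool) := fun i => E i \ hit i
    have hE' : ∏ i, mass (run F (gs' i) zeroState) (E' i) ≤ (1 - ρ) ^ N := by
      -- Nothing is assumed about hits by candidate `0`, so its factor is bounded by `1` and the
      -- exponent is `N`.
      rw [Fin.prod_univ_succ]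
      calc _ ≤ 1 * ∏ _i : Fin N, (1 - ρ) := by
            refine mul_le_mul (mass_run_zeroState_le _ _) (Finset.prod_le_prod
              (fun i _ => mass_nonneg _ _) fun i _ => ?_) (Finset.prod_nonneg
              fun i _ => mass_nonneg _ _) zero_le_one
            have h2 := (hhit i.succ (Fin.succ_ne_zero i) f H hf hHK).trans
              ((hv i.succ F).2 (enc '' {h | h ∈ H ∧ h ∉ K}) (by
                rintro _ ⟨h, hh, rfl⟩
                exact (hF h).2 hh.1))
            have h3 := mass_compl (run F (gs' i.succ) zeroState) (hit i.succ)
            rw [mass_run, mass_zeroState_univ] at h3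
            have h4 : mass (run F (gs' i.succ) zeroState) (E' i.succ) ≤
              mass (run F (gs' i.succ) zeroState) (hit i.succ)ᶜ := mass_mono _ fun v hv => hv.2
            have h5 : ρ ≤ mass (run F (gs' i.succ) zeroState) (hit i.succ) := h2
            linarith
        _ = _ := by simp
    have hsub : {v : Empty ⊕ Fin (N + 1) × VerifiedWires β m A k → Bool |
        ∀ i, (fun w => v (Sum.inr (i, w))) ∈ E' i} ⊆ {v | ∀ i, (fun w => v (Sum.inr (i, w))) ∈ E i} :=
      fun v hv i => (hv i).1
    -- All outputs are acceptable but not all of them miss: the weight of this event is a difference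
    -- of two products.
    refine le_trans ?_ (mass_mono _ (E := {v | ∀ i, (fun w => v (Sum.inr (i, w))) ∈ E i} \
      {v | ∀ i, (fun w => v (Sum.inr (i, w))) ∈ E' i}) ?_)
    · have hpar := mass_parallel (F := F) gs' o' E
      have hpar' := mass_parallel (F := F) gs' o' E'
      have hdiff := mass_diff (run F (parallel gs' o').gates zeroState) hsub
      linarith
    · rintro v ⟨hv, hv'⟩
      refine hcorrect v hv fun _ => ?_
      by_contra hno
      exact hv' fun i => ⟨hv i, fun hi => hno ⟨i, hi⟩⟩

end Amplify

end HSP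

end

noncomputable section

namespace HSP

open Function

/-! ### The quantum Fourier transform modulo a power of two -/

section Fourier

/-- `exp (2πit)`. -/
def ex (t : ℝ) : ℂ := Complex.exp (Complex.I * (2 * Real.pi * t : ℝ))

theorem ex_add (s t : ℝ) : ex (s + t) = ex s * ex t := by
  rw [ex, ex, ex, ← Complex.exp_add]
  congr 1
  push_cast
  ring

theorem ex_zero : ex 0 = 1 := by simp [ex]

theorem ex_intCast (n : ℤ) : ex n = 1 := by
  rw [ex, Complex.exp_eq_one_iff]
  refine ⟨n, ?_⟩
  push_cast
  ring

theorem ex_natCast (n : ℕ) : ex n = 1 := by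
  exact_mod_cast ex_intCast n

theorem ex_add_intCast (t : ℝ) (n : ℤ) : ex (t + n) = ex t := by
  rw [ex_add, ex_intCast, mul_one]

theorem ex_half : ex (1 / 2) = -1 := by
  rw [ex, ← Complex.exp_pi_mul_I]
  congr 1
  push_cast
  ring

theorem norm_ex (t : ℝ) : ‖ex t‖ = 1 := by
  rw [ex, mul_comm]
  exact Complex.norm_exp_ofReal_mul_I _

theorem norm_ex_sub_one_le (t : ℝ) : ‖ex t - 1‖ ≤ 2 * Real.pi * |t| := by
  refine Real.norm_exp_I_mul_ofReal_sub_one_le.trans_eq ?_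
  rw [Real.norm_eq_abs, abs_mul, abs_of_pos Real.two_pi_pos]

theorem ofBits_eq_sum {n : ℕ} (x : Fin n → Bool) :
    Nat.ofBits x = ∑ i, if x i then 2 ^ (i : ℕ) else 0 := by
  induction n with
  | zero => simp
  | succ n ih =>
    rw [Nat.ofBits_succ, ih, Fin.sum_univ_succ, Finset.mul_sum, add_comm]
    congr 1
    · cases x 0 <;> simp
    · refine Finset.sum_congr rfl fun i _ => ?_
      simp only [comp_apply, Fin.val_succ, mul_ite, mul_zero]
      rw [pow_succ']

theorem ofBits_snoc {n : ℕ} (x : Fin n → Bool) (c : Bool) :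
    Nat.ofBits (Fin.snoc x c : Fin (n + 1) → Bool) = Nat.ofBits x + 2 ^ n * c.toNat := by
  rw [ofBits_eq_sum, ofBits_eq_sum, Fin.sum_univ_castSucc]
  simp only [Fin.snoc_castSucc, Fin.snoc_last, Fin.val_castSucc, Fin.val_last]
  cases c <;> simp

theorem ofBits_rev_succ {n : ℕ} (y : Fin (n + 1) → Bool) :
    Nat.ofBits (y ∘ Fin.rev) =
      2 * Nat.ofBits ((y ∘ Fin.castSucc) ∘ Fin.rev) + (y (Fin.last n)).toNat := by
  rw [Nat.ofBits_succ]
  congr 3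
  funext i
  simp [Fin.rev_succ]

variable {β : Type} {m : ℕ} {W : Type}

theorem exists_phases {L : ℕ} (r : Fin (L + 1) ↪ W) :
    ∃ gs : List (Gate β m W), gs.length = L ∧ ∀ (F : (β → Bool) → Fin m → Bool) ψ v,
      run F gs ψ v = ex (if v (r (Fin.last L)) then
        (Nat.ofBits fun i : Fin L => v (r i.castSucc)) / 2 ^ (L + 1) else 0) * ψ v := by
  choose g hg using fun i : Fin L => exists_phase_gate (β := β) (m := m)
    (i := r i.castSucc) (j := r (Fin.last L))
    (fun h => Fin.castSucc_ne_last i (r.injective h)) (2 * Real.pi * (2 ^ (i : ℕ) / 2 ^ (L + 1)))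
  have hlist : ∀ (l : List (Fin L)) (F : (β → Bool) → Fin m → Bool) ψ v, run F (l.map g) ψ v =
      ex ((l.map fun i : Fin L => if v (r (Fin.last L)) then
        (if v (r i.castSucc) then (2 : ℝ) ^ (i : ℕ) / 2 ^ (L + 1) else 0) else 0).sum) * ψ v := by
    intro l
    induction l with
    | nil => intros; simp [run_nil, ex_zero]
    | cons i l ih =>
      intro F ψ v
      rw [List.map_cons, run_cons, ih, hg, List.map_cons, List.sum_cons, ex_add, ← mul_assoc,
        mul_comm (ex (List.sum _))]
      congr 2
      cases v (r i.castSucc) <;> cases v (r (Fin.last L)) <;> simp [ex]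
  refine ⟨(List.finRange L).map g, by simp, fun F ψ v => ?_⟩
  rw [hlist, ← List.ofFn_eq_map, List.sum_ofFn, ofBits_eq_sum]
  congr 2
  split_ifs
  · push_cast
    rw [Finset.sum_div]
    refine Finset.sum_congr rfl fun i _ => ?_
    split_ifs <;> simp
  · simp

variable [DecidableEq W]

/-- Write the input as `X + 2 ^ L * c` and the output as `2 * Y + d`. Modulo one, their product over
`2 ^ (L + 1)` is `X * Y / 2 ^ L + X * d / 2 ^ (L + 1) + c * d / 2`: a smaller transform, controlled
phases and a Hadamard gate. The output bits are left in reversed order. -/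
theorem exists_fourier_gates {L : ℕ} (r : Fin L ↪ W) :
    ∃ gs : List (Gate β m W), gs.length ≤ L * (L + 1) ∧
      ∀ (F : (β → Bool) → Fin m → Bool) ψ v, run F gs ψ v =
        rsqrt ^ L * ∑ x : Fin L → Bool,
          ex (Nat.ofBits x * Nat.ofBits ((v ∘ r) ∘ Fin.rev) / 2 ^ L) * ψ (extend r x v) := by
  induction L with
  | zero =>
    refine ⟨[], by simp, fun F ψ v => ?_⟩
    have : ∀ x, extend r x v = v := by
      intro x
      funext w
      exact extend_apply' _ _ _ (by simp)
    simp only [run_nil, pow_zero, one_mul, Fintype.sum_unique, this]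
    simp [ex_zero]
  | succ L ih =>
    obtain ⟨gs, hlen, hgs⟩ := ih (Fin.castSuccEmb.trans r)
    obtain ⟨ph, hlph, hph⟩ := exists_phases (β := β) (m := m) r
    obtain ⟨hd, hhd⟩ := exists_hadamard_gate (β := β) (m := m) (r (Fin.last L))
    refine ⟨hd :: (ph ++ gs), ?_, fun F ψ v => ?_⟩
    · simp only [List.length_cons, List.length_append, hlph]
      nlinarith
    rw [run_cons, run_append, hgs]
    have hlast : ∀ x : Fin L → Bool,
        extend (Fin.castSuccEmb.trans r) x v (r (Fin.last L)) = v (r (Fin.last L)) := by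
      intro x
      refine extend_apply' _ _ _ ?_
      rintro ⟨i, hi⟩
      exact Fin.castSucc_ne_last i (r.injective hi)
    have hlow : ∀ x : Fin L → Bool,
        (fun i : Fin L => extend (Fin.castSuccEmb.trans r) x v (r i.castSucc)) = x :=
      fun x => funext fun i => (Fin.castSuccEmb.trans r).injective.extend_apply x v i
    have hupd : ∀ (x : Fin L → Bool) (c : Bool),
        update (extend (Fin.castSuccEmb.trans r) x v) (r (Fin.last L)) c =
          extend r (Fin.snoc x c : Fin (L + 1) → Bool) v := by
      intro x c
      funext w
      by_cases hw : ∃ i, r i = w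
      · obtain ⟨i, rfl⟩ := hw
        rw [r.injective.extend_apply]
        induction i using Fin.lastCases with
        | last => simp
        | cast i =>
          rw [update_of_ne (r.injective.ne (Fin.castSucc_ne_last i)), Fin.snoc_castSucc]
          exact congrFun (hlow x) i
      · rw [extend_apply' _ _ _ hw, update_of_ne, extend_apply']
        · rintro ⟨i, hi⟩
          exact hw ⟨_, hi⟩
        · rintro rfl
          exact hw ⟨_, rfl⟩
    rw [← Equiv.sum_comp (Fin.snocEquiv fun _ : Fin (L + 1) => Bool), Fintype.sum_prod_type_right]
    simp only [hph, hhd, hlast, hlow, hupd]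
    rw [pow_succ rsqrt, mul_assoc]
    congr 1
    rw [Finset.mul_sum]
    refine Finset.sum_congr rfl fun x _ => ?_
    simp only [Finset.mul_sum]
    refine Finset.sum_congr rfl fun c _ => ?_
    have key : ex (Nat.ofBits (Fin.snoc x c : Fin (L + 1) → Bool) *
          Nat.ofBits ((v ∘ r) ∘ Fin.rev) / 2 ^ (L + 1)) =
        ex (Nat.ofBits x * Nat.ofBits ((v ∘ Fin.castSuccEmb.trans r) ∘ Fin.rev) / 2 ^ L) *
          ex (if v (r (Fin.last L)) then (Nat.ofBits x : ℝ) / 2 ^ (L + 1) else 0) *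
          sgn (v (r (Fin.last L))) c := by
      rw [ofBits_snoc, ofBits_rev_succ (v ∘ r)]
      change ex (_ * ((2 * Nat.ofBits ((v ∘ Fin.castSuccEmb.trans r) ∘ Fin.rev) +
        (v (r (Fin.last L))).toNat : ℕ) : ℝ) / _) = _
      generalize Nat.ofBits ((v ∘ Fin.castSuccEmb.trans r) ∘ Fin.rev) = Y
      generalize Nat.ofBits x = X
      -- The remaining cross term `c * Y` is an integer and does not change the phase.
      have hs : sgn (v (r (Fin.last L))) c =
          ex (c.toNat * Y + (c.toNat * (v (r (Fin.last L))).toNat : ℝ) / 2) := by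
        rw [ex_add, ← Nat.cast_mul, ex_natCast, one_mul]
        cases v (r (Fin.last L)) <;> cases c <;> simp [sgn, ex_zero]
        rw [← ex_half]
        norm_num
      rw [hs, ← ex_add, ← ex_add]
      congr 1
      cases v (r (Fin.last L)) <;> simp <;> field_simp <;> ring
    change _ = rsqrt * (ex (Nat.ofBits (Fin.snoc x c : Fin (L + 1) → Bool) *
          Nat.ofBits ((v ∘ r) ∘ Fin.rev) / 2 ^ (L + 1)) * ψ (extend r (Fin.snoc x c : Fin (L + 1) → Bool) v))
    rw [key]
    ring

/-- Hadamard gates on the wires `s` turn `|0…0⟩` into a uniform superposition. -/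
theorem exists_uniform_gates (s : Finset W) :
    ∃ gs : List (Gate β m W), gs.length = s.card ∧ ∀ F : (β → Bool) → Fin m → Bool,
      run F gs zeroState = fun v => rsqrt ^ s.card * ind (∀ w ∉ s, v w = false) := by
  induction s using Finset.induction_on with
  | empty =>
    refine ⟨[], rfl, fun F => ?_⟩
    funext v
    simp [run_nil, zeroState, funext_iff]
  | insert w s hw ih =>
    obtain ⟨gs, hlen, hgs⟩ := ih
    obtain ⟨hd, hhd⟩ := exists_hadamard_gate (β := β) (m := m) w
    refine ⟨gs ++ [hd], by simp [hlen, Finset.card_insert_of_notMem hw], fun F => ?_⟩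
    rw [run_append, hgs, run_cons, run_nil]
    funext v
    rw [hhd, Finset.card_insert_of_notMem hw, pow_succ', mul_assoc, Fintype.sum_bool]
    congr 1
    have h1 : ¬ ∀ w' ∉ s, update v w true w' = false := fun h => by simpa using h w hw
    have h2 : (∀ w' ∉ s, update v w false w' = false) ↔ ∀ w' ∉ insert w s, v w' = false := by
      constructor
      · intro h w' hw'
        rw [Finset.mem_insert, not_or] at hw'
        simpa [update_of_ne hw'.1] using h w' hw'.2
      · intro h w' hw'
        by_cases hww : w' = w
        · subst hww
          simp
        · rw [update_of_ne hww]
          exact h w' (by simp [hww, hw'])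
    rw [ind_neg h1, propext h2]
    simp [sgn]

end Fourier

end HSP

end

noncomputable section

namespace HSP

open Function

/-! ### Modular arithmetic by logical operations -/

section Arithmetic

variable {X : Type} {A : Set (X → Bool)} {K : ℕ}

/-- The bits of a number that depends on `x : X`. -/
def bitSet (N : X → BitVec K) : Set (X → Bool) := Set.range fun (j : Fin K) x => (N x).getLsbD j

theorem mem_bitSet (N : X → BitVec K) {j : ℕ} (hj : j < K) :
    (fun x => (N x).getLsbD j) ∈ bitSet N := ⟨⟨j, hj⟩, rfl⟩

theorem bit_mem {N : X → BitVec K} (hN : bitSet N ⊆ A) {j : ℕ} (hj : j < K) :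
    (fun x => (N x).getLsbD j) ∈ A := hN (mem_bitSet N hj)

namespace Derives

theorem bitSet_of {N : X → BitVec K} {d : ℕ}
    (h : ∀ j < K, Derives A d {fun x => (N x).getLsbD j}) : Derives A (K * d) (bitSet N) :=
  range_fin fun j => h j j.2

theorem const (hA : A.Nonempty) (b : Bool) : Derives A 1 {fun _ => b} := by
  obtain ⟨f, hf⟩ := hA
  exact op (fun _ _ => b) hf hf

theorem const_bitSet (hA : A.Nonempty) (N : BitVec K) : Derives A K (bitSet fun _ : X => N) :=
  (bitSet_of fun j _ => const hA (N.getLsbD j)).mono_cost (by omega)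

theorem not_bitSet {N : X → BitVec K} (hN : bitSet N ⊆ A) :
    Derives A K (bitSet fun x => ~~~ N x) := by
  refine (bitSet_of fun j hj => ((op (fun a _ => !a) (bit_mem hN hj) (bit_mem hN hj)).mono_right
    ?_)).mono_cost (c := K * 1) (by omega)
  rintro f rfl
  simp [hj]

theorem mask_bitSet {N : X → BitVec K} {b : X → Bool} (hN : bitSet N ⊆ A) (hb : b ∈ A) :
    Derives A K (bitSet fun x => if b x then N x else 0) := by
  refine (bitSet_of fun j hj => ((op (fun a b => a && b) (bit_mem hN hj) hb).mono_right
    ?_)).mono_cost (c := K * 1) (by omega)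
  rintro f rfl
  funext x
  cases b x <;> simp

theorem mux_bitSet {N M : X → BitVec K} {b : X → Bool} (hN : bitSet N ⊆ A) (hM : bitSet M ⊆ A)
    (hb : b ∈ A) : Derives A (3 * K) (bitSet fun x => if b x then N x else M x) := by
  refine (bitSet_of (d := 3) fun j hj => ?_).mono_cost (by omega)
  refine step _ _ (fun b n => b && n) hb (bit_mem hN hj) ?_
  refine step _ _ (fun b n => !b && n) (Or.inr hb) (Or.inr (bit_mem hM hj)) ?_
  refine step _ _ (fun s t => s || t) (Or.inl rfl) (Or.inr (Or.inl rfl)) (base ?_)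
  rintro f rfl
  left
  funext x
  cases b x <;> simp

theorem carries {N M : X → BitVec K} (hN : bitSet N ⊆ A) (hM : bitSet M ⊆ A) (hA : A.Nonempty)
    (c : Bool) (j : ℕ) (hj : j ≤ K) :
    Derives A (4 * j + 1) {f | ∃ i ≤ j, f = fun x => BitVec.carry i (N x) (M x) c} := by
  induction j with
  | zero =>
    refine (const hA c).mono_right ?_
    rintro f ⟨i, hi, rfl⟩
    obtain rfl : i = 0 := by omega
    simp
  | succ j ih =>
    have hstep : Derives (A ∪ {f | ∃ i ≤ j, f = fun x => BitVec.carry i (N x) (M x) c}) 4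
        {fun x => BitVec.carry (j + 1) (N x) (M x) c} := by
      have h1 := bit_mem hN (show j < K by omega)
      have h2 := bit_mem hM (show j < K by omega)
      have h3 : (fun x => BitVec.carry j (N x) (M x) c) ∈
        {f | ∃ i ≤ j, f = fun x => BitVec.carry i (N x) (M x) c} := ⟨j, le_rfl, rfl⟩
      -- The carry is a majority, computed as `(a && b) || ((a || b) && c)`.
      refine step _ _ (fun a b => a && b) (Or.inl h1) (Or.inl h2) ?_
      refine step _ _ (fun a b => a || b) (Or.inr (Or.inl h1)) (Or.inr (Or.inl h2)) ?_
      refine step _ _ (fun t c => t && c) (Or.inl rfl) (Or.inr (Or.inr (Or.inr h3))) ?_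
      refine step _ _ (fun s t => s || t) (Or.inl rfl) (Or.inr (Or.inr (Or.inl rfl))) (base ?_)
      rintro f rfl
      left
      funext x
      rw [BitVec.carry_succ]
      cases (N x).getLsbD j <;> cases (M x).getLsbD j <;> cases BitVec.carry j (N x) (M x) c <;> rfl
    refine ((ih (by omega)).trans hstep.union_self).mono_right ?_ |>.mono_cost (by omega)
    rintro f ⟨i, hi, rfl⟩
    by_cases hij : i = j + 1
    · subst hij
      exact Or.inr rfl
    · exact Or.inl (Or.inr ⟨i, by omega, rfl⟩)

theorem add_bitSet {N M : X → BitVec K} (hN : bitSet N ⊆ A) (hM : bitSet M ⊆ A)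
    (hA : A.Nonempty) : Derives A (6 * K + 1) (bitSet fun x => N x + M x) := by
  refine ((carries hN hM hA false K le_rfl).trans (bitSet_of (d := 2) fun j hj => ?_)).mono_cost
    (by omega)
  refine step _ _ xor (Or.inl (bit_mem hN hj)) (Or.inl (bit_mem hM hj)) ?_
  refine step _ _ xor (Or.inl rfl) (Or.inr (Or.inr ⟨j, hj.le, rfl⟩)) (base ?_)
  rintro f rfl
  left
  funext x
  exact (BitVec.getLsbD_add hj _ _).trans (Bool.xor_assoc _ _ _).symm

/-- The subtraction `N + ~~~M + 1` overflows exactly if `N ≥ M`. -/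
theorem ult_bitSet {N M : X → BitVec K} (hN : bitSet N ⊆ A) (hM : bitSet M ⊆ A)
    (hA : A.Nonempty) : Derives A (5 * K + 2) {fun x => (N x).ult (M x)} := by
  refine ((not_bitSet hM).trans (((carries (A := A ∪ bitSet fun x => ~~~ M x)
    (hN.trans Set.subset_union_left) Set.subset_union_right
    (hA.mono Set.subset_union_left) true K le_rfl)).trans ((op (fun a _ => !a)
    (Or.inr ⟨K, le_rfl, rfl⟩) (Or.inr ⟨K, le_rfl, rfl⟩)).mono_right ?_))).mono_cost (by omega)
  rintro f rfl
  funext x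
  exact BitVec.ult_eq_not_carry _ _

end Derives

/-! ### Arithmetic of residues -/

section Mod

variable {n : ℕ} [NeZero n]

/-- The binary representation of a residue that depends on `x : X`. -/
def residue (K : ℕ) (Z : X → ZMod n) : X → BitVec K := fun x => BitVec.ofNat K (Z x).val

namespace Derives

theorem add_residue (hK : 2 * n ≤ 2 ^ K) {Y Z : X → ZMod n} (hY : bitSet (residue K Y) ⊆ A)
    (hZ : bitSet (residue K Z) ⊆ A) (hA : A.Nonempty) :
    Derives A (22 * K + 4) (bitSet (residue K fun x => Y x + Z x)) := by
  let S : X → BitVec K := fun x => residue K Y x + residue K Z x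
  let b : X → Bool := fun x => (S x).ult (BitVec.ofNat K n)
  -- Subtraction of `n` modulo `2 ^ K`. The sum `S` itself does not overflow, because `2 * n ≤ 2 ^
  -- K`.
  let D : X → BitVec K := fun x => S x + BitVec.ofNat K (2 ^ K - n)
  have hn : 0 < n := Nat.pos_of_ne_zero (NeZero.ne n)
  have h : (residue K fun x => Y x + Z x) = fun x => if b x then S x else D x := by
    funext x
    have hy := ZMod.val_lt (Y x)
    have hz := ZMod.val_lt (Z x)
    have hS : (S x).toNat = (Y x).val + (Z x).val := by
      simp only [S, residue, BitVec.toNat_add, BitVec.toNat_ofNat]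
      rw [Nat.mod_eq_of_lt (by omega : (Y x).val < 2 ^ K),
        Nat.mod_eq_of_lt (by omega : (Z x).val < 2 ^ K), Nat.mod_eq_of_lt (by omega)]
    have hb : b x = true ↔ (Y x).val + (Z x).val < n := by
      simp only [b, BitVec.ult, decide_eq_true_eq, hS, BitVec.toNat_ofNat]
      rw [Nat.mod_eq_of_lt (by omega : n < 2 ^ K)]
    apply BitVec.eq_of_toNat_eq
    simp only [residue, ZMod.val_add, BitVec.toNat_ofNat]
    by_cases hlt : (Y x).val + (Z x).val < n
    · rw [if_pos (hb.2 hlt), hS, Nat.mod_eq_of_lt hlt, Nat.mod_eq_of_lt (by omega)]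
    · rw [if_neg (mt hb.1 hlt)]
      simp only [D, BitVec.toNat_add, hS, BitVec.toNat_ofNat]
      rw [Nat.mod_eq_of_lt (by omega : 2 ^ K - n < 2 ^ K), Nat.mod_eq_sub_mod (by omega : n ≤ _),
        Nat.mod_eq_of_lt (by omega : (Y x).val + (Z x).val - n < n),
        Nat.mod_eq_of_lt (by omega : (Y x).val + (Z x).val - n < 2 ^ K),
        Nat.mod_eq_sub_mod (by omega : 2 ^ K ≤ _), Nat.mod_eq_of_lt (by omega)]
      omega
  rw [h]
  have h1 : Derives A (6 * K + 1) (bitSet S) := add_bitSet hY hZ hA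
  have h2' : Derives (A ∪ bitSet S) (6 * K + 2) {b} := by
    refine ((const_bitSet (hA.mono Set.subset_union_left) (BitVec.ofNat K n)).trans
      (ult_bitSet (N := S) (M := fun _ => BitVec.ofNat K n)
      (Set.subset_union_right.trans Set.subset_union_left) Set.subset_union_right
      ((hA.mono Set.subset_union_left).mono Set.subset_union_left))).mono_cost (by omega)
  have h3' : Derives (A ∪ bitSet S) (7 * K + 1) (bitSet D) := by
    refine ((const_bitSet (hA.mono Set.subset_union_left)
      (BitVec.ofNat K (2 ^ K - n))).trans
      (add_bitSet (N := S) (M := fun _ => BitVec.ofNat K (2 ^ K - n))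
      (Set.subset_union_right.trans Set.subset_union_left) Set.subset_union_right
      ((hA.mono Set.subset_union_left).mono Set.subset_union_left))).mono_cost (by omega)
  refine (h1.trans ((h2'.union h3').trans (mux_bitSet (N := S) (M := D) (b := b) ?_ ?_ ?_))).mono_cost
    (by omega)
  · exact Set.subset_union_right.trans Set.subset_union_left
  · exact Set.subset_union_right.trans Set.subset_union_right
  · exact Or.inr (Or.inl rfl)

/-- Horner's scheme: each bit of the multiplier costs a doubling and the addition of `Z` or zero. -/
theorem mul_ofBits_residue (hK : 2 * n ≤ 2 ^ K) {J : ℕ} {Z : X → ZMod n} {f : Fin J → X → Bool}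
    (hZ : bitSet (residue K Z) ⊆ A) (hf : ∀ j, f j ∈ A) (hA : A.Nonempty) :
    Derives A (J * (45 * K + 8) + K)
      (bitSet (residue K fun x => Z x * ((Nat.ofBits fun j => f j x : ℕ) : ZMod n))) := by
  induction J with
  | zero =>
    refine (const_bitSet hA (0 : BitVec K)).mono_cost (by omega) |>.mono_right ?_
    have : (residue K fun x => Z x * ((Nat.ofBits fun j => f j x : ℕ) : ZMod n)) = fun _ => (0 : BitVec K) := by
      funext x
      simp [residue]
    rw [this]
  | succ J ih =>
    let Y : X → ZMod n := fun x => Z x * ((Nat.ofBits fun j => f (Fin.succ j) x : ℕ) : ZMod n)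
    let B : X → ZMod n := fun x => if f 0 x then Z x else 0
    have hB : residue K B = fun x => if f 0 x then residue K Z x else 0 := by
      funext x
      cases h : f 0 x <;> simp [B, residue, h]
    have h1 : Derives A (J * (45 * K + 8) + K) (bitSet (residue K Y)) := ih fun j => hf j.succ
    have h2 : Derives A K (bitSet (residue K B)) := by
      rw [hB]
      exact mask_bitSet hZ (hf 0)
    have h3 : Derives (A ∪ bitSet (residue K Y)) (22 * K + 4)
        (bitSet (residue K fun x => Y x + Y x)) :=
      add_residue hK Set.subset_union_right Set.subset_union_right (hA.mono Set.subset_union_left)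
    have h4 := (h2.mono_left Set.subset_union_left).union h3
    have h5 : (fun x => Z x * ((Nat.ofBits fun j => f j x : ℕ) : ZMod n)) = fun x => B x + (Y x + Y x) := by
      funext x
      rw [Nat.ofBits_succ]
      change Z x * ((2 * Nat.ofBits (fun j => f (Fin.succ j) x) + (f 0 x).toNat : ℕ) : ZMod n) = _
      simp only [B, Y]
      cases f 0 x <;> simp <;> ring
    rw [h5]
    refine (h1.trans (h4.trans (add_residue hK (Y := B) (Z := fun x => Y x + Y x)
      (Set.subset_union_left.trans Set.subset_union_right)
      (Set.subset_union_right.trans Set.subset_union_right)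
      ((hA.mono Set.subset_union_left).mono Set.subset_union_left)))).mono_cost ?_
    rw [add_mul]
    omega

theorem mul_residue (hK : 2 * n ≤ 2 ^ K) {Y Z : X → ZMod n} (hY : bitSet (residue K Y) ⊆ A)
    (hZ : bitSet (residue K Z) ⊆ A) (hA : A.Nonempty) :
    Derives A (45 * K ^ 2 + 9 * K) (bitSet (residue K fun x => Y x * Z x)) := by
  have h := mul_ofBits_residue hK (Z := Y) (f := fun (j : Fin K) x => (residue K Z x).getLsbD j) hY
    (fun j => bit_mem hZ j.2) hA
  have h2 : ∀ x, ((Nat.ofBits fun j : Fin K => (residue K Z x).getLsbD j : ℕ) : ZMod n) = Z x := by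
    intro x
    have hz := ZMod.val_lt (Z x)
    have : (Nat.ofBits fun j : Fin K => (residue K Z x).getLsbD j) = (Z x).val := by
      have h3 : (fun j : Fin K => (residue K Z x).getLsbD j) = fun j : Fin K => (Z x).val.testBit j := by
        funext j
        simp only [residue]
        rw [BitVec.getLsbD_ofNat, decide_eq_true j.2, Bool.true_and]
      rw [h3, Nat.ofBits_testBit, Nat.mod_eq_of_lt (by omega)]
    rw [this, ZMod.natCast_zmod_val]
  simp only [h2] at h
  refine h.mono_cost (le_of_eq ?_)
  ring

theorem pow_residue (hK : 2 * n ≤ 2 ^ K) {Z : X → ZMod n} (hZ : bitSet (residue K Z) ⊆ A)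
    (hA : A.Nonempty) (e : ℕ) :
    Derives A (K + Nat.size e * (2 * (45 * K ^ 2 + 9 * K)))
      (bitSet (residue K fun x => Z x ^ e)) := by
  -- Square and multiply. This form of recursion excludes a leading zero digit, so each step
  -- increases `Nat.size e` by one.
  induction e using Nat.binaryRec' with
  | zero =>
    refine ((const_bitSet hA (BitVec.ofNat K (1 : ZMod n).val)).mono_cost (by omega)).mono_right ?_
    simp only [pow_zero]
    rfl
  | bit b e hbe ih =>
    have hsq : Derives (A ∪ bitSet (residue K fun x => Z x ^ e)) (45 * K ^ 2 + 9 * K)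
        (bitSet (residue K fun x => Z x ^ e * Z x ^ e)) :=
      mul_residue hK Set.subset_union_right Set.subset_union_right (hA.mono Set.subset_union_left)
    have hne : Nat.bit b e ≠ 0 := by
      intro h
      rw [Nat.bit_eq_zero_iff] at h
      have := hbe h.1
      simp [h.2] at this
    have hsize : Nat.size (Nat.bit b e) = Nat.size e + 1 := Nat.size_bit hne
    rw [hsize]
    cases b with
    | false =>
      refine ((ih.trans hsq).mono_right ?_).mono_cost (by rw [add_mul]; omega)
      have : (fun x => Z x ^ Nat.bit false e) = fun x => Z x ^ e * Z x ^ e := by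
        funext x
        rw [Nat.bit_val, Bool.toNat_false, add_zero, two_mul, pow_add]
      rw [this]
    | true =>
      have hmul : Derives (A ∪ bitSet (residue K fun x => Z x ^ e) ∪
          bitSet (residue K fun x => Z x ^ e * Z x ^ e)) (45 * K ^ 2 + 9 * K)
          (bitSet (residue K fun x => Z x ^ e * Z x ^ e * Z x)) :=
        mul_residue hK Set.subset_union_right
          (hZ.trans (Set.subset_union_left.trans Set.subset_union_left))
          ((hA.mono Set.subset_union_left).mono Set.subset_union_left)
      refine ((ih.trans (hsq.trans hmul)).mono_right ?_).mono_cost (by rw [add_mul]; omega)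
      have : (fun x => Z x ^ Nat.bit true e) = fun x => Z x ^ e * Z x ^ e * Z x := by
        funext x
        rw [Nat.bit_val, Bool.toNat_true, pow_succ, two_mul, pow_add]
      rw [this]

end Derives

end Mod

/-- The integer part of `p * y / 2 ^ L`, for a number `y` with `L` bits. -/
def scaledFloor (p : ℕ) {L : ℕ} (y : Fin L → Bool) : ℕ := p * Nat.ofBits y / 2 ^ L

theorem scaledFloor_lt {p : ℕ} (hp : 0 < p) {L : ℕ} (y : Fin L → Bool) : scaledFloor p y < p := by
  rw [scaledFloor, Nat.div_lt_iff_lt_mul (by positivity)]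
  exact Nat.mul_lt_mul_of_pos_left (Nat.ofBits_lt_two_pow y) hp

/-- Computed modulo `p * 2 ^ L`, the product with `p` is exact, since the other factor is below `2 ^
L`. The division then only drops the `L` lowest bits. -/
theorem Derives.scaledFloor {p : ℕ} [NeZero p] {L : ℕ} (hK : 2 * (p * 2 ^ L) ≤ 2 ^ K)
    {f : Fin L → X → Bool} (hf : ∀ j, f j ∈ A) (hA : A.Nonempty) :
    Derives A (L * (45 * K + 8) + 3 * K)
      (bitSet (residue K fun x => (HSP.scaledFloor p (fun j => f j x) : ZMod p))) := by
  have hp : 0 < p := Nat.pos_of_ne_zero (NeZero.ne p)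
  let P : X → ZMod (p * 2 ^ L) := fun x => (p : ZMod (p * 2 ^ L)) *
    ((Nat.ofBits fun j => f j x : ℕ) : ZMod (p * 2 ^ L))
  have h1 : Derives A K (bitSet (residue K fun _ : X => (p : ZMod (p * 2 ^ L)))) :=
    const_bitSet hA _
  have h2 : Derives (A ∪ bitSet (residue K fun _ : X => (p : ZMod (p * 2 ^ L))))
      (L * (45 * K + 8) + K) (bitSet (residue K P)) :=
    mul_ofBits_residue hK Set.subset_union_right (fun j => Or.inl (hf j))
      (hA.mono Set.subset_union_left)
  have hP : ∀ x, (P x).val = p * Nat.ofBits fun j => f j x := by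
    intro x
    simp only [P]
    rw [← Nat.cast_mul, ZMod.val_natCast, Nat.mod_eq_of_lt]
    exact Nat.mul_lt_mul_of_pos_left (Nat.ofBits_lt_two_pow _) hp
  refine (h1.trans (h2.trans (bitSet_of (d := 1) fun j hj => ?_))).mono_cost (by omega)
  have hbit : (fun x => (residue K (fun x => (HSP.scaledFloor p (fun j => f j x) : ZMod p)) x).getLsbD j) =
      fun x => (P x).val.testBit (j + L) := by
    funext x
    simp only [residue]
    rw [BitVec.getLsbD_ofNat, ZMod.val_natCast, Nat.mod_eq_of_lt (scaledFloor_lt hp _), hP,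
      HSP.scaledFloor, Nat.testBit_div_two_pow]
    simp [hj]
  rw [hbit]
  by_cases hjL : j + L < K
  · refine base ?_
    rintro g rfl
    right
    refine ⟨⟨j + L, hjL⟩, ?_⟩
    funext x
    simp only [residue]
    rw [BitVec.getLsbD_ofNat, decide_eq_true hjL, Bool.true_and]
  · refine (const ((hA.mono Set.subset_union_left).mono Set.subset_union_left) false).mono_right ?_
    rintro g rfl
    rw [Set.mem_singleton_iff]
    funext x
    apply Nat.testBit_eq_false_of_lt
    have h3 := ZMod.val_lt (P x)
    have h4 : 2 ^ K ≤ 2 ^ (j + L) := Nat.pow_le_pow_right (by norm_num) (by omega)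
    omega

end Arithmetic

end HSP

end

noncomputable section

namespace HSP

open Function

/-! ### Subgroups of the group `ℤ_q ⋉ ℤ_p` -/

namespace QHedral

variable {p : ℕ} {a : (ZMod p)ˣ}

/-- The element `(α, z)`. -/
def mk (α : Subgroup.zpowers a) (z : ZMod p) : QHedral p a := ⟨Multiplicative.ofAdd z, α⟩

/-- The residue of the first component. -/
def scale (α : Subgroup.zpowers a) : ZMod p := ((α : (ZMod p)ˣ) : ZMod p)

theorem scale_one : scale (1 : Subgroup.zpowers a) = 1 := rfl

theorem scale_injective : Injective (scale (a := a)) := fun _ _ h => Subtype.ext (Units.ext h)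

theorem mk_mul_mk (α α' : Subgroup.zpowers a) (z z' : ZMod p) :
    mk α z * mk α' z' = mk (α * α') (z + scale α * z') := rfl

theorem mk_one_zero : mk (1 : Subgroup.zpowers a) 0 = 1 := rfl

theorem eq_mk (g : QHedral p a) : g = mk g.right g.left.toAdd := rfl

theorem mk_inj {α α' : Subgroup.zpowers a} {z z' : ZMod p} :
    mk α z = mk α' z' ↔ α = α' ∧ z = z' := by
  constructor
  · intro h
    exact ⟨congrArg SemidirectProduct.right h, congrArg (fun g : QHedral p a => g.left.toAdd) h⟩
  · rintro ⟨rfl, rfl⟩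
    rfl

theorem mk_one_inv (z : ZMod p) : (mk (1 : Subgroup.zpowers a) z)⁻¹ = mk 1 (-z) := by
  rw [inv_eq_iff_mul_eq_one, mk_mul_mk, scale_one, one_mul, one_mul, add_neg_cancel, mk_one_zero]

theorem mk_one_pow (z : ZMod p) (k : ℕ) :
    (mk (1 : Subgroup.zpowers a) z) ^ k = mk 1 ((k : ZMod p) * z) := by
  induction k with
  | zero => simp [mk_one_zero]
  | succ k ih =>
    rw [pow_succ, ih, mk_mul_mk, scale_one, mk_inj]
    refine ⟨one_mul _, ?_⟩
    push_cast
    ring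

/-- The subgroup of translations. -/
def translations (p : ℕ) (a : (ZMod p)ˣ) : Subgroup (QHedral p a) :=
  SemidirectProduct.rightHom.ker

theorem mem_translations {g : QHedral p a} : g ∈ translations p a ↔ g.right = 1 := Iff.rfl

/-- The translation by one. -/
def translation (p : ℕ) (a : (ZMod p)ˣ) : QHedral p a := mk 1 1

variable {H H' : Subgroup (QHedral p a)}

section

variable [NeZero p]

theorem mk_one_mem (h : translation p a ∈ H) (z : ZMod p) : mk 1 z ∈ H := by
  have := H.pow_mem h z.val
  rwa [translation, mk_one_pow, ZMod.natCast_zmod_val, mul_one] at this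

end

variable [Fact p.Prime]

theorem eq_zero_of_mk_one_mem (h : translation p a ∉ H) {z : ZMod p} (hz : mk 1 z ∈ H) :
    z = 0 := by
  by_contra hne
  apply h
  have := H.pow_mem hz (z⁻¹).val
  rwa [mk_one_pow, ZMod.natCast_zmod_val, inv_mul_cancel₀ hne] at this

/-- A map `x ↦ α * x + c` with `α ≠ 1` fixes `b = c / (1 - α)`, so it is conjugate to `x ↦ α * x` by
the translation by `b`. As the order of `a` is prime, `α` generates all scales, and the powers of
the map fill the stabilizer of `b`. -/
theorem exists_fixed_point (ha : (orderOf a).Prime) (hH : ¬ H ≤ translations p a) :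
    ∃ b : ZMod p, ∀ α, mk α (b * (1 - scale α)) ∈ H := by
  obtain ⟨h, hhH, hh⟩ := SetLike.not_le_iff_exists.1 hH
  rw [mem_translations] at hh
  have hne : 1 - scale h.right ≠ 0 := fun h0 =>
    hh (scale_injective ((sub_eq_zero.1 h0).symm.trans scale_one.symm))
  refine ⟨h.left.toAdd / (1 - scale h.right), fun α => ?_⟩
  generalize hb : h.left.toAdd / (1 - scale h.right) = b
  have hconj : ∀ α : Subgroup.zpowers a,
      mk 1 b * SemidirectProduct.inr α * (mk 1 b)⁻¹ = mk α (b * (1 - scale α)) := by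
    intro α
    rw [mk_one_inv]
    change mk 1 b * mk α 0 * mk 1 (-b) = _
    rw [mk_mul_mk, mk_mul_mk, mk_inj]
    refine ⟨by simp, ?_⟩
    simp only [one_mul]
    ring
  have : Fact (orderOf a).Prime := ⟨ha⟩
  obtain ⟨k, hk⟩ := mem_zpowers_of_prime_card (p := orderOf a) (g := h.right) (g' := α)
    (Nat.card_zpowers a) hh
  have hh' : h = mk 1 b * SemidirectProduct.inr h.right * (mk 1 b)⁻¹ := by
    rw [hconj, ← hb, div_mul_cancel₀ _ hne]
    exact eq_mk h
  have := H.zpow_mem hhH k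
  rw [hh', conj_zpow, ← map_zpow] at this
  have hk' : h.right ^ k = α := hk
  rwa [hk', hconj] at this

/-- An element of `H' ` that is not a translation yields elements of `H'` with every scale. Dividing
an element of `H` by the one with its scale leaves a translation in `H`; it is trivial unless `H`,
and hence `H'`, contains all translations. -/
theorem eq_of_le_of_mem (ha : (orderOf a).Prime) (hle : H' ≤ H)
    (h1 : translation p a ∈ H → translation p a ∈ H')
    (h2 : ¬ H ≤ translations p a → ∃ h ∈ H', h ∉ translations p a) : H' = H := by
  have hsub : ∀ z, mk 1 z ∈ H → mk 1 z ∈ H' := by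
    intro z hz
    by_cases ht : translation p a ∈ H
    · exact mk_one_mem (h1 ht) z
    · rw [eq_zero_of_mk_one_mem ht hz]
      exact H'.one_mem
  refine le_antisymm hle fun x hx => ?_
  by_cases hH : H ≤ translations p a
  · have hxr : x.right = 1 := hH hx
    rw [eq_mk x, hxr] at hx ⊢
    exact hsub _ hx
  · obtain ⟨h, hh, hht⟩ := h2 hH
    obtain ⟨b, hb⟩ := exists_fixed_point (H := H') ha fun hle' => hht (hle' hh)
    have hy := hb x.right
    have hxy := H.mul_mem hx (H.inv_mem (hle hy))
    have : x * (mk x.right (b * (1 - scale x.right)))⁻¹ =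
        mk 1 (x * (mk x.right (b * (1 - scale x.right)))⁻¹).left.toAdd := by
      conv_lhs => rw [eq_mk (x * _)]
      congr 1
      exact mul_inv_cancel x.right
    rw [this] at hxy
    have h3 := H'.mul_mem (hsub _ hxy) hy
    rwa [← this, inv_mul_cancel_right] at h3

theorem mem_of_translation_mem (ha : (orderOf a).Prime) (hH : ¬ H ≤ translations p a)
    (ht : translation p a ∈ H) (g : QHedral p a) : g ∈ H := by
  obtain ⟨b, hb⟩ := exists_fixed_point ha hH
  have := H.mul_mem (mk_one_mem ht (g.left.toAdd - b * (1 - scale g.right))) (hb g.right)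
  rw [mk_mul_mk, scale_one, one_mul, one_mul, sub_add_cancel] at this
  exact this

/-- Here `H` is the stabilizer of `b`, so the left coset of `g` is determined by the image `z` of
`b` under `g`. The translation by `z - b` represents it. -/
theorem hides_eq_iff {S : Type} {f : QHedral p a → S} (hf : Hides f H)
    (ht : translation p a ∉ H) {b : ZMod p} (hb : ∀ α, mk α (b * (1 - scale α)) ∈ H)
    (z : ZMod p) (g : QHedral p a) :
    f (mk 1 (z - b)) = f g ↔ g.left.toAdd = z - scale g.right * b := by
  have h1 : (mk 1 (z - b))⁻¹ * g = mk g.right (g.left.toAdd + b - z) := by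
    conv_lhs => rw [eq_mk g]
    rw [mk_one_inv, mk_mul_mk, scale_one, mk_inj]
    exact ⟨one_mul _, by ring⟩
  rw [hf, h1]
  constructor
  · intro h
    have h2 := H.mul_mem h (H.inv_mem (hb g.right))
    have h3 : mk g.right (g.left.toAdd + b - z) * (mk g.right (b * (1 - scale g.right)))⁻¹ =
        mk 1 (g.left.toAdd + b - z - b * (1 - scale g.right)) := by
      rw [mul_inv_eq_iff_eq_mul, mk_mul_mk, scale_one, mk_inj]
      exact ⟨(one_mul _).symm, by ring⟩
    rw [h3] at h2
    have h4 := eq_zero_of_mk_one_mem ht h2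
    linear_combination h4
  · intro h
    have h2 : g.left.toAdd + b - z = b * (1 - scale g.right) := by
      rw [h]
      ring
    rw [h2]
    exact hb g.right

end QHedral

end HSP

end

noncomputable section

namespace HSP

open Function

/-! ### Fourier sampling -/

section Sampling

/-- The wires for Fourier sampling: two registers of `L` qubits and the register for the oracle's
value. -/
abbrev SampleWires (L m : ℕ) : Type := (Fin L ⊕ Fin L) ⊕ Fin m

/-- The basis state with the given registers. -/
def registers {L m : ℕ} (x₁ x₂ : Fin L → Bool) (y : Fin m → Bool) : SampleWires L m → Bool :=
  Sum.elim (Sum.elim x₁ x₂) y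

theorem registers_inj {L m : ℕ} {x₁ x₂ x₁' x₂' : Fin L → Bool} {y y' : Fin m → Bool} :
    registers x₁ x₂ y = registers x₁' x₂' y' ↔ x₁ = x₁' ∧ x₂ = x₂' ∧ y = y' := by
  constructor
  · intro h
    exact ⟨funext fun i => congrFun h (Sum.inl (Sum.inl i)),
      funext fun i => congrFun h (Sum.inl (Sum.inr i)), funext fun i => congrFun h (Sum.inr i)⟩
  · rintro ⟨rfl, rfl, rfl⟩
    rfl

/-- The query involves only the `n` low qubits of each register. The `L - n` high qubits are zero
until the Fourier transforms, where they serve to refine the frequencies. -/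
theorem exists_sampling_gates {n L m : ℕ} (hn : n ≤ L) :
    ∃ gs : List (Gate (Fin n ⊕ Fin n) m (SampleWires L m)),
      gs.length ≤ 2 * n + 1 + 2 * (L * (L + 1)) ∧
      ∀ (F : (Fin n ⊕ Fin n → Bool) → Fin m → Bool) s₁ s₂ y,
        run F gs zeroState (registers s₁ s₂ y) = rsqrt ^ (2 * n + 2 * L) *
          ∑ x : (Fin L → Bool) × (Fin L → Bool),
            ex (Nat.ofBits x.1 * Nat.ofBits (s₁ ∘ Fin.rev) / 2 ^ L +
              Nat.ofBits x.2 * Nat.ofBits (s₂ ∘ Fin.rev) / 2 ^ L) *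
            ind ((∀ i : Fin L, n ≤ i → x.1 i = false ∧ x.2 i = false) ∧
              y = F (Sum.elim (x.1 ∘ Fin.castLE hn) (x.2 ∘ Fin.castLE hn))) := by
  classical
  let e : Fin n ⊕ Fin n ↪ SampleWires L m :=
    (Embedding.sumMap (Fin.castLEEmb hn) (Fin.castLEEmb hn)).trans ⟨Sum.inl, Sum.inl_injective⟩
  let y' : Fin m ↪ SampleWires L m := ⟨Sum.inr, Sum.inr_injective⟩
  let r₁ : Fin L ↪ SampleWires L m := ⟨fun i => Sum.inl (Sum.inl i), fun _ _ h => by simpa using h⟩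
  let r₂ : Fin L ↪ SampleWires L m := ⟨fun i => Sum.inl (Sum.inr i), fun _ _ h => by simpa using h⟩
  obtain ⟨g₁, hl₁, h₁⟩ := exists_uniform_gates (β := Fin n ⊕ Fin n) (m := m) (Finset.univ.map e)
  obtain ⟨g₂, h₂⟩ := exists_query_gate e y' fun b j h => by
    have : (Sum.inl _ : SampleWires L m) = Sum.inr j := h
    simp at this
  obtain ⟨g₃, hl₃, h₃⟩ := exists_fourier_gates (β := Fin n ⊕ Fin n) (m := m) r₁
  obtain ⟨g₄, hl₄, h₄⟩ := exists_fourier_gates (β := Fin n ⊕ Fin n) (m := m) r₂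
  have hcard : (Finset.univ.map e).card = 2 * n := by
    simp [two_mul]
  have hr₁₂ : ∀ i j, r₁ i ≠ Sum.inl (Sum.inr j) := by
    intro i j h
    have : (Sum.inl (Sum.inl i) : SampleWires L m) = Sum.inl (Sum.inr j) := h
    simp at this
  have hr₁ : ∀ x s₁ s₂ y, extend r₁ x (registers s₁ s₂ y : SampleWires L m → Bool) =
      registers x s₂ y := by
    intro x s₁ s₂ y
    funext w
    rcases w with (w | w) | w
    · exact r₁.injective.extend_apply _ _ w
    · exact extend_apply' _ _ _ fun ⟨i, hi⟩ => hr₁₂ i w hi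
    · exact extend_apply' _ _ _ (by simp [r₁])
  have hr₂ : ∀ x s₁ s₂ y, extend r₂ x (registers s₁ s₂ y : SampleWires L m → Bool) =
      registers s₁ x y := by
    intro x s₁ s₂ y
    funext w
    rcases w with (w | w) | w
    · exact extend_apply' _ _ _ fun ⟨i, hi⟩ => hr₁₂ w i hi.symm
    · exact r₂.injective.extend_apply _ _ w
    · exact extend_apply' _ _ _ (by simp [r₂])
  have hc₁ : ∀ s₁ s₂ y, (registers s₁ s₂ y : SampleWires L m → Bool) ∘ r₁ = s₁ := fun _ _ _ => rfl
  have hc₂ : ∀ s₁ s₂ y, (registers s₁ s₂ y : SampleWires L m → Bool) ∘ r₂ = s₂ := fun _ _ _ => rfl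
  refine ⟨g₁ ++ (g₂ :: (g₃ ++ g₄)), ?_, fun F s₁ s₂ y => ?_⟩
  · simp only [List.length_append, List.length_cons, hl₁, hcard]
    omega
  rw [run_append, run_cons, run_append, h₁, hcard, h₄]
  simp only [h₃, h₂, hr₁, hr₂, hc₁, hc₂]
  have hind : ∀ x₁ x₂ : Fin L → Bool, (∀ w ∉ Finset.univ.map e,
      queryMap F e y' (registers x₁ x₂ y) w = false) ↔
      (∀ i : Fin L, n ≤ i → x₁ i = false ∧ x₂ i = false) ∧
        y = F (Sum.elim (x₁ ∘ Fin.castLE hn) (x₂ ∘ Fin.castLE hn)) := by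
    intro x₁ x₂
    have hq₁ : ∀ w, queryMap F e y' (registers x₁ x₂ y) (Sum.inl w) =
        registers x₁ x₂ y (Sum.inl w) := fun w => extend_apply' _ _ _ (by simp [y'])
    have hq₂ : ∀ j, queryMap F e y' (registers x₁ x₂ y) (Sum.inr j) =
        xor (y j) (F (Sum.elim (x₁ ∘ Fin.castLE hn) (x₂ ∘ Fin.castLE hn)) j) := by
      intro j
      refine (y'.injective.extend_apply _ _ j).trans ?_
      have : (fun b => registers x₁ x₂ y (e b)) =
          Sum.elim (x₁ ∘ Fin.castLE hn) (x₂ ∘ Fin.castLE hn) := by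
        funext b
        rcases b with b | b <;> rfl
      rw [this]
      rfl
    have he₁ : ∀ i : Fin L, (Sum.inl (Sum.inl i) : SampleWires L m) ∉ Finset.univ.map e ↔ n ≤ i := by
      intro i
      rw [← not_lt, not_iff_not, Finset.mem_map]
      constructor
      · rintro ⟨b | b, -, hb⟩
        · obtain rfl : Fin.castLE hn b = i := Sum.inl.inj (Sum.inl.inj hb)
          exact b.2
        · have : (Sum.inl (Sum.inr _) : SampleWires L m) = Sum.inl (Sum.inl i) := hb
          simp at this
      · exact fun hi => ⟨Sum.inl ⟨i, hi⟩, Finset.mem_univ _, rfl⟩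
    have he₂ : ∀ i : Fin L, (Sum.inl (Sum.inr i) : SampleWires L m) ∉ Finset.univ.map e ↔ n ≤ i := by
      intro i
      rw [← not_lt, not_iff_not, Finset.mem_map]
      constructor
      · rintro ⟨b | b, -, hb⟩
        · have : (Sum.inl (Sum.inl _) : SampleWires L m) = Sum.inl (Sum.inr i) := hb
          simp at this
        · obtain rfl : Fin.castLE hn b = i := Sum.inr.inj (Sum.inl.inj hb)
          exact b.2
      · exact fun hi => ⟨Sum.inr ⟨i, hi⟩, Finset.mem_univ _, rfl⟩
    have he₃ : ∀ j : Fin m, (Sum.inr j : SampleWires L m) ∉ Finset.univ.map e := by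
      intro j
      rw [Finset.mem_map]
      rintro ⟨b, -, hb⟩
      have : (Sum.inl _ : SampleWires L m) = Sum.inr j := hb
      simp at this
    constructor
    · intro h
      refine ⟨fun i hi => ⟨?_, ?_⟩, funext fun j => ?_⟩
      · exact (hq₁ _).symm.trans (h _ ((he₁ i).2 hi))
      · exact (hq₁ _).symm.trans (h _ ((he₂ i).2 hi))
      · have := (hq₂ j).symm.trans (h _ (he₃ j))
        simpa using this
    · rintro ⟨h, hy⟩ w hw
      rcases w with (w | w) | w
      · exact (hq₁ _).trans (h w ((he₁ w).1 hw)).1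
      · exact (hq₁ _).trans (h w ((he₂ w).1 hw)).2
      · rw [hq₂, ← hy, Bool.xor_self]
  simp only [hind]
  rw [Fintype.sum_prod_type_right]
  simp only [Finset.mul_sum]
  refine Finset.sum_congr rfl fun x₂ _ => Finset.sum_congr rfl fun x₁ _ => ?_
  rw [ex_add]
  ring

/-- The `L` digits of a number, the highest one first. -/
def digits (L N : ℕ) : Fin L → Bool := fun j => N.testBit (Fin.rev j)

theorem ofBits_digits {L N : ℕ} (h : N < 2 ^ L) : Nat.ofBits (digits L N ∘ Fin.rev) = N := by
  have : digits L N ∘ Fin.rev = fun j : Fin L => N.testBit j := by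
    funext j
    simp [digits]
  rw [this, Nat.ofBits_testBit, Nat.mod_eq_of_lt h]

/-- The frequency among the multiples of `1 / 2 ^ L` that represents the frequency `t / p`. -/
def frequency (p L t : ℕ) : ℕ := (2 ^ L * t + (p - 1)) / p

/-! ### Rounding of frequencies -/

section Frequency

variable {p L t : ℕ}

theorem le_mul_frequency (hp : 0 < p) : 2 ^ L * t ≤ p * frequency p L t := by
  have h1 := Nat.div_add_mod (2 ^ L * t + (p - 1)) p
  have h2 := Nat.mod_lt (2 ^ L * t + (p - 1)) hp
  rw [frequency]
  omega

theorem mul_frequency_lt (hp : 0 < p) : p * frequency p L t < 2 ^ L * t + p := by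
  have h1 := Nat.mul_div_le (2 ^ L * t + (p - 1)) p
  rw [frequency]
  omega

theorem frequency_lt (hpL : p ≤ 2 ^ L) (ht : t < p) : frequency p L t < 2 ^ L := by
  have h1 := mul_frequency_lt (L := L) (t := t) (by omega : 0 < p)
  have h2 : 2 ^ L * (t + 1) ≤ 2 ^ L * p := Nat.mul_le_mul_left _ ht
  have h3 : p * frequency p L t < p * 2 ^ L := by
    rw [mul_comm p (2 ^ L)]
    rw [mul_add, mul_one] at h2
    omega
  exact lt_of_mul_lt_mul_left h3 (Nat.zero_le p)

/-- The frequency `2 ^ L * t / p` is rounded up, so scaling back gives a number in `[t, t + p / 2 ^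
L)`, whose integer part is `t`. -/
theorem scaledFloor_frequency (hpL : p ≤ 2 ^ L) (ht : t < p) :
    scaledFloor p (digits L (frequency p L t) ∘ Fin.rev) = t := by
  have hp : 0 < p := by omega
  rw [scaledFloor, ofBits_digits (frequency_lt hpL ht)]
  have h1 := le_mul_frequency (L := L) (t := t) hp
  have h2 := mul_frequency_lt (L := L) (t := t) hp
  refine Nat.div_eq_of_lt_le ?_ ?_
  · rwa [mul_comm]
  · rw [add_mul, one_mul, mul_comm t]
    omega

theorem abs_frequency_sub_le (hp : 0 < p) :
    |(frequency p L t : ℝ) / 2 ^ L - t / p| ≤ 1 / 2 ^ L := by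
  have h1 : ((2 ^ L * t : ℕ) : ℝ) ≤ (p * frequency p L t : ℕ) := by
    exact_mod_cast le_mul_frequency hp
  have h2 : ((p * frequency p L t : ℕ) : ℝ) ≤ (2 ^ L * t + p : ℕ) := by
    exact_mod_cast (mul_frequency_lt hp).le
  push_cast at h1 h2
  have hp' : (0 : ℝ) < p := by exact_mod_cast hp
  have hL : (0 : ℝ) < 2 ^ L := by positivity
  have : (frequency p L t : ℝ) / 2 ^ L - t / p = (p * frequency p L t - 2 ^ L * t) / (2 ^ L * p) := by
    field_simp
  rw [this, abs_of_nonneg (div_nonneg (by linarith) (by positivity)),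
    div_le_div_iff₀ (by positivity) hL]
  nlinarith

end Frequency

end Sampling

end HSP

end

noncomputable section

namespace HSP

open Function

/-! ### Fourier sampling for the group `ℤ_q ⋉ ℤ_p` -/

namespace QHedral

variable {p : ℕ} [Fact p.Prime] {a : (ZMod p)ˣ} {m : ℕ} {H : Subgroup (QHedral p a)}

/-- The `L` binary digits of a residue, the lowest one first. -/
def lowDigits (L : ℕ) (x : ZMod p) : Fin L → Bool := fun j => x.val.testBit j

theorem ofBits_lowDigits {L : ℕ} (hpL : p ≤ 2 ^ L) (x : ZMod p) :
    Nat.ofBits (lowDigits L x) = x.val := by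
  have hx := ZMod.val_lt x
  unfold lowDigits
  rw [Nat.ofBits_testBit, Nat.mod_eq_of_lt (by omega)]

/-- The amplitude of an outcome of Fourier sampling, for a value of the oracle that is not zero. -/
theorem sum_ind_eq {L : ℕ} (hn : Nat.size p ≤ L) {f : QHedral p a → Fin m → Bool} (hf : Hides f H)
    (ht : translation p a ∉ H) {b : ZMod p} (hb : ∀ α, mk α (b * (1 - scale α)) ∈ H) {z : ZMod p}
    (hz : f (mk 1 (z - b)) ≠ fun _ => false) (φ : ℕ → ℕ → ℂ) :
    ∑ x : (Fin L → Bool) × (Fin L → Bool), φ (Nat.ofBits x.1) (Nat.ofBits x.2) *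
      ind ((∀ i : Fin L, Nat.size p ≤ i → x.1 i = false ∧ x.2 i = false) ∧ f (mk 1 (z - b)) =
        oracle (enc p a) f (Sum.elim (x.1 ∘ Fin.castLE hn) (x.2 ∘ Fin.castLE hn))) =
    ∑ α : Subgroup.zpowers a, φ (scale α).val (z - scale α * b).val := by
  have hpL : p ≤ 2 ^ L := (Nat.lt_size_self p).le.trans (Nat.pow_le_pow_right (by norm_num) hn)
  have henc : ∀ g : QHedral p a, enc p a g = Sum.elim (lowDigits L (scale g.right) ∘ Fin.castLE hn)
      (lowDigits L g.left.toAdd ∘ Fin.castLE hn) := fun g => rfl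
  symm
  refine Finset.sum_of_injOn
    (fun α => (lowDigits L (scale α), lowDigits L (z - scale α * b))) ?_ ?_ ?_ ?_
  · intro α _ α' _ h
    have h1 := congrArg Nat.ofBits (congrArg Prod.fst h)
    simp only [ofBits_lowDigits hpL] at h1
    exact scale_injective (ZMod.val_injective p h1)
  · intro α _
    exact Finset.mem_coe.2 (Finset.mem_univ _)
  · rintro ⟨x₁, x₂⟩ _ hx
    rw [ind_neg, mul_zero]
    rintro ⟨hhigh, hy⟩
    by_cases hr : ∃ g, enc p a g = Sum.elim (x₁ ∘ Fin.castLE hn) (x₂ ∘ Fin.castLE hn)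
    · obtain ⟨g, hg⟩ := hr
      rw [← hg, oracle_enc, hides_eq_iff hf ht hb] at hy
      apply hx
      refine ⟨g.right, by simp, ?_⟩
      rw [henc] at hg
      have hext : ∀ (x : Fin L → Bool) (y : ZMod p), (∀ i : Fin L, Nat.size p ≤ i → x i = false) →
          lowDigits L y ∘ Fin.castLE hn = x ∘ Fin.castLE hn → lowDigits L y = x := by
        intro x y hxh hxy
        funext i
        by_cases hi : (i : ℕ) < Nat.size p
        · exact congrFun hxy ⟨i, hi⟩
        · rw [hxh i (not_lt.1 hi)]
          apply Nat.testBit_eq_false_of_lt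
          exact ((ZMod.val_lt y).trans (Nat.lt_size_self p)).trans_le
            (Nat.pow_le_pow_right (by norm_num) (not_lt.1 hi))
      refine Prod.ext (hext _ _ (fun i hi => (hhigh i hi).1) ?_)
        (hext _ _ (fun i hi => (hhigh i hi).2) ?_)
      · exact funext fun j => congrFun hg (Sum.inl j)
      · rw [← hy]
        exact funext fun j => congrFun hg (Sum.inr j)
    -- A string that is not a code word has oracle value zero, which `hz` rules out.
    · apply hz
      rw [hy]
      exact extend_apply' _ _ _ hr
  · intro α _
    rw [ofBits_lowDigits hpL, ofBits_lowDigits hpL, ind_pos, mul_one]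
    constructor
    · have : ∀ (x : ZMod p) (i : Fin L), Nat.size p ≤ i → lowDigits L x i = false := by
        intro x i hi
        apply Nat.testBit_eq_false_of_lt
        exact ((ZMod.val_lt x).trans (Nat.lt_size_self p)).trans_le
          (Nat.pow_le_pow_right (by norm_num) hi)
      exact fun i hi => ⟨this _ i hi, this _ i hi⟩
    · have h := henc (mk α (z - scale α * b))
      change _ = oracle (enc p a) f (Sum.elim (lowDigits L (scale (mk α (z - scale α * b)).right) ∘ _)
        (lowDigits L (mk α (z - scale α * b)).left.toAdd ∘ _))
      rw [← h, oracle_enc, hides_eq_iff hf ht hb]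
      rfl

/-- With the exact frequencies `t * b / p` and `t / p` all terms equal `ex (z * t / p)`. Rounding
turns each by at most `2 * p / 2 ^ L ≤ 1 / 16` of a full turn, which moves it by at most `1 / 2`. -/
theorem norm_sum_ex_ge {L : ℕ} (hpL : 32 * p ≤ 2 ^ L) (b z : ZMod p) (t : ℕ) :
    (orderOf a : ℝ) / 2 ≤ ‖∑ α : Subgroup.zpowers a,
      ex ((scale α).val * frequency p L ((t : ZMod p) * b).val / 2 ^ L +
        (z - scale α * b).val * frequency p L t / 2 ^ L)‖ := by
  have hp : 0 < p := (Fact.out : p.Prime).pos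
  have hp' : (0 : ℝ) < p := by exact_mod_cast hp
  have hL : (0 : ℝ) < 2 ^ L := by positivity
  have hpL' : (32 : ℝ) * p ≤ 2 ^ L := by exact_mod_cast hpL
  set s := ((t : ZMod p) * b).val with hs
  have hterm : ∀ α : Subgroup.zpowers a, ∃ θ : ℝ, |θ| ≤ 1 / 16 ∧
      ex ((scale α).val * frequency p L s / 2 ^ L +
        (z - scale α * b).val * frequency p L t / 2 ^ L) = ex (z.val * t / p) * ex θ := by
    intro α
    set u := (scale α).val with hu
    set w := (z - scale α * b).val with hw
    -- The terms with `b` cancel: `α * (t * b) + (z - α * b) * t = z * t`.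
    have hcong : (((u : ℤ) * s + w * t - z.val * t : ℤ) : ZMod p) = 0 := by
      push_cast
      rw [hu, hw, hs, ZMod.natCast_zmod_val, ZMod.natCast_zmod_val, ZMod.natCast_zmod_val,
        ZMod.natCast_zmod_val]
      ring
    obtain ⟨k, hk⟩ := (ZMod.intCast_zmod_eq_zero_iff_dvd _ p).1 hcong
    have hk' : (u : ℝ) * s + w * t - z.val * t = p * k := by exact_mod_cast hk
    refine ⟨u * (frequency p L s / 2 ^ L - s / p) + w * (frequency p L t / 2 ^ L - t / p), ?_, ?_⟩
    · have h1 := abs_frequency_sub_le (L := L) (t := s) hp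
      have h2 := abs_frequency_sub_le (L := L) (t := t) hp
      have hu' : (u : ℝ) ≤ p := by exact_mod_cast (ZMod.val_lt (scale α)).le
      have hw' : (w : ℝ) ≤ p := by exact_mod_cast (ZMod.val_lt (z - scale α * b)).le
      have h3 : (p : ℝ) * (1 / 2 ^ L) ≤ 1 / 32 := by
        rw [mul_one_div, div_le_div_iff₀ hL (by norm_num)]
        linarith
      refine (abs_add_le _ _).trans ?_
      rw [abs_mul, abs_mul, Nat.abs_cast, Nat.abs_cast]
      have h4 := mul_le_mul hu' h1 (abs_nonneg _) hp'.le
      have h5 := mul_le_mul hw' h2 (abs_nonneg _) hp'.le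
      linarith
    · conv_rhs => rw [← ex_add, ← ex_add_intCast _ k]
      congr 1
      have : (k : ℝ) = ((u : ℝ) * s + w * t - z.val * t) / p := by
        rw [hk']
        field_simp
      rw [this]
      field_simp
      ring
  choose θ hθ hex using hterm
  have hcard : Fintype.card (Subgroup.zpowers a) = orderOf a := Fintype.card_zpowers
  rw [Finset.sum_congr rfl fun α _ => hex α, ← Finset.mul_sum, norm_mul, norm_ex, one_mul]
  have hdiff : ‖∑ α, ex (θ α) - (orderOf a : ℂ)‖ ≤ orderOf a * (1 / 2) := by
    have h1 : (orderOf a : ℂ) = ∑ _α : Subgroup.zpowers a, (1 : ℂ) := by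
      simp [← hcard]
    rw [h1, ← Finset.sum_sub_distrib]
    calc _ ≤ ∑ α, ‖ex (θ α) - 1‖ := norm_sum_le _ _
      _ ≤ ∑ _α : Subgroup.zpowers a, (1 / 2 : ℝ) := by
          refine Finset.sum_le_sum fun α _ => (norm_ex_sub_one_le _).trans ?_
          have := Real.pi_le_four
          nlinarith [hθ α, abs_nonneg (θ α), Real.pi_pos]
      _ = _ := by simp [← hcard]
  have h2 := norm_sub_norm_le (orderOf a : ℂ) ((orderOf a : ℂ) - ∑ α, ex (θ α))
  rw [sub_sub_cancel, Complex.norm_natCast, norm_sub_rev] at h2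
  linarith

/-- The group element computed from an outcome of Fourier sampling. -/
def candidate (a : (ZMod p)ˣ) {L m : ℕ} (v : SampleWires L m → Bool) : QHedral p a :=
  mk ⟨a, Subgroup.mem_zpowers a⟩ ((1 - (a : ZMod p)) *
    ((scaledFloor p fun j => v (Sum.inl (Sum.inl (Fin.rev j))) : ZMod p) *
      (scaledFloor p fun j => v (Sum.inl (Sum.inr (Fin.rev j))) : ZMod p) ^ (p - 2)))

theorem candidate_not_mem (ha : (orderOf a).Prime) {L m : ℕ} (v : SampleWires L m → Bool) :
    candidate a v ∉ translations p a := by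
  intro h
  rw [mem_translations] at h
  have h1 : a = 1 := congrArg Subtype.val h
  rw [h1, orderOf_one] at ha
  exact Nat.not_prime_one ha

/-- By Fermat, `t ^ (p - 2)` inverts `t`, so the decoded quotient is `b`, and the candidate is the
map of scale `a` that fixes `b`. -/
theorem candidate_registers {L : ℕ} (hpL : p ≤ 2 ^ L) (b : ZMod p) {t : ℕ} (ht0 : 0 < t)
    (ht : t < p) (y : Fin m → Bool) :
    candidate a (registers (digits L (frequency p L ((t : ZMod p) * b).val))
      (digits L (frequency p L t)) y) =
      mk ⟨a, Subgroup.mem_zpowers a⟩ (b * (1 - scale ⟨a, Subgroup.mem_zpowers a⟩)) := by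
  have hp := (Fact.out : p.Prime).two_le
  have hs := scaledFloor_frequency hpL (ZMod.val_lt ((t : ZMod p) * b))
  have ht' := scaledFloor_frequency hpL ht
  have hne : (t : ZMod p) ≠ 0 := by
    rw [Ne, ZMod.natCast_eq_zero_iff]
    exact fun h => absurd (Nat.le_of_dvd ht0 h) (by omega)
  have hpow : (t : ZMod p) * (t : ZMod p) ^ (p - 2) = 1 := by
    rw [← pow_succ', show p - 2 + 1 = p - 1 by omega]
    exact ZMod.pow_card_sub_one_eq_one hne
  rw [candidate, mk_inj]
  refine ⟨rfl, ?_⟩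
  change (1 - (a : ZMod p)) * ((scaledFloor p (digits L _ ∘ Fin.rev) : ZMod p) *
    (scaledFloor p (digits L _ ∘ Fin.rev) : ZMod p) ^ (p - 2)) = b * (1 - (a : ZMod p))
  rw [hs, ht', ZMod.natCast_zmod_val]
  linear_combination (1 - (a : ZMod p)) * b * hpow

theorem exists_fourier_sampling (ha : (orderOf a).Prime) (m : ℕ) :
    ∃ gs : List (Gate (Fin (Nat.size p) ⊕ Fin (Nat.size p)) m (SampleWires (Nat.size p + 5) m)),
      gs.length ≤ 2 * Nat.size p + 1 + 2 * ((Nat.size p + 5) * (Nat.size p + 5 + 1)) ∧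
      ∀ (f : QHedral p a → Fin m → Bool) (H : Subgroup (QHedral p a)), Hides f H →
        ¬ H ≤ translations p a → ((orderOf a : ℝ) / p) ^ 2 / 2 ^ 18 ≤
          mass (run (oracle (enc p a) f) gs zeroState)
            {v | candidate a v ∈ H ∧ candidate a v ∉ translations p a} := by
  classical
  -- Five extra qubits give the precision `32 * p ≤ 2 ^ L` that `norm_sum_ex_ge` needs.
  set L := Nat.size p + 5 with hLdef
  have hn : Nat.size p ≤ L := by omega
  have hp2 := (Fact.out : p.Prime).two_le
  have hp0 : (0 : ℝ) < p := by exact_mod_cast (Fact.out : p.Prime).pos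
  have hq : orderOf a ≤ p := by
    have h1 : orderOf a ≤ Fintype.card (ZMod p)ˣ := orderOf_le_card_univ
    rw [ZMod.card_units] at h1
    omega
  have hqp : (orderOf a : ℝ) / p ≤ 1 := by
    rw [div_le_one hp0]
    exact_mod_cast hq
  have hqp0 : 0 ≤ (orderOf a : ℝ) / p := by positivity
  have hpL32 : 32 * p ≤ 2 ^ L := by
    have := Nat.lt_size_self p
    rw [hLdef, pow_add]
    omega
  have hpL : p ≤ 2 ^ L := by omega
  have hLp : 2 ^ Nat.size p ≤ 2 * p := by
    have h1 : 2 ^ (Nat.size p - 1) ≤ p := Nat.lt_size.1 (by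
      have : 0 < Nat.size p := Nat.size_pos.2 (by omega)
      omega)
    have h2 : Nat.size p = Nat.size p - 1 + 1 := by
      have : 0 < Nat.size p := Nat.size_pos.2 (by omega)
      omega
    rw [h2, pow_succ]
    omega
  obtain ⟨gs, hlen, hgs⟩ := exists_sampling_gates (m := m) hn
  refine ⟨gs, hlen, fun f H hf hH => ?_⟩
  by_cases ht : translation p a ∈ H
  -- In this case `H` is the whole group and every candidate is good.
  · have : {v : SampleWires L m → Bool | candidate a v ∈ H ∧ candidate a v ∉ translations p a} =
        Set.univ :=
      Set.eq_univ_of_forall fun v => ⟨mem_of_translation_mem ha hH ht _, candidate_not_mem ha v⟩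
    rw [this, mass_run, mass_zeroState_univ]
    have h1 : ((orderOf a : ℝ) / p) ^ 2 ≤ 1 := pow_le_one₀ hqp0 hqp
    linarith
  obtain ⟨b, hb⟩ := exists_fixed_point ha hH
  let φ : ZMod p → Fin m → Bool := fun z => f (mk 1 (z - b))
  have hφ : Injective φ := by
    intro z z' h
    have h1 := (hides_eq_iff hf ht hb z (mk 1 (z' - b))).1 h
    have h2 : z' - b = z - 1 * b := h1
    linear_combination -h2
  -- The value `t = 0` cannot be inverted. The oracle value zero, taken for at most one `z`, is
  -- shared with the strings that are not code words.
  let S : Finset (ℕ × ZMod p) := Finset.Ico 1 p ×ˢ Finset.univ.filter fun z => φ z ≠ fun _ => false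
  have hS : (p - 1) * (p - 1) ≤ S.card := by
    rw [Finset.card_product, Nat.card_Ico]
    refine Nat.mul_le_mul_left _ ?_
    have h1 := Finset.card_filter_add_card_filter_not (s := (Finset.univ : Finset (ZMod p)))
      (fun z => φ z ≠ fun _ => false)
    have h2 : (Finset.univ.filter fun z => ¬ φ z ≠ fun _ => false).card ≤ 1 := by
      rw [Finset.card_le_one]
      intro z hz z' hz'
      simp only [ne_eq, not_not, Finset.mem_filter] at hz hz'
      exact hφ (hz.2.trans hz'.2.symm)
    rw [Finset.card_univ, ZMod.card] at h1
    omega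
  let g : ℕ × ZMod p → SampleWires L m → Bool := fun x =>
    registers (digits L (frequency p L ((x.1 : ZMod p) * b).val)) (digits L (frequency p L x.1))
      (φ x.2)
  refine le_trans ?_ (sum_le_mass _ _ S g ?_ ?_)
  · have hamp : ∀ x ∈ S, (1 / 2 : ℝ) ^ (2 * Nat.size p + 2 * L) * ((orderOf a : ℝ) / 2) ^ 2 ≤
        ‖run (oracle (enc p a) f) gs zeroState (g x)‖ ^ 2 := by
      rintro ⟨t, z⟩ hx
      obtain ⟨htp, hz⟩ := Finset.mem_product.1 hx
      rw [Finset.mem_Ico] at htp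
      rw [Finset.mem_filter] at hz
      have h1 := sum_ind_eq hn hf ht hb hz.2 fun X₁ X₂ =>
        ex (X₁ * frequency p L ((t : ZMod p) * b).val / 2 ^ L + X₂ * frequency p L t / 2 ^ L)
      simp only [g]
      rw [hgs, ofBits_digits (frequency_lt hpL (ZMod.val_lt _)),
        ofBits_digits (frequency_lt hpL htp.2)]
      erw [h1]
      rw [norm_mul, mul_pow, norm_pow, ← pow_mul, mul_comm (_ + _), pow_mul, norm_rsqrt_sq]
      gcongr
      exact norm_sum_ex_ge hpL32 b z t
    have hp1 : (p : ℝ) / 2 ≤ p - 1 := by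
      have : (2 : ℝ) ≤ p := by exact_mod_cast hp2
      linarith
    have hcard : ((p : ℝ) / 2) ^ 2 ≤ S.card := by
      have h1 : ((p - 1 : ℕ) : ℝ) * (p - 1 : ℕ) ≤ S.card := by exact_mod_cast hS
      rw [Nat.cast_sub (by omega), Nat.cast_one] at h1
      nlinarith
    have h2p : (1 / 2 : ℝ) ^ (2 * Nat.size p + 2 * L) ≥ 1 / (2 ^ 14 * (p : ℝ) ^ 4) := by
      have h1 : (2 : ℝ) ^ Nat.size p ≤ 2 * p := by exact_mod_cast hLp
      have h2 : (2 : ℝ) ^ (2 * Nat.size p + 2 * L) ≤ 2 ^ 14 * (p : ℝ) ^ 4 := by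
        calc (2 : ℝ) ^ (2 * Nat.size p + 2 * L) = ((2 : ℝ) ^ Nat.size p) ^ 4 * 2 ^ 10 := by
              rw [hLdef, ← pow_mul, ← pow_add]
              congr 1
              ring
          _ ≤ (2 * p) ^ 4 * 2 ^ 10 := by gcongr
          _ = _ := by ring
      rw [one_div_pow]
      exact one_div_le_one_div_of_le (by positivity) h2
    -- The exponent collects `2 ^ 14` from the normalization, a factor `4` from the number of
    -- outcomes and a factor `4` from the rounding loss in the amplitude.
    calc ((orderOf a : ℝ) / p) ^ 2 / 2 ^ 18
        = ((p : ℝ) / 2) ^ 2 * (1 / (2 ^ 14 * (p : ℝ) ^ 4) * ((orderOf a : ℝ) / 2) ^ 2) := by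
          field_simp
      _ ≤ S.card * ((1 / 2 : ℝ) ^ (2 * Nat.size p + 2 * L) * ((orderOf a : ℝ) / 2) ^ 2) := by
          gcongr
      _ = ∑ _x ∈ S, (1 / 2 : ℝ) ^ (2 * Nat.size p + 2 * L) * ((orderOf a : ℝ) / 2) ^ 2 := by
          rw [Finset.sum_const, nsmul_eq_mul]
      _ ≤ _ := Finset.sum_le_sum hamp
  · rintro ⟨t, z⟩ hx ⟨t', z'⟩ hx' h
    have hx1 := (Finset.mem_Ico.1 (Finset.mem_product.1 (Finset.mem_coe.1 hx)).1).2
    have hx1' := (Finset.mem_Ico.1 (Finset.mem_product.1 (Finset.mem_coe.1 hx')).1).2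
    obtain ⟨-, h2, h3⟩ := registers_inj.1 h
    have h4 := congrArg (fun x => scaledFloor p (x ∘ Fin.rev)) h2
    simp only at h4 hx1 hx1'
    rw [scaledFloor_frequency hpL hx1, scaledFloor_frequency hpL hx1'] at h4
    exact Prod.ext h4 (hφ h3)
  · rintro ⟨t, z⟩ hx
    have hx1 := Finset.mem_Ico.1 (Finset.mem_product.1 hx).1
    refine ⟨?_, candidate_not_mem ha _⟩
    simp only [g]
    rw [candidate_registers hpL b (by exact hx1.1) hx1.2]
    exact hb _

end QHedral

end HSP

end

noncomputable section

namespace HSP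

open Function

/-! ### Circuits for the hidden subgroup problem in `ℤ_q ⋉ ℤ_p` -/

namespace QHedral

variable {p : ℕ} [Fact p.Prime] {a : (ZMod p)ˣ} {m : ℕ}

theorem derives_mul_pow {X : Type} {p K : ℕ} [NeZero p] (hK : 2 * p ≤ 2 ^ K)
    {A : Set (X → Bool)} (hA : A.Nonempty) {s t : X → ZMod p} (hs : bitSet (residue K s) ⊆ A)
    (ht : bitSet (residue K t) ⊆ A) (z : ZMod p) {e : ℕ} (he : Nat.size e ≤ K) :
    Derives A (218 * K ^ 3) (bitSet (residue K fun x => z * (s x * t x ^ e))) := by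
  have hpow : Derives A (K + Nat.size e * (2 * (45 * K ^ 2 + 9 * K)))
      (bitSet (residue K fun x => t x ^ e)) := Derives.pow_residue hK ht hA e
  have hmul : Derives (A ∪ bitSet (residue K fun x => t x ^ e)) (45 * K ^ 2 + 9 * K)
      (bitSet (residue K fun x => s x * t x ^ e)) :=
    Derives.mul_residue hK (hs.trans Set.subset_union_left) Set.subset_union_right
      (hA.mono Set.subset_union_left)
  have hconst : Derives (A ∪ bitSet (residue K fun x => t x ^ e)) K
      (bitSet (residue K fun _ : X => z)) :=
    Derives.const_bitSet (hA.mono Set.subset_union_left) _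
  have hmul' : Derives (A ∪ bitSet (residue K fun x => t x ^ e) ∪
      (bitSet (residue K fun _ : X => z) ∪ bitSet (residue K fun x => s x * t x ^ e)))
      (45 * K ^ 2 + 9 * K) (bitSet (residue K fun x => z * (s x * t x ^ e))) :=
    Derives.mul_residue hK (Set.subset_union_left.trans Set.subset_union_right)
      (Set.subset_union_right.trans Set.subset_union_right)
      ((hA.mono Set.subset_union_left).mono Set.subset_union_left)
  refine (hpow.trans ((hconst.union hmul).trans hmul')).mono_cost ?_
  have h1 : Nat.size e * (2 * (45 * K ^ 2 + 9 * K)) ≤ K * (2 * (45 * K ^ 2 + 9 * K)) :=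
    Nat.mul_le_mul_right _ he
  have h2 : K ≤ K ^ 3 := Nat.le_self_pow (by norm_num) K
  have h3 : K ^ 2 ≤ K ^ 3 := by
    rcases Nat.eq_zero_or_pos K with rfl | h
    · simp
    · exact Nat.pow_le_pow_right h (by norm_num)
  have h4 : K * (2 * (45 * K ^ 2 + 9 * K)) = 90 * K ^ 3 + 18 * K ^ 2 := by ring
  omega

theorem derives_enc_mk {X : Type} {K : ℕ} (hK : Nat.size p ≤ K) {A : Set (X → Bool)}
    (hA : A.Nonempty) {r : X → ZMod p} (hr : bitSet (residue K r) ⊆ A)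
    (α : Subgroup.zpowers a) :
    Derives A (2 * Nat.size p) (Set.range fun b x => enc p a (mk α (r x)) b) := by
  refine (Derives.range_fintype (d := 1) fun b => ?_).mono_cost (by simp [two_mul])
  rcases b with j | j
  · exact Derives.const hA (((α : (ZMod p)ˣ) : ZMod p).val.testBit j)
  · refine Derives.base ?_
    rintro f rfl
    refine hr ⟨⟨j, by omega⟩, ?_⟩
    funext v
    have hj : (j : ℕ) < K := by omega
    simp only [residue]
    rw [BitVec.getLsbD_ofNat, decide_eq_true hj, Bool.true_and]
    rfl

theorem derives_candidate (a : (ZMod p)ˣ) (m : ℕ) :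
    Derives (Set.range fun w (v : SampleWires (Nat.size p + 5) m → Bool) => v w)
      (400 * (2 * Nat.size p + 6) ^ 3)
      (Set.range fun b (v : SampleWires (Nat.size p + 5) m → Bool) => enc p a (candidate a v) b) := by
  obtain ⟨L, hL⟩ : ∃ L, L = Nat.size p + 5 := ⟨_, rfl⟩
  -- The word length for exact products with `p`: `Nat.size p` bits, `L` more, and one for the sum
  -- of two residues.
  obtain ⟨K, hK⟩ : ∃ K, K = 2 * Nat.size p + 6 := ⟨_, rfl⟩
  rw [← hL, ← hK]
  have hp : p < 2 ^ Nat.size p := Nat.lt_size_self p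
  have hpLK : 2 * (p * 2 ^ L) ≤ 2 ^ K := by
    have h1 : p * 2 ^ L ≤ 2 ^ Nat.size p * 2 ^ L := Nat.mul_le_mul_right _ hp.le
    have h2 : 2 ^ K = 2 * (2 ^ Nat.size p * 2 ^ L) := by
      rw [← pow_add, ← pow_succ']
      congr 1
      omega
    omega
  have hpK : 2 * p ≤ 2 ^ K :=
    (Nat.mul_le_mul_left 2 (Nat.le_mul_of_pos_right p (by positivity))).trans hpLK
  have hne : (Set.range fun w (v : SampleWires L m → Bool) => v w).Nonempty :=
    ⟨_, Set.mem_range_self (Sum.inl (Sum.inl ⟨0, by omega⟩))⟩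
  have hs := Derives.scaledFloor (p := p) hpLK
    (f := fun j (v : SampleWires L m → Bool) => v (Sum.inl (Sum.inl (Fin.rev j))))
    (fun j => Set.mem_range_self _) hne
  have ht := Derives.scaledFloor (p := p) hpLK
    (f := fun j (v : SampleWires L m → Bool) => v (Sum.inl (Sum.inr (Fin.rev j))))
    (fun j => Set.mem_range_self _) hne
  have hquot := derives_mul_pow hpK (hne.mono Set.subset_union_left)
    (s := fun v => (scaledFloor p fun j => v (Sum.inl (Sum.inl (Fin.rev j))) : ZMod p))
    (t := fun v => (scaledFloor p fun j => v (Sum.inl (Sum.inr (Fin.rev j))) : ZMod p))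
    (Set.subset_union_left.trans (Set.subset_union_right (s := Set.range fun w (v : SampleWires L m → Bool) => v w)))
    (Set.subset_union_right.trans (Set.subset_union_right (s := Set.range fun w (v : SampleWires L m → Bool) => v w)))
    (1 - (a : ZMod p)) (e := p - 2) ((Nat.size_le_size (Nat.sub_le p 2)).trans (by omega))
  refine ((hs.union ht).trans (hquot.trans (derives_enc_mk (by omega)
    ((hne.mono Set.subset_union_left).mono Set.subset_union_left) Set.subset_union_right
    ⟨a, Subgroup.mem_zpowers a⟩))).mono_cost ?_
  have h1 : L * (45 * K + 8) ≤ K * (45 * K + 8) := Nat.mul_le_mul_right _ (by omega)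
  have h2 : K ≤ K ^ 2 := Nat.le_self_pow (by norm_num) K
  have h3 : K ^ 2 ≤ K ^ 3 := Nat.pow_le_pow_right (by omega) (by norm_num)
  have h4 : K * (45 * K + 8) = 45 * K ^ 2 + 8 * K := by ring
  omega

theorem circuit_size_le (n N k : ℕ) :
    (N + 1) * (2 * n + 1 + 2 * ((n + 5) * (n + 5 + 1)) + 400 * (2 * n + 6) ^ 3 +
      k * (2 * (2 * n) + 3) + (k + 1 + 2 * n) + 1) ≤ 600 * ((N + 1) * (k + 1) * (2 * n + 6) ^ 3) := by
  obtain ⟨K, hK⟩ : ∃ K, K = 2 * n + 6 := ⟨_, rfl⟩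
  rw [← hK]
  have h1 : 2 * n + 1 + 2 * ((n + 5) * (n + 5 + 1)) ≤ 2 * K ^ 2 := by
    rw [hK]
    nlinarith
  have h3 : K ≤ K ^ 3 := Nat.le_self_pow (by norm_num) K
  have h4 : K ^ 2 ≤ K ^ 3 := Nat.pow_le_pow_right (by omega) (by norm_num)
  have h5 : k * (2 * (2 * n) + 3) ≤ k * (2 * K ^ 3) := Nat.mul_le_mul_left _ (by omega)
  have h6 : k ≤ k * K ^ 3 := Nat.le_mul_of_pos_right _ (Nat.pow_pos (by omega))
  have h7 : 600 * ((N + 1) * (k + 1) * K ^ 3) =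
      (N + 1) * (600 * (k * K ^ 3) + 600 * K ^ 3) := by ring
  have h8 : k * (2 * K ^ 3) = 2 * (k * K ^ 3) := by ring
  rw [h7]
  exact Nat.mul_le_mul_left _ (by omega)

set_option synthInstance.maxSize 1000 in
theorem exists_circuit (ha : (orderOf a).Prime) (m N k : ℕ) :
    ∃ (W : Type) (_ : Fintype W) (_ : DecidableEq W)
      (c : Circuit (Fin (Nat.size p) ⊕ Fin (Nat.size p)) m W),
      c.size ≤ 600 * ((N + 1) * (k + 1) * (2 * Nat.size p + 6) ^ 3) ∧
      ∀ (H : Subgroup (QHedral p a)) (f : QHedral p a → Fin m → Bool), Hides f H →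
        1 - (N + 1) * (1 / 2) ^ k - (1 - ((orderOf a : ℝ) / p) ^ 2 / 2 ^ 18) ^ N ≤
          c.prob (oracle (enc p a) f) (correctOutcomes (enc p a) c H) := by
  obtain ⟨gs, hlen, hgs⟩ := exists_fourier_sampling ha m
  obtain ⟨cl, o, hlcl, hcl⟩ := (derives_candidate a m).compile (β := Fin (Nat.size p) ⊕ Fin (Nat.size p)) (m := m)
  -- The cost of the fixed candidate is raised to that of the sampled ones, so that all candidates
  -- live on the same type of wires.
  have hconst : Derives (Set.range fun w (v : SampleWires (Nat.size p + 5) m → Bool) => v w)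
      (400 * (2 * Nat.size p + 6) ^ 3) (Set.range fun b (_ : SampleWires (Nat.size p + 5) m → Bool) =>
        enc p a (translation p a) b) := by
    refine (Derives.range_fintype (d := 1) fun b => Derives.const
      ⟨_, Set.mem_range_self (Sum.inl (Sum.inl ⟨0, by omega⟩))⟩ _).mono_cost ?_
    have h1 : 2 * Nat.size p + 6 ≤ (2 * Nat.size p + 6) ^ 3 := Nat.le_self_pow (by norm_num) _
    simp only [Fintype.card_sum, Fintype.card_fin, mul_one]
    omega
  obtain ⟨cl₀, o₀, hlcl₀, hcl₀⟩ := hconst.compile (β := Fin (Nat.size p) ⊕ Fin (Nat.size p)) (m := m)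
  have hne : Nonempty (SampleWires (Nat.size p + 5) m ⊕ Fin (400 * (2 * Nat.size p + 6) ^ 3)) :=
    ⟨Sum.inl (Sum.inl (Sum.inl ⟨0, by omega⟩))⟩
  let g : Fin (N + 1) → List (Gate (Fin (Nat.size p) ⊕ Fin (Nat.size p)) m (SampleWires (Nat.size p + 5) m ⊕ Fin (400 * (2 * Nat.size p + 6) ^ 3))) :=
    fun i => if i = 0 then cl₀ else gs.map (Gate.map ⟨Sum.inl, Sum.inl_injective⟩) ++ cl
  let o' : Fin (N + 1) → Fin (Nat.size p) ⊕ Fin (Nat.size p) → SampleWires (Nat.size p + 5) m ⊕ Fin (400 * (2 * Nat.size p + 6) ^ 3) :=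
    fun i => if i = 0 then o₀ else o
  have hmass₀ : ∀ (f : QHedral p a → Fin m → Bool)
      (E : Set (Fin (Nat.size p) ⊕ Fin (Nat.size p) → Bool)),
      mass (run (oracle (enc p a) f) (g 0) zeroState) {v | v ∘ o' 0 ∈ E} =
        mass (zeroState : QState (SampleWires (Nat.size p + 5) m)) {_v | enc p a (translation p a) ∈ E} := by
    intro f E
    simp only [g, o', if_true]
    rw [← padded_zeroState]
    exact hcl₀ _ _ E
  have hmass : ∀ i ≠ 0, ∀ (f : QHedral p a → Fin m → Bool)
      (E : Set (Fin (Nat.size p) ⊕ Fin (Nat.size p) → Bool)),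
      mass (run (oracle (enc p a) f) (g i) zeroState) {v | v ∘ o' i ∈ E} =
        mass (run (oracle (enc p a) f) gs zeroState) {v | enc p a (candidate a v) ∈ E} := by
    intro i hi f E
    simp only [g, o', if_neg hi]
    rw [run_append, ← padded_zeroState, run_map_inl]
    exact hcl _ _ E
  have hempty : ∀ ψ : QState (SampleWires (Nat.size p + 5) m), mass ψ ∅ = 0 := fun ψ => by simp [mass]
  have hρ : ((orderOf a : ℝ) / p) ^ 2 / 2 ^ 18 ≤ 1 := by
    have hp0 : (0 : ℝ) < p := by exact_mod_cast (Fact.out : p.Prime).pos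
    have hq : orderOf a ≤ p := by
      have h1 : orderOf a ≤ Fintype.card (ZMod p)ˣ := orderOf_le_card_univ
      rw [ZMod.card_units] at h1
      omega
    have h1 : (orderOf a : ℝ) / p ≤ 1 := by
      rw [div_le_one hp0]
      exact_mod_cast hq
    have h2 : ((orderOf a : ℝ) / p) ^ 2 ≤ 1 := pow_le_one₀ (by positivity) h1
    linarith
  obtain ⟨c, hc, hprob⟩ := exists_circuit_of_samplers (enc p a) (translations p a)
    (translation p a) (fun H H' hle h1 h2 => eq_of_le_of_mem ha hle h1 h2) N k
    (2 * Nat.size p + 1 + 2 * ((Nat.size p + 5) * (Nat.size p + 5 + 1)) + 400 * (2 * Nat.size p + 6) ^ 3) _ hρ g (by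
      intro i
      by_cases hi : i = 0
      · simp only [g, if_pos hi]
        omega
      · simp only [g, if_neg hi]
        rw [List.length_append, List.length_map]
        omega) o' (by
      intro i f
      by_cases hi : i = 0
      · subst hi
        refine (hmass₀ f (Set.range (enc p a))ᶜ).trans ((congrArg _ ?_).trans (hempty _))
        exact Set.eq_empty_of_forall_notMem fun v hv => hv ⟨_, rfl⟩
      · refine (hmass i hi f (Set.range (enc p a))ᶜ).trans ((congrArg _ ?_).trans (hempty _))
        exact Set.eq_empty_of_forall_notMem fun v hv => hv ⟨_, rfl⟩) (by
      intro f
      rw [hmass₀ f {enc p a (translation p a)}, ← mass_zeroState_univ (W := SampleWires (Nat.size p + 5) m)]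
      congr 1
      exact Set.eq_univ_of_forall fun v => rfl) (by
      intro i hi f H hf hH
      rw [hmass i hi f]
      refine (hgs f H hf hH).trans (mass_mono _ fun v hv => ?_)
      exact ⟨_, hv, rfl⟩)
  refine ⟨_, inferInstance, inferInstance, c, hc.trans ?_, hprob⟩
  have hcard : Fintype.card (Fin (Nat.size p) ⊕ Fin (Nat.size p)) = 2 * Nat.size p := by
    simp [two_mul]
  rw [hcard]
  exact circuit_size_le _ N k

end QHedral

end HSP

end

noncomputable section

namespace HSP

open Function

/-! ### Full reconstructibility -/

theorem size_le_of_log_le {p : ℕ} (hp : 0 < p) {T : ℝ} (hT : 1 ≤ T) (h : 1 + Real.log p ≤ T) :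
    ((2 * Nat.size p + 6 : ℕ) : ℝ) ≤ 11 * T := by
  have h1 : 2 ^ (Nat.size p - 1) ≤ p := by
    apply Nat.lt_size.1
    have : 0 < Nat.size p := Nat.size_pos.2 hp
    omega
  have h2 : ((Nat.size p - 1 : ℕ) : ℝ) * Real.log 2 ≤ Real.log p := by
    rw [← Real.log_pow]
    exact Real.log_le_log (by positivity) (by exact_mod_cast h1)
  have h3 : (Nat.size p : ℝ) ≤ ((Nat.size p - 1 : ℕ) : ℝ) + 1 := by
    have : Nat.size p ≤ Nat.size p - 1 + 1 := by omega
    exact_mod_cast this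
  have h4 : (1 / 2 : ℝ) ≤ Real.log 2 := by linarith [Real.log_two_gt_d9]
  have h5 : ((Nat.size p - 1 : ℕ) : ℝ) * (1 / 2) ≤ ((Nat.size p - 1 : ℕ) : ℝ) * Real.log 2 :=
    mul_le_mul_of_nonneg_left h4 (Nat.cast_nonneg _)
  push_cast
  linarith

/-- The numbers of samples and of checks that make the two error terms small. -/
theorem exists_repetitions {ρ ε T B : ℝ} {e : ℕ} (hρ : 0 < ρ) (hρ1 : ρ ≤ 1) (hε : 0 < ε)
    (hT : 1 ≤ T) (hεT : 1 + Real.log (1 / ε) ≤ T) (hρB : 1 / ρ ≤ B * T ^ e) :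
    ∃ N k : ℕ, (N + 1 : ℝ) * (1 / 2) ^ k + (1 - ρ) ^ N ≤ ε ∧
      (N : ℝ) + 1 ≤ (B + 2) * T ^ (e + 1) ∧ (k : ℝ) + 1 ≤ (2 * B + 8) * T ^ (e + 1) := by
  have hT0 : 0 < T := by linarith
  have hTe : 1 ≤ T ^ e := one_le_pow₀ hT
  have hTe' : 1 ≤ T ^ (e + 1) := one_le_pow₀ hT
  have hTT : T ≤ T ^ (e + 1) := le_self_pow₀ hT (Nat.succ_ne_zero e)
  have hl2 : (1 / 2 : ℝ) ≤ Real.log 2 := by linarith [Real.log_two_gt_d9]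
  have hl2' : Real.log 2 ≤ 1 := by linarith [Real.log_two_lt_d9]
  have hlε : Real.log (2 / ε) ≤ T := by
    rw [show 2 / ε = 2 * (1 / ε) by ring, Real.log_mul (by norm_num) (by positivity)]
    linarith
  -- Then `(1 - ρ) ^ N ≤ exp (-N * ρ) ≤ exp (-T) ≤ ε / 2`.
  obtain ⟨N, hN⟩ : ∃ N, N = ⌈T / ρ⌉₊ := ⟨_, rfl⟩
  have hN1 : T / ρ ≤ N := hN ▸ Nat.le_ceil _
  have hN2 : (N : ℝ) < T / ρ + 1 := hN ▸ Nat.ceil_lt_add_one (by positivity)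
  have hNB : (N : ℝ) + 1 ≤ (B + 2) * T ^ (e + 1) := by
    have h1 : T / ρ ≤ B * T ^ (e + 1) := by
      calc T / ρ = T * (1 / ρ) := by ring
        _ ≤ T * (B * T ^ e) := mul_le_mul_of_nonneg_left hρB hT0.le
        _ = B * T ^ (e + 1) := by ring
    linarith
  have hpow : (1 - ρ) ^ N ≤ ε / 2 := by
    have h1 : (1 - ρ) ^ N ≤ Real.exp (-ρ) ^ N :=
      pow_le_pow_left₀ (by linarith) (Real.one_sub_le_exp_neg ρ) N
    have h2 : Real.exp (-ρ) ^ N = Real.exp (-(N * ρ)) := by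
      rw [← Real.exp_nat_mul]
      congr 1
      ring
    have h3 : T ≤ N * ρ := (div_le_iff₀ hρ).1 hN1
    have h4 : Real.exp (-(N * ρ)) ≤ Real.exp (-Real.log (2 / ε)) :=
      Real.exp_le_exp.2 (by linarith)
    rw [Real.exp_neg (Real.log _), Real.exp_log (by positivity), inv_div] at h4
    linarith
  -- As `log 2 ≥ 1 / 2`, this makes `(1 / 2) ^ k ≤ exp (-(T + N + 1))`. The summand `N + 1` absorbs
  -- the factor of the union bound by `x * exp (-x) ≤ 1`.
  obtain ⟨k, hk⟩ : ∃ k, k = ⌈2 * (T + (N + 1))⌉₊ := ⟨_, rfl⟩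
  have hk1 : 2 * (T + (N + 1)) ≤ k := hk ▸ Nat.le_ceil _
  have hk2 : (k : ℝ) < 2 * (T + (N + 1)) + 1 := hk ▸ Nat.ceil_lt_add_one (by positivity)
  refine ⟨N, k, ?_, hNB, by linarith⟩
  have h1 : ((1 : ℝ) / 2) ^ k ≤ Real.exp (-(T + (N + 1))) := by
    have h2 : (1 / 2 : ℝ) = Real.exp (-Real.log 2) := by
      rw [Real.exp_neg, Real.exp_log (by norm_num), one_div]
    rw [h2, ← Real.exp_nat_mul]
    refine Real.exp_le_exp.2 ?_
    have h3 : (k : ℝ) * (1 / 2) ≤ k * Real.log 2 :=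
      mul_le_mul_of_nonneg_left hl2 (Nat.cast_nonneg _)
    linarith
  have h2 : (N + 1 : ℝ) * Real.exp (-(N + 1)) ≤ 1 := by
    have h3 : (N : ℝ) + 1 ≤ Real.exp (N + 1) := by linarith [Real.add_one_le_exp ((N : ℝ) + 1)]
    rw [Real.exp_neg, ← div_eq_mul_inv, div_le_one (Real.exp_pos _)]
    exact h3
  have h3 : Real.exp (-T) ≤ ε / 2 := by
    have h4 : Real.exp (-T) ≤ Real.exp (-Real.log (2 / ε)) := Real.exp_le_exp.2 (by linarith)
    rwa [Real.exp_neg (Real.log _), Real.exp_log (by positivity), inv_div] at h4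
  have h4 : (N + 1 : ℝ) * (1 / 2) ^ k ≤ ε / 2 := by
    calc (N + 1 : ℝ) * (1 / 2) ^ k ≤ (N + 1) * Real.exp (-(T + (N + 1))) :=
          mul_le_mul_of_nonneg_left h1 (by positivity)
      _ = ((N + 1) * Real.exp (-(N + 1))) * Real.exp (-T) := by
          rw [neg_add, Real.exp_add]
          ring
      _ ≤ 1 * Real.exp (-T) := mul_le_mul_of_nonneg_right h2 (Real.exp_pos _).le
      _ ≤ ε / 2 := by linarith
  linarith

namespace QHedral

theorem le_card {p : ℕ} [Fact p.Prime] (a : (ZMod p)ˣ) : p ≤ Nat.card (QHedral p a) := by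
  -- Finiteness is needed because `Nat.card` of an infinite type is zero.
  have : Finite (QHedral p a) :=
    Finite.of_equiv (Multiplicative (ZMod p) × Subgroup.zpowers a)
      SemidirectProduct.equivProd.symm
  have h := Nat.card_le_card_of_injective
    (SemidirectProduct.inl : Multiplicative (ZMod p) →* QHedral p a)
    SemidirectProduct.inl_injective
  have h' : Nat.card (Multiplicative (ZMod p)) = p := Nat.card_zmod p
  rwa [h'] at h

end QHedral

/-- The polylogarithmic bound on the index enters here: with `p ≤ 2 * (p - 1)` it bounds the
reciprocal of the success probability of one sample by a polynomial in `T`. -/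
theorem Params.one_div_le {A : ℝ} {d : ℕ} (i : Params A d) {T : ℝ} (hT : Real.log i.p ≤ T) :
    1 / (((i.q : ℝ) / i.p) ^ 2 / 2 ^ 18) ≤ 2 ^ 20 * A ^ 2 * T ^ (2 * d) := by
  have hp : (2 : ℝ) ≤ i.p := by exact_mod_cast i.prime_p.two_le
  have hq : (0 : ℝ) < i.q := by exact_mod_cast i.prime_q.pos
  have hlog : 0 ≤ Real.log i.p := Real.log_nonneg (by linarith)
  have h1 : (i.p : ℝ) / i.q ≤ 2 * (|A| * T ^ d) := by
    calc (i.p : ℝ) / i.q ≤ (2 * (i.p - 1)) / i.q := by gcongr; linarith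
      _ = 2 * ((i.p - 1) / i.q) := by ring
      _ ≤ 2 * (A * Real.log i.p ^ d) := by linarith [i.index_le]
      _ ≤ 2 * (|A| * Real.log i.p ^ d) := by gcongr; exact le_abs_self A
      _ ≤ 2 * (|A| * T ^ d) := by gcongr
  calc 1 / (((i.q : ℝ) / i.p) ^ 2 / 2 ^ 18) = 2 ^ 18 * ((i.p : ℝ) / i.q) ^ 2 := by
        field_simp
    _ ≤ 2 ^ 18 * (2 * (|A| * T ^ d)) ^ 2 := by gcongr
    _ = 2 ^ 20 * |A| ^ 2 * T ^ (2 * d) := by ring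
    _ = 2 ^ 20 * A ^ 2 * T ^ (2 * d) := by rw [sq_abs]

end HSP

end

/-- For every polylogarithmic bound `A * (log p) ^ d` on `(p - 1) / q`, subgroups of the groups
`ℤ_q ⋉ ℤ_p`, with `p` and `q` primes that obey this bound, are fully reconstructible. -/
theorem theorem1 (A : ℝ) (d : ℕ) :
    HSP.FullyReconstructible
      (fun i : HSP.Params A d => HSP.QHedral i.p i.a)
      (fun i => Fin (Nat.size i.p) ⊕ Fin (Nat.size i.p))
      (fun i => HSP.QHedral.enc i.p i.a) := by
  obtain ⟨B, hB⟩ : ∃ B : ℝ, B = 2 ^ 20 * A ^ 2 := ⟨_, rfl⟩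
  have hB0 : 0 ≤ B := by rw [hB]; positivity
  -- The exponent counts the number of samples, the number of tests, and the cubic cost of one
  -- candidate in the bit length of `p`.
  refine ⟨600 * ((B + 2) * (2 * B + 8) * 11 ^ 3), (2 * d + 1) + (2 * d + 1) + 3,
    fun i m ε hε hε1 => ?_⟩
  have : Fact i.p.Prime := ⟨i.prime_p⟩
  obtain ⟨T, hTdef⟩ : ∃ T : ℝ, T = 1 + Real.log (Nat.card (HSP.QHedral i.p i.a)) +
    Real.log (1 / ε) := ⟨_, rfl⟩
  simp only [← hTdef]
  have hp : 0 < i.p := i.prime_p.pos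
  have hp1 : (1 : ℝ) ≤ i.p := by exact_mod_cast hp
  have hq : (0 : ℝ) < i.q := by exact_mod_cast i.prime_q.pos
  have hcard : Real.log i.p ≤ Real.log (Nat.card (HSP.QHedral i.p i.a)) :=
    Real.log_le_log (by linarith) (by exact_mod_cast HSP.QHedral.le_card i.a)
  have hlogp : 0 ≤ Real.log i.p := Real.log_nonneg hp1
  have hlogε : 0 ≤ Real.log (1 / ε) := Real.log_nonneg ((one_le_div hε).2 hε1.le)
  have hT : 1 ≤ T := by linarith
  have hρ0 : 0 < ((i.q : ℝ) / i.p) ^ 2 / 2 ^ 18 := by positivity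
  have hqp : i.q ≤ i.p := by
    have h1 : orderOf i.a ≤ Fintype.card (ZMod i.p)ˣ := orderOf_le_card_univ
    rw [ZMod.card_units, i.orderOf_a] at h1
    omega
  have hρ1 : ((i.q : ℝ) / i.p) ^ 2 / 2 ^ 18 ≤ 1 := by
    have h1 : (i.q : ℝ) / i.p ≤ 1 := (div_le_one (by linarith)).2 (by exact_mod_cast hqp)
    have h2 : ((i.q : ℝ) / i.p) ^ 2 ≤ 1 := pow_le_one₀ (by positivity) h1
    linarith
  obtain ⟨N, k, herr, hN, hk⟩ := HSP.exists_repetitions hρ0 hρ1 hε hT (by linarith)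
    (hB ▸ i.one_div_le (T := T) (by linarith))
  obtain ⟨W, hW, hW', c, hsize, hprob⟩ := HSP.QHedral.exists_circuit (a := i.a)
    (i.orderOf_a ▸ i.prime_q) m N k
  refine ⟨W, hW, hW', c, ?_, fun H f hf => ?_⟩
  · have hK := HSP.size_le_of_log_le (T := T) hp hT (by linarith)
    have hT0 : 0 < T := by linarith
    calc (c.size : ℝ) ≤ 600 * ((N + 1) * (k + 1) * ((2 * Nat.size i.p + 6 : ℕ) : ℝ) ^ 3) := by
          exact_mod_cast hsize
      _ ≤ 600 * (((B + 2) * T ^ (2 * d + 1)) * ((2 * B + 8) * T ^ (2 * d + 1)) *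
          (11 * T) ^ 3) := by gcongr
      _ = 600 * ((B + 2) * (2 * B + 8) * 11 ^ 3) * T ^ ((2 * d + 1) + (2 * d + 1) + 3) := by
          ring
  · refine le_trans ?_ (hprob H f hf)
    rw [i.orderOf_a]
    linarith
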